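/- **Setting.** Let $n\ge 2$ and $N\ge 1$ be integers and let $A=(A_{ij})_{0\le i,j\le n}$ be the Cartan matrix of affine type $A_n^{(1)}$ ($A_{ii}=2$, $A_{ij}=-1$ if $i-j\equiv\pm1 \bmod (n+1)$, and $A_{ij}=0$ otherwise). The toroidal Lie algebra $\tau(A_n)$ is the complex Lie algebra with generators $K_{\mathbf m,l}$, $H_i(\mathbf m)$, $E_i(\mathbf m)$, $F_i(\mathbf m)$ ($0\le i\le n$, $0\le l\le N$, $\mathbf m\in\mathbb Z^{N+1}$) and relations, for all indices: $K_{\mathbf m,l}$ is central; $\sum_{l} m_lK_{\mathbf m,l}=0$; $$[H_i(\mathbf m),H_j(\mathbf k)]=A_{ij}\sum_{l} m_lK_{\mathbf m+\mathbf k,l},\quad [H_i(\mathbf m),E_j(\mathbf k)]=A_{ij}E_j(\mathbf m+\mathbf k),\quad [H_i(\mathbf m),F_j(\mathbf k)]=-A_{ij}F_j(\mathbf m+\mathbf k),$$ $$[E_i(\mathbf m),F_j(\mathbf k)]=-\delta_{ij}\Big(H_i(\mathbf m+\mathbf k)+\tfrac{2}{A_{ii}}\sum_{l} m_lK_{\mathbf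 m+\mathbf k,l}\Big),\quad [E_i(\mathbf m),E_i(\mathbf k)]=0=[F_i(\mathbf m),F_i(\mathbf k)],$$ $$(\mathrm{ad}\,E_i(\mathbf m))^{1-A_{ij}}E_j(\mathbf k)=0=(\mathrm{ad}\,F_i(\mathbf m))^{1-A_{ij}}F_j(\mathbf k)\qquad(i\ne j).$$ Fix a decomposition $\mathbb Z^{N+1}=\mathbb Z^{N+1}_-\sqcup\{\mathbf 0\}\sqcup\mathbb Z^{N+1}_+$ with $\mathbb Z^{N+1}_\pm$ closed under addition; write $\mathbf m>0$ if $\mathbf m\in\mathbb Z^{N+1}_+$, and let $\theta(\mathbf m)=1$ if $\mathbf m>0$ and $\theta(\mathbf m)=0$ otherwise. Let $$\mathbb C[\mathbf x]=\mathbb C[x_{ij}(\mathbf m):0<i<j\le n+1,\ \mathbf m\in\mathbb Z^{N+1}],\qquad \mathbb C[\mathbf y]=\mathbb C[y_i(\mathbf k):1\le i\le n,\ \mathbf k>0].$$ Let $\kappa_{\mathbf m,p}\in\mathbb C$ ($\mathbf m\in\mathbb Z^{N+1}$, $0\le p\le N$) and $\lambda_i\in\mathbb C$ be given. On $\mathbb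 C[\mathbf y]$ put, for $1\le i\le n$, $$\Phi(b_i)(\mathbf m)=\theta(-\mathbf m)\sum_{\mathbf s>0}\sum_p m_p\kappa_{-\mathbf m+\mathbf s,p}\big(\partial_{y_{i-1}(\mathbf s)}-\partial_{y_i(\mathbf s)}\big)+\theta(\mathbf m)\sum_{\mathbf s>0}\sum_p m_p\kappa_{-\mathbf m+\mathbf s,p}\big(\partial_{y_{i-1}(\mathbf s)}-2\partial_{y_i(\mathbf s)}+\partial_{y_{i+1}(\mathbf s)}\big)+\theta(-\mathbf m)y_i(-\mathbf m)-\delta_{\mathbf m,\mathbf 0}\lambda_i$$ (with $\partial_{y_0(\mathbf s)}=\partial_{y_{n+1}(\mathbf s)}=0$) and $\Phi(b_0)(\mathbf m)=-\sum_{i=1}^n\Phi(b_i)(\mathbf m)$. On $\mathbb C[\mathbf x]\otimes\mathbb C[\mathbf y]$ let $a_{ij,\mathbf m}=-x_{ij}(\mathbf m)$ and $a^*_{ij,\mathbf m}=\partial/\partial x_{ij}(-\mathbf m)$ act on the first factor and $\Phi(b_i)(\mathbf m)$ on the second, and let $a_{ij}(\mathbf z)=\sum_{\mathbf m} a_{ij,\mathbf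 m}\mathbf z^{-\mathbf m}$, $a^*_{ij}(\mathbf z)=\sum_{\mathbf m} a^*_{ij,\mathbf m}\mathbf z^{-\mathbf m}$, $\Phi(b_i)(\mathbf z)=\sum_{\mathbf m}\Phi(b_i)(\mathbf m)\mathbf z^{-\mathbf m}$, $$\kappa\cdot D\,a^*_{ij}(\mathbf z)=\sum_{p=0}^N\Big(\sum_{\mathbf m}\kappa_{\mathbf m,p}\mathbf z^{\mathbf m}\Big)z_p\frac{\partial}{\partial z_p}a^*_{ij}(\mathbf z).$$ All products below, with the $a_{ij}$ to the left of the $a^*_{kl}$, have coefficients that are finite sums on every vector. **Theorem (Realization).** Assume $$\sum_{p=0}^N m_p\kappa_{\mathbf m,p}=0\ \text{ for all }\mathbf m,\qquad \sum_{p=0}^N m_p\kappa_{-\mathbf m-\mathbf k,p}=0\ \text{ for all }\mathbf m>0,\ \mathbf k>0.$$ Define, suppressing $\mathbf z$, for $1\le r\le n$, $$\rho(F_r)=a_{r,r+1}-\sum_{j=1}^{r-1}a_{j,r+1}a^*_{jr},$$ $$\rho(H_r)=2a_{r,r+1}a^*_{r,r+1}+\sum_{i=1}^{r-1}(a_{i,r+1}a^*_{i,r+1}-a_{ir}a^*_{ir})+\sum_{j=r+2}^{n+1}(a_{rj}a^*_{rj}-a_{r+1,j}a^*_{r+1,j})+\Phi(b_r),$$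 $$\rho(E_r)=a_{r,r+1}a^*_{r,r+1}a^*_{r,r+1}-\sum_{j=r+2}^{n+1}a_{r+1,j}a^*_{rj}+\sum_{j=1}^{r-1}a_{jr}a^*_{j,r+1}+\sum_{j=r+2}^{n+1}(a_{rj}a^*_{rj}-a_{r+1,j}a^*_{r+1,j})a^*_{r,r+1}+a^*_{r,r+1}\Phi(b_r)+\kappa\cdot Da^*_{r,r+1},$$ and $$\rho(E_0)=-a_{1,n+1},\qquad \rho(H_0)=-\sum_{r=1}^{n}a_{r,n+1}a^*_{r,n+1}-\sum_{r=2}^{n+1}a_{1r}a^*_{1r}+\Phi(b_0),$$ $$\rho(F_0)=-\sum_{1\le r<j\le n+1}a_{rj}\sum_{\substack{\mathbf q:\ q_i=j\\ q_{i-1}\le r}}\Big(\prod_{l=1}^{i-1}a^*_{q_lq_{l+1}}\Big)a^*_{r,n+1}-\sum_{r=1}^n\ \sum_{\mathbf q:\ q_i\le r}\Big(\prod_{l=1}^{i}a^*_{q_lq_{l+1}}\Big)\Phi(b_r)-\sum_{r=1}^n\ \sum_{\mathbf q:\ q_i=r}\Big(\prod_{l=1}^{i-1}a^*_{q_lq_{l+1}}\Big)\kappa\cdot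 Da^*_{r,n+1},$$ where $\mathbf q$ runs over all finite sequences $1=q_1<q_2<\dots<q_i$ of integers (any length $i\ge1$) with the stated restrictions, and $q_{i+1}:=n+1$. Then there is a unique representation $\rho$ of $\tau(A_n)$ on $\mathbb C[\mathbf x]\otimes\mathbb C[\mathbf y]$ in which $E_r(\mathbf m)$, $F_r(\mathbf m)$, $H_r(\mathbf m)$ ($0\le r\le n$) act as the coefficients of $\mathbf z^{-\mathbf m}$ in $\rho(E_r)$, $\rho(F_r)$, $\rho(H_r)$, and $K_{\mathbf m,l}$ acts as the scalar $-\kappa_{-\mathbf m,l}$. Moreover $\rho(H_0)=-\sum_{r=1}^n\rho(H_r)$. -/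

import Mathlib

open scoped TensorProduct

attribute [local instance 100] LieRing.ofAssociativeRing

namespace Toroidal

/-- The lattice of multi-indices `ℤ^{N+1}`. -/
abbrev Idx (N : ℕ) : Type := Fin (N + 1) → ℤ

/-- A decomposition of `ℤ^{N+1}` into disjoint sets `neg`, `{0}`, `pos`, with `pos` and `neg`
closed under addition. -/
structure SignDecomposition (N : ℕ) where
  pos : Set (Idx N)
  neg : Set (Idx N)
  zero_notMem_pos : (0 : Idx N) ∉ pos
  zero_notMem_neg : (0 : Idx N) ∉ neg
  disjoint : Disjoint neg pos
  union_eq : neg ∪ {0} ∪ pos = Set.univ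
  add_mem_pos : ∀ {j k : Idx N}, j ∈ pos → k ∈ pos → j + k ∈ pos
  add_mem_neg : ∀ {j k : Idx N}, j ∈ neg → k ∈ neg → j + k ∈ neg

/-! ### The toroidal Lie algebra by generators and relations -/

/-- The Cartan matrix of affine type `A_n^{(1)}`, `n ≥ 2`, with rows and columns `0, …, n`
(addition in `Fin (n + 1)` is cyclic). -/
def affineCartan (n : ℕ) (i j : Fin (n + 1)) : ℤ :=
  if i = j then 2 else if i + 1 = j ∨ j + 1 = i then -1 else 0

/-- The generators. -/
inductive Gen (n N : ℕ) : Type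
  | K (m : Idx N) (l : Fin (N + 1)) : Gen n N
  | H (i : Fin (n + 1)) (m : Idx N) : Gen n N
  | E (i : Fin (n + 1)) (m : Idx N) : Gen n N
  | F (i : Fin (n + 1)) (m : Idx N) : Gen n N

noncomputable section

/-- A generator as an element of the free Lie algebra. -/
abbrev gen {n N : ℕ} (g : Gen n N) : FreeLieAlgebra ℂ (Gen n N) := FreeLieAlgebra.of ℂ g

/-- `∑_l m_l K_{r,l}` in the free Lie algebra. -/
def sumK {n N : ℕ} (m r : Idx N) : FreeLieAlgebra ℂ (Gen n N) :=
  ∑ l, (m l : ℂ) • gen (Gen.K r l)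

open LieAlgebra in
/-- The relators: `Relator x` means that `x = 0` is one of the defining relations. -/
inductive Relator (n N : ℕ) : FreeLieAlgebra ℂ (Gen n N) → Prop
  | central (m : Idx N) (l : Fin (N + 1)) (g : Gen n N) :
      Relator n N ⁅gen (n := n) (Gen.K m l), gen g⁆
  | sumK (m : Idx N) : Relator n N (sumK m m)
  | HH (i j : Fin (n + 1)) (m k : Idx N) :
      Relator n N (⁅gen (n := n) (Gen.H i m), gen (Gen.H j k)⁆
        - (affineCartan n i j : ℂ) • Toroidal.sumK m (m + k))
  | HE (i j : Fin (n + 1)) (m k : Idx N) :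
      Relator n N (⁅gen (n := n) (Gen.H i m), gen (Gen.E j k)⁆
        - (affineCartan n i j : ℂ) • gen (Gen.E j (m + k)))
  | HF (i j : Fin (n + 1)) (m k : Idx N) :
      Relator n N (⁅gen (n := n) (Gen.H i m), gen (Gen.F j k)⁆
        + (affineCartan n i j : ℂ) • gen (Gen.F j (m + k)))
  | EF_same (i : Fin (n + 1)) (m k : Idx N) :
      Relator n N (⁅gen (n := n) (Gen.E i m), gen (Gen.F i k)⁆
        + (gen (Gen.H i (m + k))
          + (2 / (affineCartan n i i : ℂ)) • Toroidal.sumK m (m + k)))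
  | EF_ne (i j : Fin (n + 1)) (hij : i ≠ j) (m k : Idx N) :
      Relator n N ⁅gen (n := n) (Gen.E i m), gen (Gen.F j k)⁆
  | EE (i : Fin (n + 1)) (m k : Idx N) : Relator n N ⁅gen (n := n) (Gen.E i m), gen (Gen.E i k)⁆
  | FF (i : Fin (n + 1)) (m k : Idx N) : Relator n N ⁅gen (n := n) (Gen.F i m), gen (Gen.F i k)⁆
  | serreE (i j : Fin (n + 1)) (hij : i ≠ j) (m k : Idx N) :
      Relator n N (((ad ℂ (FreeLieAlgebra ℂ (Gen n N)) (gen (Gen.E i m)))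
        ^ (-affineCartan n i j + 1).toNat) (gen (Gen.E j k)))
  | serreF (i j : Fin (n + 1)) (hij : i ≠ j) (m k : Idx N) :
      Relator n N (((ad ℂ (FreeLieAlgebra ℂ (Gen n N)) (gen (Gen.F i m)))
        ^ (-affineCartan n i j + 1).toNat) (gen (Gen.F j k)))

/-- The ideal of the free Lie algebra generated by the relators. -/
abbrev relatorIdeal (n N : ℕ) : LieIdeal ℂ (FreeLieAlgebra ℂ (Gen n N)) :=
  LieSubmodule.lieSpan ℂ (FreeLieAlgebra ℂ (Gen n N)) {x | Relator n N x}

/-- The toroidal Lie algebra `τ(A_n)`. -/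
abbrev ToroidalLieAlgebra (n N : ℕ) : Type :=
  FreeLieAlgebra ℂ (Gen n N) ⧸ relatorIdeal n N

/-- The image of a generator in `τ(A_n)`. -/
def ToroidalLieAlgebra.of {n N : ℕ} (g : Gen n N) : ToroidalLieAlgebra n N :=
  LieSubmodule.Quotient.mk (gen g)

/-! ### Formal series of operators -/

section Series

variable {V : Type*} [AddCommGroup V] [Module ℂ V] {N : ℕ}

/-- A formal series `A(z) = ∑_m A_m z^{-m}` with coefficients in `End V`; `A m` is `A_m`. -/
abbrev OpSeries (N : ℕ) (V : Type*) [AddCommGroup V] [Module ℂ V] : Type _ :=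
  Idx N → Module.End ℂ V

/-- A family of operators `(B_k)_{k ∈ ι}` such that for every vector `v` only finitely many
`B_k v` are nonzero, encoded by the linear map `v ↦ (k ↦ B_k v)`. -/
abbrev SummableFamily (ι : Type*) (V : Type*) [AddCommGroup V] [Module ℂ V] : Type _ :=
  V →ₗ[ℂ] (ι →₀ V)

/-- A pointwise finite family of operators as a `SummableFamily`. -/
def SummableFamily.ofFinite {ι : Type*} (B : ι → Module.End ℂ V)
    (h : ∀ v, (Function.support fun k => B k v).Finite) : SummableFamily ι V where
  toFun v := Finsupp.ofSupportFinite (fun k => B k v) (h v)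
  map_add' v w := Finsupp.ext fun k => map_add (B k) v w
  map_smul' c v := Finsupp.ext fun k => map_smul (B k) c v

/-- The operator `∑_k A_k ∘ B_k`, where `B` is summable and `A` is any family. -/
def SummableFamily.sumComp {ι : Type*} (A : ι → Module.End ℂ V) (B : SummableFamily ι V) :
    Module.End ℂ V :=
  Finsupp.lsum ℂ A ∘ₗ B

/-- The product `A(z) B(z)` of a formal series with a summable series:
`(A B)_m = ∑_k A_{m-k} ∘ B_k`. -/
def OpSeries.mul (A : OpSeries N V) (B : SummableFamily (Idx N) V) : OpSeries N V :=
  fun m => SummableFamily.sumComp (fun k => A (m - k)) B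

/-- The product `A(z) B(z)` of two summable series; it is again summable. -/
def SummableFamily.mul (A B : SummableFamily (Idx N) V) : SummableFamily (Idx N) V :=
  Finsupp.lsum ℂ (fun k => Finsupp.lmapDomain V ℂ (fun l => l + k) ∘ₗ A) ∘ₗ B

/-- The constant series `1`. -/
def SummableFamily.one : SummableFamily (Idx N) V := Finsupp.lsingle 0

/-- The Euler derivative `z_p ∂/∂z_p` of a summable series `∑_q B_q z^{-q}`. -/
def SummableFamily.euler (p : Fin (N + 1)) (B : SummableFamily (Idx N) V) :
    SummableFamily (Idx N) V :=
  Finsupp.lsum ℂ (fun q => (-(q p : ℂ)) • Finsupp.lsingle q) ∘ₗ B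

/-- The scalar series `∑_m κ_{m,p} z^m`; the coefficient of `z^{-m}` is `κ_{-m,p}`. -/
def kappaSeries (κ : Idx N → Fin (N + 1) → ℂ) (p : Fin (N + 1)) : OpSeries N V :=
  fun m => κ (-m) p • LinearMap.id

/-- `κ · D B (z) = ∑_p (∑_m κ_{m,p} z^m) z_p ∂B(z)/∂z_p`. -/
def kappaD (κ : Idx N → Fin (N + 1) → ℂ) (B : SummableFamily (Idx N) V) : OpSeries N V :=
  ∑ p, (kappaSeries κ p).mul (B.euler p)

end Series

/-! ### The polynomial rings and the elementary operators -/

/-- Index set of the variables `x_{ij}(m)`, `0 < i < j ≤ n + 1`. -/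
abbrev XVar (n N : ℕ) : Type :=
  {p : ℕ × ℕ // 0 < p.1 ∧ p.1 < p.2 ∧ p.2 ≤ n + 1} × Idx N

/-- Index set of the variables `y_i(k)`, `1 ≤ i ≤ n`, `k > 0`. -/
abbrev YVar (n : ℕ) {N : ℕ} (S : SignDecomposition N) : Type :=
  {p : ℕ × Idx N // (1 ≤ p.1 ∧ p.1 ≤ n) ∧ p.2 ∈ S.pos}

/-- The ring `ℂ[x]`. -/
abbrev CX (n N : ℕ) : Type := MvPolynomial (XVar n N) ℂ

/-- The ring `ℂ[y]`. -/
abbrev CY (n : ℕ) {N : ℕ} (S : SignDecomposition N) : Type := MvPolynomial (YVar n S) ℂ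

/-- The Fock space `ℂ[x] ⊗ ℂ[y]`. -/
abbrev Fock (n : ℕ) {N : ℕ} (S : SignDecomposition N) : Type := CX n N ⊗[ℂ] CY n S

/-- Multiplication by `x_{ij}(m)` on `ℂ[x]` (`0` unless `0 < i < j ≤ n + 1`). -/
def mulX (n : ℕ) {N : ℕ} (i j : ℕ) (m : Idx N) : Module.End ℂ (CX n N) :=
  if h : 0 < i ∧ i < j ∧ j ≤ n + 1 then
    LinearMap.mulLeft ℂ (MvPolynomial.X (⟨(i, j), h⟩, m))
  else 0

/-- `∂/∂x_{ij}(m)` on `ℂ[x]` (`0` unless `0 < i < j ≤ n + 1`). -/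
def derivX (n : ℕ) {N : ℕ} (i j : ℕ) (m : Idx N) : Module.End ℂ (CX n N) :=
  if h : 0 < i ∧ i < j ∧ j ≤ n + 1 then
    (MvPolynomial.pderiv (R := ℂ) ((⟨(i, j), h⟩, m) : XVar n N)).toLinearMap
  else 0

open Classical in
/-- Multiplication by `y_i(k)` on `ℂ[y]` (`0` unless `1 ≤ i ≤ n` and `k > 0`). -/
def mulY {n N : ℕ} (S : SignDecomposition N) (i : ℕ) (k : Idx N) : Module.End ℂ (CY n S) :=
  if h : (1 ≤ i ∧ i ≤ n) ∧ k ∈ S.pos then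
    LinearMap.mulLeft ℂ (MvPolynomial.X ⟨(i, k), h⟩)
  else 0

open Classical in
/-- `∂/∂y_i(k)` on `ℂ[y]` (`0` unless `1 ≤ i ≤ n` and `k > 0`). -/
def derivY {n N : ℕ} (S : SignDecomposition N) (i : ℕ) (k : Idx N) : Module.End ℂ (CY n S) :=
  if h : (1 ≤ i ∧ i ≤ n) ∧ k ∈ S.pos then
    (MvPolynomial.pderiv (R := ℂ) (⟨(i, k), h⟩ : YVar n S)).toLinearMap
  else 0

theorem derivX_finite {n N : ℕ} (i j : ℕ) (p : CX n N) :
    (Function.support fun m : Idx N => derivX n i j m p).Finite := by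
  by_cases h : 0 < i ∧ i < j ∧ j ≤ n + 1
  · refine Set.Finite.subset (p.vars.finite_toSet.image Prod.snd) fun m hm => ?_
    by_contra hmem
    refine hm ?_
    simp only [derivX, dif_pos h]
    refine MvPolynomial.pderiv_eq_zero_of_notMem_vars fun hv => hmem ⟨_, hv, rfl⟩
  · simp [derivX, dif_neg h]

theorem derivY_finite {n N : ℕ} (S : SignDecomposition N) (i : ℕ) (p : CY n S) :
    (Function.support fun k : Idx N => derivY S i k p).Finite := by
  refine Set.Finite.subset (p.vars.finite_toSet.image fun v => v.1.2) fun k hk => ?_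
  by_contra hmem
  refine hk ?_
  by_cases h : (1 ≤ i ∧ i ≤ n) ∧ k ∈ S.pos
  · simp only [derivY, dif_pos h]
    refine MvPolynomial.pderiv_eq_zero_of_notMem_vars fun hv => hmem ⟨_, hv, rfl⟩
  · simp [derivY, dif_neg h]

/-! ### The toroidal Heisenberg algebra acting on `ℂ[y]` -/

/-- `θ(m)`, equal to `1` if `m > 0` and to `0` otherwise. -/
def theta {N : ℕ} (S : SignDecomposition N) (m : Idx N) : ℂ := S.pos.indicator 1 m

/-- The operator `∑_{s > 0} ∑_p m_p κ_{-m+s,p} ∂/∂y_i(s)` on `ℂ[y]`. -/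
def kappaDerivY {n N : ℕ} (S : SignDecomposition N) (κ : Idx N → Fin (N + 1) → ℂ)
    (i : ℕ) (m : Idx N) : Module.End ℂ (CY n S) :=
  SummableFamily.sumComp (fun s => (∑ p, (m p : ℂ) * κ (-m + s) p) • LinearMap.id)
    (SummableFamily.ofFinite (derivY S i) (derivY_finite S i))

/-- `Φ(b_i(m))` for `1 ≤ i ≤ n`. -/
def heis {n N : ℕ} (S : SignDecomposition N) (κ : Idx N → Fin (N + 1) → ℂ) (lam : ℕ → ℂ)
    (i : ℕ) (m : Idx N) : Module.End ℂ (CY n S) :=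
  theta S (-m) • (kappaDerivY S κ (i - 1) m - kappaDerivY S κ i m)
  + theta S m • (kappaDerivY S κ (i - 1) m - (2 : ℂ) • kappaDerivY S κ i m
      + kappaDerivY S κ (i + 1) m)
  + theta S (-m) • mulY S i (-m)
  - (if m = 0 then lam i else 0) • LinearMap.id

/-- `Φ(b_i(m))` for `0 ≤ i ≤ n`, where `b_0(m) = -∑_{i=1}^n b_i(m)`. -/
def heisAll {n N : ℕ} (S : SignDecomposition N) (κ : Idx N → Fin (N + 1) → ℂ) (lam : ℕ → ℂ)
    (i : ℕ) (m : Idx N) : Module.End ℂ (CY n S) :=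
  if i = 0 then -∑ j ∈ Finset.Icc 1 n, heis S κ lam j m else heis S κ lam i m

/-! ### Fields on the Fock space -/

section Fields

variable (n : ℕ) {N : ℕ} (S : SignDecomposition N)

/-- The series `a_{ij}(z)`, with `a_{ij,m} = -x_{ij}(m)`. -/
def aF (i j : ℕ) : OpSeries N (Fock n S) :=
  fun m => LinearMap.rTensor (CY n S) (-mulX n i j m)

/-- The operators `a^*_{ij,m} = ∂/∂x_{ij}(-m)`. -/
def aStarMode (i j : ℕ) (m : Idx N) : Module.End ℂ (Fock n S) :=
  LinearMap.rTensor (CY n S) (derivX n i j (-m))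

theorem aStarMode_finite (i j : ℕ) (v : Fock n S) :
    (Function.support fun m : Idx N => aStarMode n S i j m v).Finite := by
  induction v using TensorProduct.induction_on with
  | zero => simp
  | tmul p q =>
    refine Set.Finite.subset ((derivX_finite i j p).image Neg.neg) fun m hm => ?_
    refine ⟨-m, fun h0 => hm ?_, neg_neg m⟩
    simp only [aStarMode, LinearMap.rTensor_tmul]
    simp only at h0
    rw [h0, TensorProduct.zero_tmul]
  | add v w hv hw =>
    refine (hv.union hw).subset ?_
    simp only [map_add]
    exact Function.support_add _ _

/-- The summable series `a^*_{ij}(z)`. -/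
def aS (i j : ℕ) : SummableFamily (Idx N) (Fock n S) :=
  SummableFamily.ofFinite (aStarMode n S i j) (aStarMode_finite n S i j)

/-- The series `Φ(b_r)(z)` acting on the Fock space as `1 ⊗ Φ(b_r)`. -/
def PhiF (κ : Idx N → Fin (N + 1) → ℂ) (lam : ℕ → ℂ) (r : ℕ) : OpSeries N (Fock n S) :=
  fun m => LinearMap.lTensor (CX n N) (heisAll S κ lam r m)

/-- `∏_l a^*_{q_l q_{l+1}}(z)` over consecutive entries of a list `q`. -/
def chainProd : List ℕ → SummableFamily (Idx N) (Fock n S)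
  | a :: b :: l => (aS n S a b).mul (chainProd (b :: l))
  | _ => SummableFamily.one

/-- The sequences `1 = q_1 < q_2 < ⋯ < q_i = j`, each given by its set of entries. -/
def chains (j : ℕ) : Finset (Finset ℕ) :=
  (Finset.Icc 1 j).powerset.filter fun s => 1 ∈ s ∧ j ∈ s

/-- `ρ(F_r)(z)` for `1 ≤ r ≤ n`. -/
def rhoFpos (r : ℕ) : OpSeries N (Fock n S) :=
  aF n S r (r + 1) - ∑ j ∈ Finset.Icc 1 (r - 1), (aF n S j (r + 1)).mul (aS n S j r)

variable (κ : Idx N → Fin (N + 1) → ℂ) (lam : ℕ → ℂ)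

/-- `ρ(H_r)(z)` for `1 ≤ r ≤ n`. -/
def rhoHpos (r : ℕ) : OpSeries N (Fock n S) :=
  (2 : ℂ) • (aF n S r (r + 1)).mul (aS n S r (r + 1))
  + ∑ i ∈ Finset.Icc 1 (r - 1),
      ((aF n S i (r + 1)).mul (aS n S i (r + 1)) - (aF n S i r).mul (aS n S i r))
  + ∑ j ∈ Finset.Icc (r + 2) (n + 1),
      ((aF n S r j).mul (aS n S r j) - (aF n S (r + 1) j).mul (aS n S (r + 1) j))
  + PhiF n S κ lam r

/-- `ρ(E_r)(z)` for `1 ≤ r ≤ n`. The factors `a^*` and `Φ(b_r)` commute. -/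
def rhoEpos (r : ℕ) : OpSeries N (Fock n S) :=
  (aF n S r (r + 1)).mul ((aS n S r (r + 1)).mul (aS n S r (r + 1)))
  - ∑ j ∈ Finset.Icc (r + 2) (n + 1), (aF n S (r + 1) j).mul (aS n S r j)
  + ∑ j ∈ Finset.Icc 1 (r - 1), (aF n S j r).mul (aS n S j (r + 1))
  + ∑ j ∈ Finset.Icc (r + 2) (n + 1),
      ((aF n S r j).mul (aS n S r j)
        - (aF n S (r + 1) j).mul (aS n S (r + 1) j)).mul (aS n S r (r + 1))
  + (PhiF n S κ lam r).mul (aS n S r (r + 1))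
  + kappaD κ (aS n S r (r + 1))

/-- `ρ(E_0)(z)`. -/
def rhoE0 : OpSeries N (Fock n S) := -aF n S 1 (n + 1)

/-- `ρ(H_0)(z)`. -/
def rhoH0 : OpSeries N (Fock n S) :=
  -∑ r ∈ Finset.Icc 1 n, (aF n S r (n + 1)).mul (aS n S r (n + 1))
  - ∑ r ∈ Finset.Icc 2 (n + 1), (aF n S 1 r).mul (aS n S 1 r)
  + PhiF n S κ lam 0

/-- `ρ(F_0)(z)`. The sums run over sequences `1 = q_1 < ⋯ < q_i` with `q_{i+1} = n + 1`:
in the first line `q_i = j` and `q_{i-1} ≤ r`, in the second `q_i ≤ r`, in the third `q_i = r`.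
The factors `a^*`, `Φ(b_r)` and `κ·D a^*` commute with each other. -/
def rhoF0 : OpSeries N (Fock n S) :=
  ∑ r ∈ Finset.Icc 1 n, ∑ j ∈ Finset.Icc (r + 1) (n + 1),
      ∑ q ∈ (chains j).filter (fun q => ∀ k ∈ q, k ≠ j → k ≤ r),
        (-aF n S r j).mul ((chainProd n S (q.sort (· ≤ ·))).mul (aS n S r (n + 1)))
  - ∑ r ∈ Finset.Icc 1 n, ∑ t ∈ Finset.Icc 1 r, ∑ q ∈ chains t,
      (PhiF n S κ lam r).mul (chainProd n S (q.sort (· ≤ ·) ++ [n + 1]))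
  - ∑ r ∈ Finset.Icc 1 n, ∑ q ∈ chains r,
      (kappaD κ (aS n S r (n + 1))).mul (chainProd n S (q.sort (· ≤ ·)))

/-- `ρ(E_r)(z)`, `0 ≤ r ≤ n`. -/
def rhoE (r : Fin (n + 1)) : OpSeries N (Fock n S) :=
  if r = 0 then rhoE0 n S else rhoEpos n S κ lam r

/-- `ρ(F_r)(z)`, `0 ≤ r ≤ n`. -/
def rhoF (r : Fin (n + 1)) : OpSeries N (Fock n S) :=
  if r = 0 then rhoF0 n S κ lam else rhoFpos n S r

/-- `ρ(H_r)(z)`, `0 ≤ r ≤ n`. -/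
def rhoH (r : Fin (n + 1)) : OpSeries N (Fock n S) :=
  if r = 0 then rhoH0 n S κ lam else rhoHpos n S κ lam r

end Fields

end

end Toroidal

/-! The fields a^*_{ij}(z) have commuting modes and are finite on every vector, so polynomials in
them act on V[z^{±1}] as a commutative ring R. A formal series A is encoded by the functional z^{-s}
v ↦ A_{-s} v; multiplying it on the right by a field is then precomposition, and series form an
R-module. The operation κ·D is a derivation from R into this module precisely because ∑ m_p κ_{m,p}
= 0 (`kappaDerivation`).

The series a_{ij} act on R as partial derivatives and the Heisenberg series act trivially. Every
generator is a current ∑ P(u_α) a_α + ∑ ζ_b Ψ_b + ∑ f κ·D g, that is, a vector field, a Heisenberg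
part and a one-form. Since a always stands to the left of a^*, the bracket of two currents follows
from the Leibniz rule alone, with no reordering of infinite sums. The result,
`FreeFields.adShift_current`, is a bracket of Dorfman type: Lie bracket of vector fields, Lie
derivatives and contractions of one-forms, and multiples of κ.

The currents come from geometry. Let U = 1 - u be the generic upper unitriangular matrix. A matrix X
acts infinitesimally on the big cell by P_X U = (U X U⁻¹)_+ U, where + is the strictly upper part.
Let C_X be the current with vector field P_X, Heisenberg coefficients minus the diagonal of U X U⁻¹,
and one-form -tr(X U⁻¹ dU). For traceless X and Y, `FreeFields.adShift_matrixCurrent` gives [C_X(m),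
C_Y(k)] = C_{[X,Y]}(m+k) - tr(XY) ∑ m_p κ_{-(m+k),p}. With x = U X U⁻¹ and y = U Y U⁻¹, the vector
and diagonal parts hold because strictly upper and weakly lower matrices are both closed under
products. The one-form part reduces to tr(y dx) = tr([X,Y] U⁻¹ dU), and the scalar part to tr(yx) =
tr(XY). The Gram matrix of Ψ_b = ∑_{r≥b} Φ(b_r) is the identity plus a function of the row plus a
function of the column; the last two drop out since x and y are traceless.

It remains to recognise the generators. With node 0 read as the index n+1, E_r, F_r and H_r are the
currents of e_{r+1,r}, -e_{r,r+1} and e_{r+1,r+1} - e_{r,r}. The sums over sequences in F_0 are the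
path expansion of the first row of U⁻¹. The toroidal relations then follow from identities between
matrix units on a cycle of length n+1 ≥ 3 (`IsAffinization.lift_relator`), and the universal
property of the presentation gives existence and uniqueness. -/

namespace Toroidal

noncomputable section

/-! ### Formal series as functionals on V[z^{±1}] -/

section Loop

variable {V : Type*} [AddCommGroup V] [Module ℂ V] {N : ℕ}

/-- Multiplication by `z^{-k}` on the space `V[z^{±1}]` of finitely supported families. -/
def shift (k : Idx N) : Module.End ℂ (Idx N →₀ V) := Finsupp.lmapDomain V ℂ (fun l => l + k)

@[simp]
theorem shift_single (k s : Idx N) (v : V) :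
    shift k (Finsupp.single s v) = Finsupp.single (s + k) v := by
  simp [shift]

theorem shift_apply (k s : Idx N) (w : Idx N →₀ V) : shift k w s = w (s - k) := by
  have := Finsupp.mapDomain_apply (add_left_injective k) w (s - k)
  simpa [shift] using this

theorem shift_mul (k l : Idx N) : shift (V := V) k * shift l = shift (l + k) := by
  refine Finsupp.lhom_ext fun s v => ?_
  simp [add_assoc]

theorem shift_zero : shift (V := V) (0 : Idx N) = 1 := by
  refine Finsupp.lhom_ext fun s v => ?_
  simp

/-- The `z`-linear extension of a summable series to an endomorphism of `V[z^{±1}]`. -/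
def SummableFamily.extend (f : SummableFamily (Idx N) V) : Module.End ℂ (Idx N →₀ V) :=
  Finsupp.lsum ℂ (fun k => shift k ∘ₗ f)

@[simp]
theorem SummableFamily.extend_single (f : SummableFamily (Idx N) V) (k : Idx N) (v : V) :
    f.extend (Finsupp.single k v) = shift k (f v) := by
  simp [extend]

theorem SummableFamily.extend_shift (f : SummableFamily (Idx N) V) (k : Idx N) :
    Commute f.extend (shift k) := by
  refine Finsupp.lhom_ext fun s v => ?_
  simp only [Module.End.mul_apply, shift_single, extend_single]
  rw [← shift_mul]
  rfl

theorem SummableFamily.extend_mul (f g : SummableFamily (Idx N) V) :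
    (f.mul g).extend = f.extend * g.extend := by
  refine Finsupp.lhom_ext fun s v => ?_
  have := LinearMap.congr_fun (f.extend_shift s) (g v)
  simp only [Module.End.mul_apply, extend_single] at this ⊢
  exact this.symm

/-- The convolution form, written with `finsum` so that the summation index can later be reflected
by l ↦ s - l without tracking supports. -/
theorem SummableFamily.extend_apply (f : SummableFamily (Idx N) V) (w : Idx N →₀ V)
    (s : Idx N) : f.extend w s = ∑ᶠ l, f (w l) (s - l) := by
  rw [finsum_eq_sum_of_support_subset (s := w.support)]
  · simp only [extend, Finsupp.lsum_apply, Finsupp.sum, LinearMap.comp_apply,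
      Finsupp.finsetSum_apply, shift_apply]
  · intro l hl
    simp only [Function.mem_support, Finset.mem_coe, Finsupp.mem_support_iff] at hl ⊢
    rintro h
    simp [h] at hl

/-- Summable series whose modes commute have commuting extensions. -/
theorem SummableFamily.extend_commute (f g : SummableFamily (Idx N) V)
    (h : ∀ k l v, f (g v l) k = g (f v k) l) : Commute f.extend g.extend := by
  have key : ∀ v, f.extend (g v) = g.extend (f v) := by
    intro v
    ext s
    rw [extend_apply, extend_apply, ← finsum_comp_equiv (Equiv.subLeft s)]
    refine finsum_congr fun l => ?_
    simp [h]
  refine Finsupp.lhom_ext fun s v => ?_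
  have h1 := LinearMap.congr_fun (f.extend_shift s) (g v)
  have h2 := LinearMap.congr_fun (g.extend_shift s) (f v)
  simp only [Module.End.mul_apply, extend_single] at h1 h2 ⊢
  rw [h1, h2, key]

/-- The operator `z^{-s} v ↦ s_p z^{-s} v`. -/
def eulerOp (p : Fin (N + 1)) : Module.End ℂ (Idx N →₀ V) :=
  Finsupp.lsum ℂ (fun q => (q p : ℂ) • Finsupp.lsingle q)

@[simp]
theorem eulerOp_single (p : Fin (N + 1)) (s : Idx N) (v : V) :
    eulerOp p (Finsupp.single s v) = (s p : ℂ) • Finsupp.single s v := by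
  simp [eulerOp]

theorem eulerOp_shift (p : Fin (N + 1)) (k : Idx N) :
    eulerOp (V := V) p * shift k = shift k * (eulerOp p + (k p : ℂ) • 1) := by
  refine Finsupp.lhom_ext fun s v => ?_
  simp [add_smul]

theorem SummableFamily.euler_eq (p : Fin (N + 1)) (f : SummableFamily (Idx N) V) :
    f.euler p = -(eulerOp p ∘ₗ f) := by
  have : (Finsupp.lsum ℂ (fun q : Idx N => (-(q p : ℂ)) • Finsupp.lsingle (M := V) q) :
      Module.End ℂ (Idx N →₀ V)) = -eulerOp p := by
    refine Finsupp.lhom_ext fun s v => ?_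
    simp
  rw [SummableFamily.euler, this]
  rfl

theorem SummableFamily.euler_apply (p : Fin (N + 1)) (f : SummableFamily (Idx N) V) (v : V)
    (k : Idx N) : f.euler p v k = (-(k p : ℂ)) • f v k := by
  have : ∀ w : Idx N →₀ V, eulerOp p w k = (k p : ℂ) • w k := by
    intro w
    induction w using Finsupp.induction_linear with
    | zero => simp
    | add a b ha hb => simp [ha, hb]
    | single s x =>
      by_cases h : s = k
      · subst h; simp
      · simp [h]
  rw [euler_eq]
  simp [this]

/-- Differentiating a field is taking its commutator with the degree operator. The order of the
factors reflects that `eulerOp` is -z_p ∂/∂z_p. -/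
theorem SummableFamily.extend_euler (p : Fin (N + 1)) (f : SummableFamily (Idx N) V) :
    (f.euler p).extend = f.extend * eulerOp p - eulerOp p * f.extend := by
  refine Finsupp.lhom_ext fun s v => ?_
  have := LinearMap.congr_fun (eulerOp_shift p s) (f v)
  simp only [Module.End.mul_apply] at this
  simp [euler_eq, this]

/-- The functional on `V[z^{±1}]` encoding a formal series: `z^{-s} v ↦ A_{-s} v`. -/
def OpSeries.total : OpSeries N V →ₗ[ℂ] ((Idx N →₀ V) →ₗ[ℂ] V) where
  toFun A := Finsupp.lsum ℂ (fun k => A (-k))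
  map_add' A B := by
    refine Finsupp.lhom_ext fun s v => ?_
    simp
  map_smul' c A := by
    refine Finsupp.lhom_ext fun s v => ?_
    simp

@[simp]
theorem OpSeries.total_single (A : OpSeries N V) (s : Idx N) (v : V) :
    A.total (Finsupp.single s v) = A (-s) v := by
  simp [total]

/-- The series encoded by a functional. -/
def OpSeries.ofTotal (t : (Idx N →₀ V) →ₗ[ℂ] V) : OpSeries N V :=
  fun m => t ∘ₗ Finsupp.lsingle (-m)

@[simp]
theorem OpSeries.total_ofTotal (t : (Idx N →₀ V) →ₗ[ℂ] V) : (OpSeries.ofTotal t).total = t := by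
  refine Finsupp.lhom_ext fun s v => ?_
  simp [ofTotal]

theorem OpSeries.apply_eq (A : OpSeries N V) (m : Idx N) (v : V) :
    A m v = A.total (Finsupp.single (-m) v) := by
  simp

theorem OpSeries.total_injective : Function.Injective (OpSeries.total (N := N) (V := V)) := by
  intro A B h
  funext m
  ext v
  rw [apply_eq, h, ← apply_eq]

/-- The reason for the encoding: products of series become composition of linear maps, so
associativity and commutativity need no manipulation of infinite sums. -/
theorem OpSeries.total_mul (A : OpSeries N V) (f : SummableFamily (Idx N) V) :
    (A.mul f).total = A.total ∘ₗ f.extend := by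
  refine Finsupp.lhom_ext fun s v => ?_
  have : Finsupp.lsum ℂ (fun k => A (-s - k)) = A.total ∘ₗ shift s := by
    refine Finsupp.lhom_ext fun k v => ?_
    simp only [Finsupp.lsum_single, LinearMap.comp_apply, shift_single, total_single]
    congr 2
    abel
  simp only [total_single, LinearMap.comp_apply, SummableFamily.extend_single]
  simp only [OpSeries.mul, SummableFamily.sumComp, this]
  rfl

end Loop

/-! ### Polynomials evaluated at commuting operators -/

section EvalComm

variable {R σ A : Type*} [CommRing R] [Ring A] [Algebra R A]

open MvPolynomial in
/-- Evaluation of a polynomial at a commuting family of elements of an algebra. -/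
theorem exists_eval_of_commute (s : σ → A) (h : ∀ i j, Commute (s i) (s j)) :
    ∃ φ : MvPolynomial σ R →ₐ[R] A, ∀ i, φ (X i) = s i := by
  -- The target algebra is not commutative, so the evaluation is made inside the subalgebra
  -- generated by the commuting elements.
  have hc : IsMulCommutative (Algebra.adjoin R (Set.range s)) :=
    Algebra.isMulCommutative_adjoin R (by
      rintro _ ⟨i, rfl⟩ _ ⟨j, rfl⟩
      exact h i j)
  let _ : CommRing (Algebra.adjoin R (Set.range s)) :=
    { (inferInstance : Ring (Algebra.adjoin R (Set.range s))) with
      mul_comm := hc.is_comm.comm }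
  refine ⟨(Algebra.adjoin R (Set.range s)).val.comp
    (aeval fun i => ⟨s i, Algebra.subset_adjoin ⟨i, rfl⟩⟩), fun i => ?_⟩
  simp

end EvalComm

/-- A family of summable series with commuting modes. -/
class CommutingFields (σ : outParam Type*) (N : ℕ) (V : Type*) [AddCommGroup V] [Module ℂ V] where
  field : σ → SummableFamily (Idx N) V
  commute : ∀ (α β : σ) (k l : Idx N) (v : V),
    field α (field β v l) k = field β (field α v k) l

/-! ### The module of series over polynomials in the fields -/

section Currents

open MvPolynomial

variable {σ V : Type*} [AddCommGroup V] [Module ℂ V] {N : ℕ} [CommutingFields σ N V]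

/-- The action of polynomials in the commuting fields on `V[z^{±1}]`. -/
def evalFields : MvPolynomial σ ℂ →ₐ[ℂ] Module.End ℂ (Idx N →₀ V) :=
  (exists_eval_of_commute (R := ℂ)
    (fun α : σ => (CommutingFields.field (N := N) (V := V) α).extend)
    (fun _ _ => SummableFamily.extend_commute _ _ (CommutingFields.commute _ _))).choose

@[simp]
theorem evalFields_X (α : σ) :
    evalFields (N := N) (V := V) (X α) = (CommutingFields.field α).extend :=
  (exists_eval_of_commute (R := ℂ)
    (fun α : σ => (CommutingFields.field (N := N) (V := V) α).extend)
    (fun _ _ => SummableFamily.extend_commute _ _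
      (CommutingFields.commute _ _))).choose_spec α

theorem evalFields_commute (f g : MvPolynomial σ ℂ) :
    Commute (evalFields (N := N) (V := V) f) (evalFields g) :=
  (Commute.all f g).map evalFields

/-- An endomorphism commuting with the generating fields commutes with all polynomials. -/
theorem commute_evalFields {T : Module.End ℂ (Idx N →₀ V)}
    (h : ∀ α : σ, Commute T (CommutingFields.field α).extend) (f : MvPolynomial σ ℂ) :
    Commute T (evalFields f) := by
  induction f using MvPolynomial.induction_on with
  | C c => rw [← algebraMap_eq, AlgHom.commutes]; exact Algebra.commute_algebraMap_right c T
  | add p q hp hq => rw [map_add]; exact hp.add_right hq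
  | mul_X p α hp => rw [map_mul, evalFields_X]; exact hp.mul_right (h α)

theorem shift_commute_evalFields (k : Idx N) (f : MvPolynomial σ ℂ) :
    Commute (shift (V := V) k) (evalFields f) :=
  commute_evalFields (fun _ => (SummableFamily.extend_shift _ k).symm) f

/-- The degree operator is a first-order differential operator over the ring of fields: its double
commutators with fields vanish. On generators this holds because the modes of a differentiated field
are scalar multiples of the original modes. -/
theorem commutator_eulerOp_commute (p : Fin (N + 1)) (f g : MvPolynomial σ ℂ) :
    Commute (evalFields (V := V) f * eulerOp p - eulerOp p * evalFields f) (evalFields g) := by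
  induction f using MvPolynomial.induction_on with
  | C c =>
    rw [← algebraMap_eq, AlgHom.commutes, (Algebra.commutes c (eulerOp p)), sub_self]
    exact Commute.zero_left _
  | add a b ha hb =>
    have : evalFields (V := V) (a + b) * eulerOp p - eulerOp p * evalFields (a + b)
        = (evalFields a * eulerOp p - eulerOp p * evalFields a)
          + (evalFields b * eulerOp p - eulerOp p * evalFields b) := by
      rw [map_add]; noncomm_ring
    rw [this]
    exact ha.add_left hb
  | mul_X a α ha =>
    have : evalFields (V := V) (a * X α) * eulerOp p - eulerOp p * evalFields (a * X α)
        = (evalFields a * eulerOp p - eulerOp p * evalFields a) * evalFields (X α)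
          + evalFields a * (evalFields (X α) * eulerOp p - eulerOp p * evalFields (X α)) := by
      rw [map_mul, sub_mul, mul_sub]; simp only [mul_assoc]; abel
    rw [this]
    refine (ha.mul_left (evalFields_commute _ _)).add_left ((evalFields_commute _ _).mul_left ?_)
    refine commute_evalFields (fun β => ?_) g
    rw [evalFields_X, ← SummableFamily.extend_euler]
    refine SummableFamily.extend_commute _ _ fun k l v => ?_
    rw [SummableFamily.euler_apply, SummableFamily.euler_apply, CommutingFields.commute,
      map_smul, Finsupp.smul_apply]

/-- Formal series form a module over the polynomials in the commuting fields, acting by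
multiplication on the right. -/
instance currentModule : Module (MvPolynomial σ ℂ) (OpSeries N V) where
  smul f A := OpSeries.ofTotal (A.total ∘ₗ evalFields f)
  one_smul A := OpSeries.total_injective (by
    refine (OpSeries.total_ofTotal _).trans ?_
    rw [map_one]; rfl)
  mul_smul f g A := OpSeries.total_injective (by
    refine (OpSeries.total_ofTotal _).trans ?_
    refine Eq.trans ?_ (OpSeries.total_ofTotal _).symm
    -- Multiplication is on the right, so a left module structure requires commutativity of the
    -- polynomials.
    rw [mul_comm, map_mul]
    refine Eq.trans ?_ (congrArg (· ∘ₗ _) (OpSeries.total_ofTotal _)).symm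
    rfl)
  smul_zero f := OpSeries.total_injective (by
    refine (OpSeries.total_ofTotal _).trans ?_
    rw [map_zero, LinearMap.zero_comp])
  smul_add f A B := OpSeries.total_injective (by
    refine (OpSeries.total_ofTotal _).trans ?_
    rw [map_add, map_add, LinearMap.add_comp]
    exact congrArg₂ _ (OpSeries.total_ofTotal _).symm (OpSeries.total_ofTotal _).symm)
  add_smul f g A := OpSeries.total_injective (by
    refine (OpSeries.total_ofTotal _).trans ?_
    rw [map_add, map_add, LinearMap.comp_add]
    exact congrArg₂ _ (OpSeries.total_ofTotal _).symm (OpSeries.total_ofTotal _).symm)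
  zero_smul A := OpSeries.total_injective (by
    refine (OpSeries.total_ofTotal _).trans ?_
    rw [map_zero, map_zero, LinearMap.comp_zero])

@[simp]
theorem total_smul (f : MvPolynomial σ ℂ) (A : OpSeries N V) :
    (f • A).total = A.total ∘ₗ evalFields f :=
  OpSeries.total_ofTotal _

instance : IsScalarTower ℂ (MvPolynomial σ ℂ) (OpSeries N V) where
  smul_assoc c f A := OpSeries.total_injective (by
    rw [total_smul, map_smul, map_smul, total_smul, LinearMap.comp_smul])

theorem X_smul (α : σ) (A : OpSeries N V) :
    (X α : MvPolynomial σ ℂ) • A = A.mul (CommutingFields.field α) :=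
  OpSeries.total_injective (by rw [total_smul, OpSeries.total_mul, evalFields_X])

/-- The series of operators represented by a polynomial in the fields. -/
def modes (f : MvPolynomial σ ℂ) : OpSeries N V :=
  OpSeries.ofTotal (Finsupp.lapply 0 ∘ₗ evalFields f)

theorem smul_modes (f g : MvPolynomial σ ℂ) : f • modes (N := N) (V := V) g = modes (g * f) :=
  OpSeries.total_injective (by
    rw [total_smul, modes, modes, OpSeries.total_ofTotal, OpSeries.total_ofTotal, map_mul]
    rfl)

theorem modes_add (f g : MvPolynomial σ ℂ) :
    modes (N := N) (V := V) (f + g) = modes f + modes g :=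
  OpSeries.total_injective (by
    rw [map_add, modes, modes, modes]
    simp only [OpSeries.total_ofTotal, map_add, LinearMap.comp_add])

theorem modes_zero : modes (N := N) (V := V) (0 : MvPolynomial σ ℂ) = 0 :=
  OpSeries.total_injective (by
    rw [map_zero, modes, OpSeries.total_ofTotal, map_zero, LinearMap.comp_zero])

theorem modes_sum {ι : Type*} (s : Finset ι) (f : ι → MvPolynomial σ ℂ) :
    modes (N := N) (V := V) (∑ i ∈ s, f i) = ∑ i ∈ s, modes (f i) :=
  map_sum (AddMonoidHom.mk' (modes (N := N) (V := V)) modes_add) f s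

theorem evalFields_single_apply (f : MvPolynomial σ ℂ) (t s : Idx N) (v : V) :
    evalFields f (Finsupp.single t v) s = modes f (s - t) v := by
  have h := LinearMap.congr_fun (shift_commute_evalFields (V := V) s f)
    (Finsupp.single (t - s) v)
  simp only [Module.End.mul_apply, shift_single, sub_add_cancel] at h
  rw [← h, shift_apply]
  simp [modes, OpSeries.ofTotal]

theorem modes_X (α : σ) (s : Idx N) (v : V) :
    modes (X α : MvPolynomial σ ℂ) s v = CommutingFields.field α v s := by
  have := evalFields_single_apply (X α : MvPolynomial σ ℂ) 0 s v
  rw [evalFields_X, SummableFamily.extend_single, shift_zero, sub_zero] at this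
  exact this.symm

theorem modes_C (c : ℂ) (s : Idx N) :
    modes (V := V) (C c : MvPolynomial σ ℂ) s = if s = 0 then c • LinearMap.id else 0 := by
  ext v
  have := evalFields_single_apply (C c : MvPolynomial σ ℂ) 0 s v
  rw [sub_zero] at this
  rw [← this, ← algebraMap_eq, AlgHom.commutes]
  by_cases h : s = 0
  · subst h; simp [Module.algebraMap_end_apply]
  · simp [h, Module.algebraMap_end_apply]

/-- An endomorphism of `V` acting coefficientwise on `V[z^{±1}]`. -/
def coefwise (T : Module.End ℂ V) : Module.End ℂ (Idx N →₀ V) := Finsupp.mapRange.linearMap T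

@[simp]
theorem coefwise_apply (T : Module.End ℂ V) (w : Idx N →₀ V) (s : Idx N) :
    coefwise T w s = T (w s) := by
  simp [coefwise]

@[simp]
theorem coefwise_single (T : Module.End ℂ V) (s : Idx N) (v : V) :
    coefwise T (Finsupp.single s v) = Finsupp.single s (T v) := by
  simp [coefwise]

/-- `T` acts on polynomials in the fields as the derivation `δ` with degree shift `k`:
`[X, f_s] = (δ f)_{s+k}`. -/
def Implements (T : Module.End ℂ V) (k : Idx N)
    (δ : Derivation ℂ (MvPolynomial σ ℂ) (MvPolynomial σ ℂ)) : Prop :=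
  ∀ (f : MvPolynomial σ ℂ) (s : Idx N), ⁅T, modes (V := V) f s⁆ = modes (δ f) (s + k)

/-- All the mode identities together are one commutator identity on V[z^{±1}], in which the Leibniz
rule can be applied to products. -/
theorem implements_iff {T : Module.End ℂ V} {k : Idx N}
    {δ : Derivation ℂ (MvPolynomial σ ℂ) (MvPolynomial σ ℂ)} (f : MvPolynomial σ ℂ) :
    (∀ s : Idx N, ⁅T, modes (V := V) f s⁆ = modes (δ f) (s + k)) ↔
      coefwise T * evalFields f - evalFields f * coefwise T
        = shift (-k) * evalFields (δ f) := by
  have key : ∀ (t s : Idx N) (v : V),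
      ((coefwise T * evalFields f - evalFields f * coefwise T :
          Module.End ℂ (Idx N →₀ V)) (Finsupp.single t v) s
        = ⁅T, modes (V := V) f (s - t)⁆ v) ∧
      (shift (-k) * evalFields (δ f) : Module.End ℂ (Idx N →₀ V)) (Finsupp.single t v) s = modes (δ f) (s - t + k) v := by
    intro t s v
    constructor
    · simp [evalFields_single_apply, LieRing.of_associative_ring_bracket]
    · rw [Module.End.mul_apply, shift_apply, evalFields_single_apply]
      congr 2
      abel
  constructor
  · intro h
    refine Finsupp.lhom_ext fun t v => ?_
    ext s
    rw [(key t s v).1, (key t s v).2, h]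
  · intro h s
    ext v
    have h1 := key 0 s v
    rw [sub_zero] at h1
    rw [← h1.1, ← h1.2, h]

/-- It suffices to check `Implements` on the generating fields. -/
theorem implements_of_X {T : Module.End ℂ V} {k : Idx N}
    {δ : Derivation ℂ (MvPolynomial σ ℂ) (MvPolynomial σ ℂ)}
    (h : ∀ (α : σ) (s : Idx N), ⁅T, modes (V := V) (X α) s⁆ = modes (δ (X α)) (s + k)) :
    Implements T k δ := by
  intro f
  rw [implements_iff]
  induction f using MvPolynomial.induction_on with
  | C c =>
    rw [derivation_C, map_zero, mul_zero, ← algebraMap_eq, AlgHom.commutes, Algebra.commutes,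
      sub_self]
  | add p q hp hq =>
    rw [map_add, map_add, map_add, mul_add, mul_add, add_mul, ← hp, ← hq]
    abel
  | mul_X p α hp =>
    have hα := (implements_iff (X α)).1 (h α)
    have hc := (shift_commute_evalFields (V := V) (-k) p).eq
    rw [Derivation.leibniz, map_add, smul_eq_mul, smul_eq_mul, map_mul, map_mul, map_mul, mul_add,
      (evalFields_commute (X α) (δ p)).eq, ← mul_assoc (shift (-k)), ← mul_assoc (shift (-k)), hc,
      mul_assoc (evalFields p) (shift (-k)), ← hα, ← hp, sub_mul, mul_sub]
    simp only [mul_assoc]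
    abel

/-- The map `A ↦ (m ↦ [T, A_{m-k}])`. -/
def adShift (T : Module.End ℂ V) (k : Idx N) : OpSeries N V →ₗ[ℂ] OpSeries N V where
  toFun A := fun m => ⁅T, A (m - k)⁆
  map_add' A B := by funext m; simp
  map_smul' c A := by funext m; simp

theorem adShift_apply (T : Module.End ℂ V) (k m : Idx N) (A : OpSeries N V) :
    adShift T k A m = ⁅T, A (m - k)⁆ := rfl

theorem total_adShift (T : Module.End ℂ V) (k : Idx N) (A : OpSeries N V) :
    (adShift T k A).total = T ∘ₗ A.total ∘ₗ shift k
      - A.total ∘ₗ shift k ∘ₗ coefwise T := by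
  refine Finsupp.lhom_ext fun s v => ?_
  have : -s - k = -(s + k) := by abel
  simp [adShift_apply, LieRing.of_associative_ring_bracket, this]

/-- Leibniz rule for `adShift`. -/
theorem adShift_smul {T : Module.End ℂ V} {k : Idx N}
    {δ : Derivation ℂ (MvPolynomial σ ℂ) (MvPolynomial σ ℂ)} (h : Implements T k δ)
    (f : MvPolynomial σ ℂ) (A : OpSeries N V) :
    adShift T k (f • A) = f • adShift T k A + δ f • A := by
  apply OpSeries.total_injective
  have h1 := (implements_iff f).1 (h f)
  have hc := (shift_commute_evalFields (V := V) k f).eq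
  have h2 : shift (V := V) k * shift (-k) = 1 := by rw [shift_mul, neg_add_cancel, shift_zero]
  rw [map_add, total_adShift, total_smul, total_smul, total_adShift, total_smul]
  refine LinearMap.ext fun w => ?_
  have e1 := LinearMap.congr_fun hc
  have e2 : evalFields (δ f) w = shift k ((coefwise T * evalFields f
      - evalFields f * coefwise T : Module.End ℂ (Idx N →₀ V)) w) := by
    rw [h1]
    have := LinearMap.congr_fun h2 (evalFields (δ f) w)
    simpa using this.symm
  simp only [LinearMap.sub_apply, LinearMap.add_apply, LinearMap.comp_apply, e2,
    Module.End.mul_apply, map_sub] at e1 ⊢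
  rw [← e1, ← e1]
  abel

/-- `z_p ∂/∂z_p` on formal series. -/
def eulerSeries (p : Fin (N + 1)) : OpSeries N V →ₗ[ℂ] OpSeries N V where
  toFun A := fun m => (-(m p : ℂ)) • A m
  map_add' A B := by funext m; simp
  map_smul' c A := by funext m; simp [smul_comm c]

theorem eulerSeries_apply (p : Fin (N + 1)) (A : OpSeries N V) (m : Idx N) :
    eulerSeries p A m = (-(m p : ℂ)) • A m := rfl

theorem total_eulerSeries (p : Fin (N + 1)) (A : OpSeries N V) :
    (eulerSeries p A).total = A.total ∘ₗ eulerOp p := by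
  refine Finsupp.lhom_ext fun s v => ?_
  simp [eulerSeries_apply]

/-- The vanishing of double commutators, in the form needed to derive a Leibniz rule: the Euler
derivative of series is a first-order operator over the polynomials. -/
theorem eulerSeries_smul_smul (p : Fin (N + 1)) (f g : MvPolynomial σ ℂ) (A : OpSeries N V) :
    eulerSeries p ((f * g) • A) + (f * g) • eulerSeries p A
      = f • eulerSeries p (g • A) + g • eulerSeries p (f • A) := by
  apply OpSeries.total_injective
  simp only [map_add, total_smul, total_eulerSeries, map_mul]
  refine LinearMap.ext fun w => ?_
  have h1 := LinearMap.congr_fun (commutator_eulerOp_commute (V := V) p g f).eq w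
  have h2 := LinearMap.congr_fun (evalFields_commute (N := N) (V := V) f g).eq
  simp only [Module.End.mul_apply, LinearMap.sub_apply, LinearMap.add_apply, LinearMap.comp_apply,
    map_sub] at h1 h2 ⊢
  have h3 := congrArg A.total h1
  simp only [map_sub, h2] at h3 ⊢
  rw [sub_eq_sub_iff_add_eq_add] at h3
  rw [← h3]

/-- The bracket raises the degree by k while the Euler derivative multiplies by minus the degree.
The discrepancy k_p is the source of the central terms. -/
theorem adShift_eulerSeries (T : Module.End ℂ V) (k : Idx N) (p : Fin (N + 1))
    (A : OpSeries N V) :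
    adShift T k (eulerSeries p A) = eulerSeries p (adShift T k A) + (k p : ℂ) • adShift T k A := by
  funext m
  simp only [adShift_apply, eulerSeries_apply, Pi.add_apply, Pi.smul_apply, lie_smul, ← add_smul]
  congr 1
  simp [neg_add_eq_sub]

end Currents

/-! ### The derivation κ·D -/

section KappaDerivation

open MvPolynomial

variable {σ V : Type*} [AddCommGroup V] [Module ℂ V] {N : ℕ} [CommutingFields σ N V]

/-- The scalar series `∑_p k_p ∑_m κ_{m,p} z^m`. -/
def kappaDot (κ : Idx N → Fin (N + 1) → ℂ) (k : Idx N) : OpSeries N V :=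
  ∑ p, (k p : ℂ) • kappaSeries κ p

theorem kappaDot_apply (κ : Idx N → Fin (N + 1) → ℂ) (k m : Idx N) :
    kappaDot (V := V) κ k m = (∑ p, (k p : ℂ) * κ (-m) p) • LinearMap.id := by
  simp [kappaDot, kappaSeries, Finset.sum_apply, Finset.sum_smul, mul_smul]

theorem kappaDot_add (κ : Idx N → Fin (N + 1) → ℂ) (k l : Idx N) :
    kappaDot (V := V) κ (k + l) = kappaDot κ k + kappaDot κ l := by
  simp [kappaDot, add_smul, Finset.sum_add_distrib]

theorem sum_eulerSeries_kappaSeries {κ : Idx N → Fin (N + 1) → ℂ}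
    (hκ : ∀ m : Idx N, ∑ p, (m p : ℂ) * κ m p = 0) :
    ∑ p, eulerSeries p (kappaSeries (V := V) κ p) = 0 := by
  funext m
  have := hκ (-m)
  simp only [Pi.neg_apply, Int.cast_neg] at this
  simp only [Finset.sum_apply, eulerSeries_apply, kappaSeries, smul_smul, ← Finset.sum_smul, this,
    zero_smul, Pi.zero_apply]

/-- The derivation `f ↦ κ · D f` from polynomials in the fields to formal series. -/
def kappaDerivation (κ : Idx N → Fin (N + 1) → ℂ)
    (hκ : ∀ m : Idx N, ∑ p, (m p : ℂ) * κ m p = 0) :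
    Derivation ℂ (MvPolynomial σ ℂ) (OpSeries N V) :=
  Derivation.mk'
    { toFun := fun f => ∑ p, eulerSeries p (f • kappaSeries κ p)
      map_add' := fun f g => by simp only [add_smul, map_add, Finset.sum_add_distrib]
      map_smul' := fun c f => by
        simp only [smul_assoc, map_smul, Finset.smul_sum, RingHom.id_apply] }
    (fun f g => by
      have h : ∑ p, (f * g) • eulerSeries p (kappaSeries (V := V) κ p) = 0 := by
        rw [← Finset.smul_sum, sum_eulerSeries_kappaSeries hκ, smul_zero]
      change ∑ p, eulerSeries p ((f * g) • kappaSeries κ p)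
        = f • ∑ p, eulerSeries p (g • kappaSeries κ p)
          + g • ∑ p, eulerSeries p (f • kappaSeries κ p)
      -- The vanishing term fg ∑ D_p κ_p is inserted so that the first-order identity applies for
      -- each p.
      rw [← add_zero (∑ p, eulerSeries p ((f * g) • kappaSeries κ p)), ← h, Finset.smul_sum,
        Finset.smul_sum, ← Finset.sum_add_distrib, ← Finset.sum_add_distrib]
      exact Finset.sum_congr rfl fun p _ => eulerSeries_smul_smul p f g _)

variable {κ : Idx N → Fin (N + 1) → ℂ} (hκ : ∀ m : Idx N, ∑ p, (m p : ℂ) * κ m p = 0)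

theorem kappaDerivation_apply (f : MvPolynomial σ ℂ) :
    kappaDerivation (V := V) κ hκ f = ∑ p, eulerSeries p (f • kappaSeries κ p) := rfl

/-- In the stated formulas the derivative falls on the field only, here on its product with κ_p. The
two differ by the field times ∑ D_p κ_p = 0. -/
theorem kappaDerivation_X (α : σ) :
    kappaDerivation (V := V) κ hκ (X α) = kappaD κ (CommutingFields.field α) := by
  have h : ∑ p, (X α : MvPolynomial σ ℂ) • eulerSeries p (kappaSeries (V := V) κ p) = 0 := by
    rw [← Finset.smul_sum, sum_eulerSeries_kappaSeries hκ, smul_zero]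
  rw [kappaDerivation_apply, ← sub_zero (∑ p, eulerSeries p _), ← h, ← Finset.sum_sub_distrib,
    kappaD]
  refine Finset.sum_congr rfl fun p _ => OpSeries.total_injective ?_
  rw [map_sub, total_eulerSeries, total_smul, total_smul, total_eulerSeries, OpSeries.total_mul,
    SummableFamily.extend_euler, evalFields_X, LinearMap.comp_sub]
  rfl

/-- On the mode m the Euler derivative is multiplication by -m_p. This trades scalar terms depending
on the output mode for κ·D terms, and so gives the effect of integration by parts. -/
theorem smul_kappaDot_apply (f : MvPolynomial σ ℂ) (m : Idx N) :
    (f • kappaDot (V := V) κ m) m = -kappaDerivation κ hκ f m := by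
  rw [kappaDerivation_apply, kappaDot, Finset.smul_sum]
  simp only [Finset.sum_apply, eulerSeries_apply, ← Finset.sum_neg_distrib, neg_smul, neg_neg]
  refine Finset.sum_congr rfl fun p _ => ?_
  rw [smul_comm]
  rfl

theorem adShift_kappaSeries (T : Module.End ℂ V) (k : Idx N) (p : Fin (N + 1)) :
    adShift T k (kappaSeries κ p) = 0 := by
  funext m
  rw [adShift_apply, kappaSeries, lie_smul, LieRing.of_associative_ring_bracket]
  exact (congrArg _ (sub_self T)).trans (smul_zero _)

/-- Scalars commute with T, so only the polynomial is differentiated; the extra summand is the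
degree shift of `adShift_eulerSeries`. -/
theorem adShift_kappaDerivation {T : Module.End ℂ V} {k : Idx N}
    {δ : Derivation ℂ (MvPolynomial σ ℂ) (MvPolynomial σ ℂ)} (h : Implements T k δ)
    (f : MvPolynomial σ ℂ) :
    adShift T k (kappaDerivation κ hκ f)
      = kappaDerivation κ hκ (δ f) + δ f • kappaDot κ k := by
  simp only [kappaDerivation_apply, kappaDot, map_sum, adShift_eulerSeries, adShift_smul h,
    adShift_kappaSeries, smul_zero, zero_add, Finset.sum_add_distrib, Finset.smul_sum]
  congr 1
  exact Finset.sum_congr rfl fun p _ => smul_comm _ _ _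

theorem modes_lie_modes (f g : MvPolynomial σ ℂ) (s t : Idx N) :
    ⁅modes (V := V) f s, modes (V := V) g t⁆ = 0 := by
  have h : ∀ f : MvPolynomial σ ℂ, Implements (V := V) (modes f s) s 0 := by
    intro f
    refine implements_of_X fun α t => ?_
    rw [Derivation.coe_zero, Pi.zero_apply, modes_zero, Pi.zero_apply, ← lie_skew, neg_eq_zero]
    have h2 : Implements (V := V) (modes (X α : MvPolynomial σ ℂ) t) t 0 := by
      refine implements_of_X fun β r => ?_
      rw [Derivation.coe_zero, Pi.zero_apply, modes_zero, Pi.zero_apply]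
      ext v
      simp only [LieRing.of_associative_ring_bracket, LinearMap.sub_apply, Module.End.mul_apply,
        modes_X, LinearMap.zero_apply]
      rw [CommutingFields.commute, sub_self]
    rw [h2 f s, Derivation.coe_zero, Pi.zero_apply, modes_zero, Pi.zero_apply]
  rw [h f g t, Derivation.coe_zero, Pi.zero_apply, modes_zero, Pi.zero_apply]

theorem implements_modes (f : MvPolynomial σ ℂ) (s : Idx N) :
    Implements (V := V) (modes f s) s 0 := by
  intro g t
  rw [modes_lie_modes, Derivation.coe_zero, Pi.zero_apply, modes_zero, Pi.zero_apply]

end KappaDerivation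

/-! ### Brackets of currents -/

section Dorfman

open MvPolynomial

/-- Data of the free fields: `a_α` conjugate to the commuting fields, and Heisenberg fields `Ψ_b`
with Gram matrix `-B`. -/
structure FreeFields {σ V : Type*} [AddCommGroup V] [Module ℂ V] {N : ℕ} [CommutingFields σ N V]
    (κ : Idx N → Fin (N + 1) → ℂ) (I : Type*) (a : σ → OpSeries N V) (Ψ : I → OpSeries N V)
    (B : I → I → ℂ) : Prop where
  kappa : ∀ m : Idx N, ∑ p, (m p : ℂ) * κ m p = 0
  implements_a : ∀ α m, Implements (a α m) m (pderiv α)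
  a_a : ∀ α β m k, ⁅a α m, a β k⁆ = 0
  a_psi : ∀ α b m k, ⁅a α m, Ψ b k⁆ = 0
  implements_psi : ∀ b m, Implements (Ψ b m) m 0
  psi_psi : ∀ b c m k, ⁅Ψ b m, Ψ c k⁆ = (-B b c) • kappaDot κ m (m + k)

variable {σ V : Type*} [AddCommGroup V] [Module ℂ V] {N : ℕ} [CommutingFields σ N V] [Fintype σ]
  {κ : Idx N → Fin (N + 1) → ℂ} {I : Type*} [Fintype I] {a : σ → OpSeries N V}
  {Ψ : I → OpSeries N V} {B : I → I → ℂ}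

theorem derivation_eq_sum (P : Derivation ℂ (MvPolynomial σ ℂ) (MvPolynomial σ ℂ))
    (f : MvPolynomial σ ℂ) : P f = ∑ α, P (X α) * pderiv α f := by
  classical
  have e : ∀ x, (∑ α, P (X α) • pderiv (R := ℂ) α) x = ∑ α, P (X α) * pderiv α x := fun x => by
    have := congrFun (map_sum (Derivation.coeFnAddMonoidHom (R := ℂ) (A := MvPolynomial σ ℂ)
      (M := MvPolynomial σ ℂ)) (fun α => P (X α) • pderiv (R := ℂ) α) Finset.univ) x
    rw [Finset.sum_apply] at this
    exact this
  have : P = ∑ α, P (X α) • pderiv α := by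
    refine MvPolynomial.derivation_ext fun β => ?_
    rw [e, Finset.sum_eq_single β]
    · simp
    · intro α _ h
      simp [pderiv_X_of_ne h.symm]
    · simp
  conv_lhs => rw [this]
  exact e f

variable (h : FreeFields κ I a Ψ B) {ι : Type*} [Fintype ι]
  (P P' : Derivation ℂ (MvPolynomial σ ℂ) (MvPolynomial σ ℂ)) (ζ ζ' : I → MvPolynomial σ ℂ)
  (f g f' g' : ι → MvPolynomial σ ℂ)

/-- The current `∑ P(u_α) a_α + ∑ ζ_b Ψ_b + ∑ f_i κ·D g_i`. -/
def FreeFields.current (h : FreeFields κ I a Ψ B)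
    (P : Derivation ℂ (MvPolynomial σ ℂ) (MvPolynomial σ ℂ)) (ζ : I → MvPolynomial σ ℂ)
    (f g : ι → MvPolynomial σ ℂ) : OpSeries N V :=
  ∑ α, P (X α) • a α + ∑ b, ζ b • Ψ b + ∑ i, f i • kappaDerivation κ h.kappa (g i)

/-- Only the a-part of a current sees the polynomials. The bracket is computed with the roles
exchanged: a mode of p implements the zero derivation, so its bracket with the current passes
through the polynomial coefficients to the a_α, giving ∑ P(u_α) ∂_α p = P(p). -/
theorem FreeFields.implements_current (k : Idx N) :
    Implements (h.current P ζ f g k) k P := by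
  intro p s
  have himp := implements_modes (V := V) p s
  have ha : ∀ α, adShift (modes p s) s (a α) = -modes (pderiv α p) := by
    intro α
    funext m
    rw [adShift_apply, ← lie_skew, h.implements_a α (m - s) p s, add_sub_cancel]
    rfl
  have hΨ : ∀ b, adShift (modes p s) s (Ψ b) = 0 := by
    intro b
    funext m
    rw [adShift_apply, ← lie_skew, h.implements_psi b (m - s) p s]
    simp [modes_zero]
  have key : adShift (modes p s) s (h.current P ζ f g) = -modes (P p) := by
    rw [derivation_eq_sum P, modes_sum, current]
    simp only [map_add, map_sum, adShift_smul himp, adShift_kappaDerivation h.kappa himp, ha, hΨ,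
      Derivation.coe_zero, Pi.zero_apply, map_zero, zero_smul, smul_zero, add_zero,
      Finset.sum_const_zero, smul_neg, smul_modes, Finset.sum_neg_distrib, mul_comm]
  have := congrFun key (k + s)
  rw [adShift_apply, add_sub_cancel_right, Pi.neg_apply] at this
  rw [← lie_skew, this, neg_neg, add_comm]

/-- By skew symmetry, bracket the mode of Ψ_c with the current, which produces ζ_b times κ
contracted with m - k. Splitting m - k, the m-part becomes -κ·D ζ_b by `smul_kappaDot_apply` and the
k-part remains central. -/
theorem FreeFields.adShift_current_psi (k : Idx N) (c : I) :
    adShift (h.current P ζ f g k) k (Ψ c)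
      = -∑ b, (B c b) • (ζ b • kappaDot κ k + kappaDerivation κ h.kappa (ζ b)) := by
  funext m
  have himp := h.implements_psi c (m - k)
  have ha : ∀ α, adShift (Ψ c (m - k)) (m - k) (a α) = 0 := by
    intro α
    funext r
    rw [adShift_apply, ← lie_skew, h.a_psi, neg_zero]
    rfl
  have hΨ : ∀ b, adShift (Ψ c (m - k)) (m - k) (Ψ b) = (-B c b) • kappaDot κ (m - k) := by
    intro b
    funext r
    rw [adShift_apply, h.psi_psi, add_sub_cancel]
    rfl
  have key : adShift (Ψ c (m - k)) (m - k) (h.current P ζ f g)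
      = ∑ b, ζ b • (-B c b) • kappaDot κ (m - k) := by
    rw [current]
    simp only [map_add, map_sum, adShift_smul himp, adShift_kappaDerivation h.kappa himp, ha, hΨ,
      Derivation.coe_zero, Pi.zero_apply, map_zero, zero_smul, smul_zero, add_zero, zero_add,
      Finset.sum_const_zero]
  have h1 := congrFun key m
  rw [adShift_apply, sub_sub_cancel] at h1
  rw [adShift_apply, ← lie_skew, h1, Pi.neg_apply, Finset.sum_apply, Finset.sum_apply]
  refine congrArg _ (Finset.sum_congr rfl fun b _ => ?_)
  have h2 : kappaDot (V := V) κ (m - k) = kappaDot κ m - kappaDot κ k := by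
    rw [eq_sub_iff_add_eq, ← kappaDot_add, sub_add_cancel]
  rw [smul_comm, h2, smul_sub, Pi.smul_apply, Pi.sub_apply, smul_kappaDot_apply h.kappa,
    Pi.smul_apply, Pi.add_apply, neg_smul, ← smul_neg]
  congr 1
  abel

/-- Again the bracket is taken from the side of a_α, which differentiates all coefficients by ∂_α.
The term f κ·D(∂_α g) is turned into one with f differentiated by applying `smul_kappaDot_apply` to
the product f ∂_α g, as in integration by parts. -/
theorem FreeFields.adShift_current_a (k : Idx N) (α : σ) :
    adShift (h.current P ζ f g k) k (a α)
      = -(∑ β, pderiv α (P (X β)) • a β + ∑ b, pderiv α (ζ b) • Ψ b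
        + ∑ i, (pderiv α (f i) • kappaDerivation κ h.kappa (g i)
          - pderiv α (g i) • kappaDerivation κ h.kappa (f i)
          - (f i * pderiv α (g i)) • kappaDot κ k)) := by
  funext m
  have himp := h.implements_a α (m - k)
  have ha : ∀ β, adShift (a α (m - k)) (m - k) (a β) = 0 := by
    intro β
    funext r
    rw [adShift_apply, h.a_a]
    rfl
  have hΨ : ∀ b, adShift (a α (m - k)) (m - k) (Ψ b) = 0 := by
    intro b
    funext r
    rw [adShift_apply, h.a_psi]
    rfl
  have key : adShift (a α (m - k)) (m - k) (h.current P ζ f g)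
      = ∑ β, pderiv α (P (X β)) • a β + ∑ b, pderiv α (ζ b) • Ψ b
        + ∑ i, (f i • (kappaDerivation κ h.kappa (pderiv α (g i))
            + pderiv α (g i) • kappaDot κ (m - k))
          + pderiv α (f i) • kappaDerivation κ h.kappa (g i)) := by
    rw [current]
    simp only [map_add, map_sum, adShift_smul himp, adShift_kappaDerivation h.kappa himp, ha, hΨ,
      smul_zero, zero_add]
  have h1 := congrFun key m
  rw [adShift_apply, sub_sub_cancel] at h1
  rw [adShift_apply, ← lie_skew, h1]
  simp only [Pi.neg_apply, Pi.add_apply, Finset.sum_apply]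
  refine congrArg _ (congrArg _ (Finset.sum_congr rfl fun i _ => ?_))
  have h2 : kappaDot (V := V) κ (m - k) = kappaDot κ m - kappaDot κ k := by
    rw [eq_sub_iff_add_eq, ← kappaDot_add, sub_add_cancel]
  have h3 := smul_kappaDot_apply (V := V) h.kappa (f i * pderiv α (g i)) m
  rw [Derivation.leibniz] at h3
  simp only [Pi.add_apply, Pi.sub_apply, smul_add, smul_smul, h2, smul_sub, h3]
  abel

/-- The commutator of two currents. -/
theorem FreeFields.adShift_current (k : Idx N) :
    adShift (h.current P ζ f g k) k (h.current P' ζ' f' g')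
      = ∑ α, ⁅P, P'⁆ (X α) • a α + ∑ b, (P (ζ' b) - P' (ζ b)) • Ψ b
        - ∑ c, ∑ b, (B c b) • ((ζ' c * ζ b) • kappaDot κ k
            + ζ' c • kappaDerivation κ h.kappa (ζ b))
        + ∑ i, (P (f' i) • kappaDerivation κ h.kappa (g' i)
            + f' i • kappaDerivation κ h.kappa (P (g' i)) + (f' i * P (g' i)) • kappaDot κ k)
        - ∑ i, (P' (f i) • kappaDerivation κ h.kappa (g i)
            - P' (g i) • kappaDerivation κ h.kappa (f i) - (f i * P' (g i)) • kappaDot κ k) := by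
  have himp := h.implements_current P ζ f g k
  have h1 : ∑ α, P' (X α) • adShift (h.current P ζ f g k) k (a α)
      = -(∑ β, P' (P (X β)) • a β + ∑ b, P' (ζ b) • Ψ b
        + ∑ i, (P' (f i) • kappaDerivation κ h.kappa (g i)
          - P' (g i) • kappaDerivation κ h.kappa (f i)
          - (f i * P' (g i)) • kappaDot κ k)) := by
    simp only [h.adShift_current_a, smul_neg, Finset.sum_neg_distrib, smul_add, Finset.smul_sum,
      smul_sub, smul_smul, Finset.sum_add_distrib, Finset.sum_sub_distrib]
    -- The chain rule reassembles ∑ P'(u_α) ∂_α into the derivation P'.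
    have e : ∀ (p : MvPolynomial σ ℂ) (A : OpSeries N V),
        ∑ α, (P' (X α) * pderiv α p) • A = P' p • A := by
      intro p A
      rw [← Finset.sum_smul, ← derivation_eq_sum]
    have e' : ∀ (q p : MvPolynomial σ ℂ) (A : OpSeries N V),
        ∑ α, (P' (X α) * (q * pderiv α p)) • A = (q * P' p) • A := by
      intro q p A
      simp only [mul_left_comm _ q, ← Finset.sum_smul, ← Finset.mul_sum, ← derivation_eq_sum]
    congr 1
    refine congrArg₂ _ (congrArg₂ _ ?_ ?_) (congrArg₂ _ (congrArg₂ _ ?_ ?_) ?_)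
    all_goals rw [Finset.sum_comm]; refine Finset.sum_congr rfl fun i _ => ?_
    · exact e _ _
    · exact e _ _
    · exact e _ _
    · exact e _ _
    · exact e' _ _ _
  have h2 : ∑ c, ζ' c • adShift (h.current P ζ f g k) k (Ψ c)
      = -∑ c, ∑ b, (B c b) • ((ζ' c * ζ b) • kappaDot κ k
            + ζ' c • kappaDerivation κ h.kappa (ζ b)) := by
    simp only [h.adShift_current_psi, smul_neg, Finset.sum_neg_distrib, Finset.smul_sum,
      smul_comm (_ : MvPolynomial σ ℂ) (_ : ℂ), smul_add, smul_smul]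
  have h3 : adShift (h.current P ζ f g k) k (h.current P' ζ' f' g')
      = (∑ α, P' (X α) • adShift (h.current P ζ f g k) k (a α) + ∑ α, P (P' (X α)) • a α)
        + (∑ c, ζ' c • adShift (h.current P ζ f g k) k (Ψ c) + ∑ c, P (ζ' c) • Ψ c)
        + ∑ i, (P (f' i) • kappaDerivation κ h.kappa (g' i)
            + f' i • kappaDerivation κ h.kappa (P (g' i))
            + (f' i * P (g' i)) • kappaDot κ k) := by
    conv_lhs => rw [current.eq_def (P := P')]
    simp only [map_add, map_sum, adShift_smul himp, adShift_kappaDerivation h.kappa himp,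
      Finset.sum_add_distrib, smul_add, smul_smul]
    abel
  rw [h3, h1, h2]
  simp only [Derivation.commutator_apply, sub_smul, Finset.sum_sub_distrib]
  abel

end Dorfman

/-! ### Triangular splitting and invariant one-forms -/

section MatrixCalculus

set_option linter.unusedSectionVars false

variable {J I O : Type*} [CommRing J] [Algebra ℂ J] [LinearOrder I] [Fintype I] [AddCommGroup O]
  [Module ℂ O] [Module J O]

/-- The strictly upper triangular part of a matrix. -/
def upper : Matrix I I J →+ Matrix I I J where
  toFun M := Matrix.of fun i j => if i < j then M i j else 0
  map_zero' := by ext i j; simp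
  map_add' M N := by
    ext i j
    by_cases h : i < j <;> simp [h]

theorem upper_apply (M : Matrix I I J) (i j : I) : upper M i j = if i < j then M i j else 0 := rfl

theorem upper_map (P : Derivation ℂ J J) (M : Matrix I I J) :
    (upper M).map P = upper (M.map P) := by
  ext i j
  by_cases h : i < j <;> simp [upper_apply, h]

theorem upper_upper_mul_upper (M N : Matrix I I J) :
    upper (upper M * upper N) = upper M * upper N := by
  ext i j
  rw [upper_apply]
  split_ifs with h
  · rfl
  · rw [Matrix.mul_apply, eq_comm]
    refine Finset.sum_eq_zero fun s _ => ?_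
    rw [upper_apply, upper_apply]
    split_ifs with h1 h2
    · exact absurd (h1.trans h2) h
    all_goals simp

theorem upper_lower_mul_lower (M N : Matrix I I J) :
    upper ((M - upper M) * (N - upper N)) = 0 := by
  ext i j
  rw [upper_apply]
  split_ifs with h
  · rw [Matrix.mul_apply]
    refine Finset.sum_eq_zero fun s _ => ?_
    rw [Matrix.sub_apply, Matrix.sub_apply, upper_apply, upper_apply]
    split_ifs with h1 h2 h3
    · simp
    · simp
    · simp
    · exact absurd h (not_lt.2 ((not_lt.1 h3).trans (not_lt.1 h1)))
  · rfl

theorem upper_mul_upper_diag (M N : Matrix I I J) (b : I) : (upper M * upper N) b b = 0 := by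
  rw [Matrix.mul_apply]
  refine Finset.sum_eq_zero fun s _ => ?_
  rw [upper_apply, upper_apply]
  split_ifs with h1 h2
  · exact absurd (h1.trans h2) (lt_irrefl b)
  all_goals simp

theorem lower_mul_lower_diag (M N : Matrix I I J) (b : I) :
    ((M - upper M) * (N - upper N)) b b = M b b * N b b := by
  rw [Matrix.mul_apply, Finset.sum_eq_single b]
  · simp [upper_apply]
  · intro s _ hs
    rw [Matrix.sub_apply, Matrix.sub_apply, upper_apply, upper_apply]
    rcases lt_or_gt_of_ne hs with h | h <;> simp [h]
  · simp

/-- Since products of weakly lower matrices are weakly lower, the strictly upper parts of (x -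
x_+)(y - y_+) and (y - y_+)(x - x_+) vanish; the identity is the difference of these two facts. It
makes the vector fields on the cell close under the bracket. -/
theorem upper_bracket (x y : Matrix I I J) :
    upper (upper x * y - y * upper x) + upper y * upper x
      - upper (upper y * x - x * upper y) - upper x * upper y = upper (x * y - y * x) := by
  have h1 := upper_lower_mul_lower x y
  have h2 := upper_lower_mul_lower y x
  simp only [sub_mul, mul_sub, map_sub, upper_upper_mul_upper] at h1 h2 ⊢
  linear_combination (norm := abel) h2 - h1

/-- Products of strictly upper matrices have zero diagonal, while diagonals of weakly lower matrices
multiply entrywise and hence commute. -/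
theorem diag_bracket (x y : Matrix I I J) (b : I) :
    (upper x * y - y * upper x) b b - (upper y * x - x * upper y) b b = (x * y - y * x) b b := by
  have h1 := lower_mul_lower_diag x y b
  have h2 := lower_mul_lower_diag y x b
  have h3 := upper_mul_upper_diag x y b
  have h4 := upper_mul_upper_diag y x b
  simp only [sub_mul, mul_sub, Matrix.sub_apply] at h1 h2 ⊢
  linear_combination h2 - h1 + h3 - h4

theorem map_derivation_mul (P : Derivation ℂ J J) (M N : Matrix I I J) :
    (M * N).map P = M.map P * N + M * N.map P := by
  ext i j
  simp only [Matrix.map_apply, Matrix.mul_apply, Matrix.add_apply, map_sum, Derivation.leibniz,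
    smul_eq_mul, Finset.sum_add_distrib]
  rw [add_comm]
  simp only [mul_comm]

theorem map_derivation_const (P : Derivation ℂ J J) (X : Matrix I I ℂ) :
    (X.map (algebraMap ℂ J)).map P = 0 := by
  ext i j
  simp

/-- `tr(M dN)`. -/
def traceD (D : Derivation ℂ J O) (M N : Matrix I I J) : O := ∑ i, ∑ j, M i j • D (N j i)

theorem traceD_add_left (D : Derivation ℂ J O) (M M' N : Matrix I I J) :
    traceD D (M + M') N = traceD D M N + traceD D M' N := by
  simp [traceD, add_smul, Finset.sum_add_distrib]

theorem traceD_neg_left (D : Derivation ℂ J O) (M N : Matrix I I J) :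
    traceD D (-M) N = -traceD D M N := by
  simp [traceD]

theorem traceD_sub_left (D : Derivation ℂ J O) (M M' N : Matrix I I J) :
    traceD D (M - M') N = traceD D M N - traceD D M' N := by
  rw [sub_eq_add_neg, traceD_add_left, traceD_neg_left, ← sub_eq_add_neg]

theorem traceD_mul_right (D : Derivation ℂ J O) (M N N' : Matrix I I J) :
    traceD D M (N * N') = traceD D (N' * M) N + traceD D (M * N) N' := by
  simp only [traceD, Matrix.mul_apply, map_sum, Derivation.leibniz, Finset.smul_sum, smul_add,
    smul_smul, Finset.sum_smul, Finset.sum_add_distrib]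
  rw [add_comm]
  congr 1
  · conv_lhs => enter [2, i]; rw [Finset.sum_comm]
    rw [Finset.sum_comm]
    refine Finset.sum_congr rfl fun s _ => ?_
    rw [Finset.sum_comm]
    refine Finset.sum_congr rfl fun i _ => Finset.sum_congr rfl fun j _ => ?_
    rw [mul_comm]
  · refine Finset.sum_congr rfl fun i _ => ?_
    rw [Finset.sum_comm]

theorem traceD_const_right (D : Derivation ℂ J O) (M : Matrix I I J) (X : Matrix I I ℂ) :
    traceD D M (X.map (algebraMap ℂ J)) = 0 := by
  simp [traceD]

/-- Each entry N_{ji} pairs with M_{ij}; the three summands collect i > j, i < j and i = j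
respectively. -/
theorem traceD_split (D : Derivation ℂ J O) (M N : Matrix I I J) :
    traceD D M N = traceD D M (upper N) + traceD D (upper M) N + ∑ i, M i i • D (N i i) := by
  simp only [traceD]
  rw [← Finset.sum_add_distrib, ← Finset.sum_add_distrib]
  refine Finset.sum_congr rfl fun i _ => ?_
  rw [← Finset.sum_add_distrib]
  have h : M i i • D (N i i) = ∑ j, if j = i then M i j • D (N j i) else 0 := by simp
  rw [h, ← Finset.sum_add_distrib]
  refine Finset.sum_congr rfl fun j _ => ?_
  rw [upper_apply, upper_apply]
  rcases lt_trichotomy i j with h | h | h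
  · simp [h, h.not_gt, h.ne']
  · simp [h]
  · simp [h, h.not_gt, h.ne]

theorem trace_split (M N : Matrix I I J) :
    (M * N).trace = (M * upper N).trace + (upper M * N).trace + ∑ i, M i i * N i i := by
  simp only [Matrix.trace, Matrix.diag_apply, Matrix.mul_apply]
  rw [← Finset.sum_add_distrib, ← Finset.sum_add_distrib]
  refine Finset.sum_congr rfl fun i _ => ?_
  rw [← Finset.sum_add_distrib]
  have h : M i i * (N i i) = ∑ j, if j = i then M i j * (N j i) else 0 := by simp
  rw [h, ← Finset.sum_add_distrib]
  refine Finset.sum_congr rfl fun j _ => ?_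
  rw [upper_apply, upper_apply]
  rcases lt_trichotomy i j with h | h | h
  · simp [h, h.not_gt, h.ne']
  · simp [h]
  · simp [h, h.not_gt, h.ne]

/-- Scalar matrices inside matrices over `J`. -/
abbrev constMat (J : Type*) [CommRing J] [Algebra ℂ J] (X : Matrix I I ℂ) : Matrix I I J :=
  X.map (algebraMap ℂ J)

theorem constMat_mul (X Y : Matrix I I ℂ) : constMat J (X * Y) = constMat J X * constMat J Y :=
  Matrix.map_mul

theorem constMat_sub (X Y : Matrix I I ℂ) : constMat J (X - Y) = constMat J X - constMat J Y := by
  ext i j; simp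

theorem constMat_trace (X : Matrix I I ℂ) : (constMat J X).trace = algebraMap ℂ J X.trace := by
  simp [Matrix.trace]

variable {U V : Matrix I I J}

theorem map_inverse (hUV : U * V = 1) (hVU : V * U = 1) {P : Derivation ℂ J J}
    {x : Matrix I I J} (hP : U.map P = x * U) : V.map P = -(V * x) := by
  have h := map_derivation_mul P U V
  have h1 : (1 : Matrix I I J).map P = 0 := by
    ext i j
    by_cases h : i = j
    · subst h; simp
    · simp [Matrix.one_apply_ne h]
  rw [hUV, h1, hP, mul_assoc, hUV, mul_one] at h
  calc V.map P = V * U * V.map P := by rw [hVU, one_mul]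
    _ = V * (x + U * V.map P) - V * x := by rw [mul_add, mul_assoc]; abel
    _ = _ := by rw [← h, mul_zero, zero_sub]

theorem map_conj (hUV : U * V = 1) (hVU : V * U = 1) {P : Derivation ℂ J J}
    {x : Matrix I I J} (hP : U.map P = x * U) (Y : Matrix I I ℂ) :
    (U * constMat J Y * V).map P = x * (U * constMat J Y * V) - U * constMat J Y * V * x := by
  rw [map_derivation_mul, map_derivation_mul, map_derivation_const, hP,
    map_inverse hUV hVU hP]
  simp only [mul_zero, add_zero, mul_neg, mul_assoc, sub_eq_add_neg]

theorem conj_mul (hVU : V * U = 1) (X Y : Matrix I I ℂ) :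
    U * constMat J (X * Y) * V = (U * constMat J X * V) * (U * constMat J Y * V) := by
  rw [constMat_mul]
  calc _ = U * constMat J X * 1 * constMat J Y * V := by simp only [mul_assoc, mul_one]
    _ = _ := by rw [← hVU]; simp only [mul_assoc]

/-- The invariant one-forms: the `κ·D` part of the commutator of two currents. -/
theorem traceD_bracket (D : Derivation ℂ J O) (hVU : V * U = 1)
    (X Y : Matrix I I ℂ) {x y : Matrix I I J} (hx : x = U * constMat J X * V)
    (hy : y = U * constMat J Y * V) :
    traceD D (constMat J Y * V * upper x) U - traceD D (constMat J Y * V) (upper x * U)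
      - traceD D (constMat J X * V * upper y) U - traceD D (upper y * U) (constMat J X * V)
      - ∑ b, y b b • D (x b b)
    = -traceD D (constMat J (X * Y - Y * X) * V) U := by
  -- `h1` and `h2` combine the first four terms into -tr(y dx_+) - tr(y_+ dx); with the diagonal
  -- sum, `h3` makes this -tr(y dx). Expanding x = U X V in `h4` and `h5`, and using d(VU) = 0 in
  -- `h6` and `h7`, gives the invariant form of the commutator.
  have h1 := traceD_mul_right D (constMat J Y * V) (upper x) U
  have h2 := traceD_mul_right D (upper y) U (constMat J X * V)
  have h3 := traceD_split D y x
  have h4 := traceD_mul_right D y U (constMat J X * V)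
  have h5 := traceD_mul_right D (U * constMat J Y) (constMat J X) V
  have h6 := traceD_mul_right D (constMat J Y * constMat J X) V U
  have h7 : traceD D (constMat J Y * constMat J X) (V * U) = 0 := by
    have := traceD_const_right D (constMat J Y * constMat J X) (1 : Matrix I I ℂ)
    rw [hVU]
    convert this using 2
    simp
  rw [← mul_assoc U, ← hy] at h1
  rw [← mul_assoc U, ← hx] at h2 h4
  rw [traceD_const_right, zero_add] at h5
  have e1 : constMat J X * V * y = constMat J X * (constMat J Y * V) := by
    rw [hy]
    calc _ = constMat J X * (V * U) * constMat J Y * V := by simp only [mul_assoc]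
      _ = _ := by rw [hVU, mul_one, mul_assoc]
  have e2 : y * U = U * constMat J Y := by rw [hy, mul_assoc, hVU, mul_one]
  have e3 : constMat J (X * Y - Y * X) * V = constMat J X * (constMat J Y * V)
      - constMat J Y * constMat J X * V := by
    rw [constMat_sub, constMat_mul, constMat_mul, sub_mul, mul_assoc]
  rw [e1, e2, h5] at h4
  rw [e3, traceD_sub_left]
  have h8 : U * constMat J Y * constMat J X = U * (constMat J Y * constMat J X) := mul_assoc _ _ _
  rw [h7, ← h8] at h6
  rw [h4] at h3
  linear_combination (norm := abel) h3 - h1 + h2 + h6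

/-- P differentiates the conjugate y by commutation with x_+, and U by multiplication with x_+, so P
P' U - P' P U is the left side of `upper_bracket` times U. -/
theorem map_commutator (hUV : U * V = 1) (hVU : V * U = 1) {P P' : Derivation ℂ J J}
    (X Y : Matrix I I ℂ) {x y : Matrix I I J} (hx : x = U * constMat J X * V)
    (hy : y = U * constMat J Y * V) (hP : U.map P = upper x * U) (hP' : U.map P' = upper y * U)
    (i j : I) : ⁅P, P'⁆ (U i j) = (upper (x * y - y * x) * U) i j := by
  have e : Matrix.of (fun i j => ⁅P, P'⁆ (U i j)) = (U.map P').map P - (U.map P).map P' := by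
    ext i j
    simp only [Derivation.commutator_apply, Matrix.of_apply, Matrix.sub_apply, Matrix.map_apply]
  have h1 := map_conj hUV hVU hP Y
  have h2 := map_conj hUV hVU hP' X
  rw [← hy] at h1
  rw [← hx] at h2
  have e2 : Matrix.of (fun i j => ⁅P, P'⁆ (U i j)) = upper (x * y - y * x) * U := by
    rw [e, hP, hP', map_derivation_mul, map_derivation_mul, upper_map, upper_map, h1, h2, hP, hP',
      ← upper_bracket x y]
    simp only [add_mul, sub_mul, mul_assoc]
    abel
  exact congrFun (congrFun e2 i) j

/-- The scalar part of the commutator of two currents. -/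
theorem trace_bracket (hVU : V * U = 1) (X Y : Matrix I I ℂ) {x y : Matrix I I J}
    (hx : x = U * constMat J X * V) (hy : y = U * constMat J Y * V) :
    (constMat J Y * V * (upper x * U)).trace + (constMat J X * V * (upper y * U)).trace
      + ∑ b, y b b * x b b = algebraMap ℂ J (X * Y).trace := by
  have h1 : (constMat J Y * V * (upper x * U)).trace = (y * upper x).trace := by
    rw [hy, ← mul_assoc, Matrix.trace_mul_comm, ← mul_assoc, ← mul_assoc]
  have h2 : (constMat J X * V * (upper y * U)).trace = (upper y * x).trace := by
    rw [hx, ← mul_assoc, Matrix.trace_mul_comm, Matrix.trace_mul_comm (upper y), ← mul_assoc,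
      ← mul_assoc]
  have h3 : (y * x).trace = algebraMap ℂ J (X * Y).trace := by
    rw [hx, hy, ← conj_mul hVU, Matrix.trace_mul_comm, ← mul_assoc, hVU, one_mul, constMat_trace,
      Matrix.trace_mul_comm]
  rw [h1, h2, ← trace_split, h3]

theorem trace_conj (hVU : V * U = 1) (X : Matrix I I ℂ) :
    ∑ i, (U * constMat J X * V) i i = algebraMap ℂ J X.trace := by
  have h3 : (U * constMat J X * V).trace = algebraMap ℂ J X.trace := by
    rw [Matrix.trace_mul_comm, ← mul_assoc, hVU, one_mul, constMat_trace]
  exact h3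

/-- A Gram summand depending on one index alone lets the other index be summed freely, and that sum
is zero. Only the identity part of B matters for traceless data. -/
theorem sum_gram_smul [IsScalarTower ℂ J O] {B : I → I → ℂ} {β γ : I → ℂ}
    (hB : ∀ i j, B i j = (if i = j then 1 else 0) + β i + γ j) (F : J →+ O)
    {u v : I → J} (hu : ∑ i, u i = 0) (hv : ∑ i, v i = 0) :
    ∑ i, ∑ j, B i j • (v i • F (u j)) = ∑ i, v i • F (u i) := by
  have e : ∀ i j, B i j • (v i • F (u j)) = (if i = j then v i • F (u j) else 0)
      + β i • (v i • F (u j)) + γ j • (v i • F (u j)) := by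
    intro i j
    rw [hB, add_smul, add_smul, ite_smul, one_smul, zero_smul]
  simp only [e, Finset.sum_add_distrib, Finset.sum_ite_eq, Finset.mem_univ, if_true]
  have h1 : ∑ i, ∑ j, β i • (v i • F (u j)) = 0 := by
    simp only [← Finset.smul_sum, ← map_sum, hu, map_zero, smul_zero, Finset.sum_const_zero]
  have h2 : ∑ i, ∑ j, γ j • (v i • F (u j)) = 0 := by
    rw [Finset.sum_comm]
    simp only [← Finset.smul_sum, ← Finset.sum_smul, hv, zero_smul, smul_zero,
      Finset.sum_const_zero]
  rw [h1, h2, add_zero, add_zero]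

end MatrixCalculus

/-! ### Currents attached to matrices -/

section Realization

open MvPolynomial

set_option linter.unusedSectionVars false

variable {σ W : Type*} [AddCommGroup W] [Module ℂ W] {N : ℕ} [CommutingFields σ N W] [Fintype σ]
  {κ : Idx N → Fin (N + 1) → ℂ} {I : Type*} [Fintype I] [LinearOrder I] {a : σ → OpSeries N W}
  {Ψ : I → OpSeries N W} {B : I → I → ℂ}

/-- Coordinates on the big cell: a unipotent matrix `U` with inverse `V` whose entries are the
polynomial generators up to sign, and the infinitesimal action `P` of matrices,
`P_X U = (U X U⁻¹)_+ U`. -/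
structure BigCell (I σ : Type*) [Fintype I] [LinearOrder I] where
  U : Matrix I I (MvPolynomial σ ℂ)
  V : Matrix I I (MvPolynomial σ ℂ)
  U_mul_V : U * V = 1
  V_mul_U : V * U = 1
  row : σ → I
  col : σ → I
  X_eq : ∀ α, X α = -U (row α) (col α)
  P : Matrix I I ℂ → Derivation ℂ (MvPolynomial σ ℂ) (MvPolynomial σ ℂ)
  map_P : ∀ M, U.map (P M) = upper (U * constMat _ M * V) * U

/-- The conjugate `U X U⁻¹`. -/
def BigCell.conj (b : BigCell I σ) (M : Matrix I I ℂ) : Matrix I I (MvPolynomial σ ℂ) :=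
  b.U * constMat _ M * b.V

theorem BigCell.conj_commutator (b : BigCell I σ) (X Y : Matrix I I ℂ) :
    b.conj (X * Y - Y * X) = b.conj X * b.conj Y - b.conj Y * b.conj X := by
  rw [conj, constMat_sub, mul_sub, sub_mul, conj_mul b.V_mul_U, conj_mul b.V_mul_U]
  rfl

theorem BigCell.P_commutator (b : BigCell I σ) (X Y : Matrix I I ℂ) (α : σ) :
    ⁅b.P X, b.P Y⁆ (MvPolynomial.X α) = b.P (X * Y - Y * X) (MvPolynomial.X α) := by
  rw [b.X_eq, map_neg, map_neg, map_commutator b.U_mul_V b.V_mul_U X Y rfl rfl (b.map_P X)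
    (b.map_P Y)]
  have h := congrFun (congrFun (b.map_P (X * Y - Y * X)) (b.row α)) (b.col α)
  rw [Matrix.map_apply] at h
  rw [h]
  have h1 := b.conj_commutator X Y
  unfold conj at h1
  rw [h1]

theorem trace_mul_eq_sum {R : Type*} [CommRing R] (M M' : Matrix I I R) :
    (M * M').trace = ∑ i, ∑ j, M i j * M' j i := rfl

/-- The current attached to a matrix. -/
def FreeFields.matrixCurrent (h : FreeFields κ I a Ψ B) (b : BigCell I σ) (M : Matrix I I ℂ) :
    OpSeries N W :=
  h.current (b.P M) (fun i => -b.conj M i i)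
    (fun ij : I × I => -(constMat (MvPolynomial σ ℂ) M * b.V : Matrix I I _) ij.1 ij.2)
    (fun ij => b.U ij.2 ij.1)

theorem FreeFields.matrixCurrent_eq (h : FreeFields κ I a Ψ B) (b : BigCell I σ)
    (M : Matrix I I ℂ) :
    h.matrixCurrent b M = ∑ α, b.P M (X α) • a α - ∑ i, b.conj M i i • Ψ i
      - traceD (kappaDerivation κ h.kappa) (constMat _ M * b.V) b.U := by
  rw [matrixCurrent, current, Fintype.sum_prod_type, traceD]
  simp only [neg_smul, Finset.sum_neg_distrib, sub_eq_add_neg]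

/-- The Dorfman formula splits into independent identities for the a-, Ψ-, κ·D- and scalar parts,
supplied by `BigCell.P_commutator`, `diag_bracket`, `traceD_bracket` and `trace_bracket`.
Tracelessness is used only to reduce the Gram matrix to the identity. -/
theorem FreeFields.adShift_matrixCurrent (h : FreeFields κ I a Ψ B) (b : BigCell I σ)
    {β γ : I → ℂ} (hB : ∀ i j, B i j = (if i = j then 1 else 0) + β i + γ j)
    (X Y : Matrix I I ℂ) (hX : X.trace = 0) (hY : Y.trace = 0) (k : Idx N) :
    adShift (h.matrixCurrent b X k) k (h.matrixCurrent b Y)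
      = h.matrixCurrent b (X * Y - Y * X) - (X * Y).trace • kappaDot κ k := by
  have hPX := b.map_P X
  have hPY := b.map_P Y
  have hsx : ∑ i, b.conj X i i = 0 := by
    rw [BigCell.conj, trace_conj b.V_mul_U, hX, map_zero]
  have hsy : ∑ i, b.conj Y i i = 0 := by
    rw [BigCell.conj, trace_conj b.V_mul_U, hY, map_zero]
  have hω := traceD_bracket (kappaDerivation (V := W) κ h.kappa) b.V_mul_U X Y
    (x := b.conj X) (y := b.conj Y) rfl rfl
  have hK := trace_bracket b.V_mul_U X Y (x := b.conj X) (y := b.conj Y) rfl rfl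
  have hd : ∀ i, b.P X (-b.conj Y i i) - b.P Y (-b.conj X i i)
      = -b.conj (X * Y - Y * X) i i := by
    intro i
    have h1 := congrFun (congrFun (map_conj b.U_mul_V b.V_mul_U hPX Y) i) i
    have h2 := congrFun (congrFun (map_conj b.U_mul_V b.V_mul_U hPY X) i) i
    rw [Matrix.map_apply] at h1 h2
    rw [b.conj_commutator, ← diag_bracket, map_neg, map_neg]
    unfold BigCell.conj
    rw [h1, h2]
    ring
  have hW : ∀ (X Y : Matrix I I ℂ) (i j : I), b.P X (-(constMat (MvPolynomial σ ℂ) Y * b.V) i j)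
      = (constMat (MvPolynomial σ ℂ) Y * b.V * upper (b.conj X)) i j := by
    intro X Y i j
    have h1 := congrFun (congrFun (map_derivation_mul (b.P X) (constMat (MvPolynomial σ ℂ) Y) b.V)
      i) j
    rw [map_derivation_const, map_inverse b.U_mul_V b.V_mul_U (b.map_P X), Matrix.map_apply] at h1
    rw [map_neg, h1, zero_mul, zero_add, mul_neg, Matrix.neg_apply, neg_neg, ← mul_assoc]
    rfl
  have hU : ∀ (X : Matrix I I ℂ) (i j : I), b.P X (b.U i j) = (upper (b.conj X) * b.U) i j :=
    fun X i j => congrFun (congrFun (b.map_P X) i) j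
  have hgK := sum_gram_smul (O := OpSeries N W) hB
    (LinearMap.toSpanSingleton (MvPolynomial σ ℂ) (OpSeries N W) (kappaDot κ k)).toAddMonoidHom
    hsx hsy
  have hgD := sum_gram_smul (O := OpSeries N W) hB
    (kappaDerivation (V := W) κ h.kappa).toLinearMap.toAddMonoidHom hsx hsy
  simp only [LinearMap.toAddMonoidHom_coe, LinearMap.toSpanSingleton_apply,
    Derivation.coeFn_coe] at hgK hgD
  rw [h.matrixCurrent_eq b (X * Y - Y * X)]
  unfold FreeFields.matrixCurrent
  rw [h.adShift_current]
  simp only [hd, hW, hU, b.P_commutator, Fintype.sum_prod_type]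
  have hK' := congrArg (· • kappaDot (V := W) κ k) hK
  simp only [trace_mul_eq_sum (constMat (MvPolynomial σ ℂ) _ * b.V), add_smul, Finset.sum_smul,
    algebraMap_smul] at hK'
  -- In this term the differentiated matrix is the one indexed by (i, j), so the double sum is
  -- transposed to match the others.
  have hswap : traceD (kappaDerivation (V := W) κ h.kappa) (upper (b.conj Y) * b.U)
      (constMat _ X * b.V) = ∑ i, ∑ j, (upper (b.conj Y) * b.U) j i •
        kappaDerivation κ h.kappa ((constMat (MvPolynomial σ ℂ) X * b.V) i j) := Finset.sum_comm
  rw [hswap] at hω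
  unfold traceD at hω ⊢
  simp only [Finset.sum_add_distrib, Finset.sum_sub_distrib, neg_smul, neg_mul, mul_neg, neg_neg,
    map_neg, smul_neg, smul_add, Finset.sum_neg_distrib, hgD, mul_smul, hgK] at hK' hω ⊢
  linear_combination (norm := abel) hω - hK'

end Realization

open MvPolynomial

/-- Pairs `0 < i < j ≤ n + 1`. -/
abbrev Pair (n : ℕ) : Type := {p : ℕ × ℕ // 0 < p.1 ∧ p.1 < p.2 ∧ p.2 ≤ n + 1}

/-! ### The fields a and a^* on the Fock space -/

section FockFields

variable {n N : ℕ} (S : SignDecomposition N)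

theorem lie_eq_comp {W : Type*} [AddCommGroup W] [Module ℂ W] (f g : Module.End ℂ W) :
    ⁅f, g⁆ = f ∘ₗ g - g ∘ₗ f :=
  LieRing.of_associative_ring_bracket f g

theorem lie_eq_zero_of_comp_eq {W : Type*} [AddCommGroup W] [Module ℂ W] {f g : Module.End ℂ W}
    (h : f ∘ₗ g = g ∘ₗ f) : ⁅f, g⁆ = 0 := by
  rw [lie_eq_comp, h, sub_self]

theorem derivation_commute_of_X {τ : Type*} {D D' : Derivation ℂ (MvPolynomial τ ℂ) (MvPolynomial τ ℂ)}
    (h : ∀ v, D (D' (X v)) = D' (D (X v))) (f : MvPolynomial τ ℂ) : D (D' f) = D' (D f) := by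
  have : ⁅D, D'⁆ = 0 := derivation_ext fun v => by
    rw [Derivation.commutator_apply, h, sub_self]
    rfl
  have h1 := congrArg (fun E => E f) this
  simp only [Derivation.commutator_apply] at h1
  exact sub_eq_zero.1 h1

theorem derivX_of_pair (α : Pair n) (m : Idx N) :
    derivX n α.1.1 α.1.2 m = (pderiv (R := ℂ) ((α, m) : XVar n N)).toLinearMap := by
  rw [derivX, dif_pos α.2]

theorem mulX_of_pair (α : Pair n) (m : Idx N) :
    mulX n α.1.1 α.1.2 m = LinearMap.mulLeft ℂ (X ((α, m) : XVar n N)) := by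
  rw [mulX, dif_pos α.2]

theorem aS_apply (i j : ℕ) (v : Fock n S) (k : Idx N) : aS n S i j v k = aStarMode n S i j k v :=
  rfl

theorem derivX_comm (α β : Pair n) (m k : Idx N) :
    derivX n α.1.1 α.1.2 m ∘ₗ derivX n β.1.1 β.1.2 k
      = derivX n β.1.1 β.1.2 k ∘ₗ derivX n α.1.1 α.1.2 m := by
  classical
  rw [derivX_of_pair, derivX_of_pair]
  refine LinearMap.ext fun f => derivation_commute_of_X (D := pderiv (R := ℂ) ((α, m) : XVar n N))
    (D' := pderiv (R := ℂ) ((β, k) : XVar n N)) (fun v => ?_) f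
  rw [pderiv_X, pderiv_X, Pi.single_apply, Pi.single_apply]
  split_ifs <;> simp

instance : CommutingFields (Pair n) N (Fock n S) where
  field α := aS n S α.1.1 α.1.2
  commute α β k l v := by
    rw [aS_apply, aS_apply, aS_apply, aS_apply, aStarMode, aStarMode]
    simp only [← LinearMap.comp_apply, ← LinearMap.rTensor_comp, derivX_comm]

/-- The fields `a_α`. -/
def aFields (α : Pair n) : OpSeries N (Fock n S) := aF n S α.1.1 α.1.2

theorem implements_aFields (α : Pair n) (m : Idx N) :
    Implements (aFields S α m) m (pderiv α) := by
  classical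
  refine implements_of_X fun β s => ?_
  have h1 : modes (V := Fock n S) (X β : MvPolynomial (Pair n) ℂ) s
      = LinearMap.rTensor (CY n S) (derivX n β.1.1 β.1.2 (-s)) := by
    refine LinearMap.ext fun v => ?_
    rw [modes_X]
    rfl
  have h2 : (-mulX n α.1.1 α.1.2 m) ∘ₗ derivX n β.1.1 β.1.2 (-s)
      - derivX n β.1.1 β.1.2 (-s) ∘ₗ (-mulX n α.1.1 α.1.2 m)
      = (if β = α ∧ -s = m then 1 else 0 : ℂ) • LinearMap.id := by
    rw [derivX_of_pair, mulX_of_pair]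
    refine LinearMap.ext fun f => ?_
    simp only [LinearMap.sub_apply, LinearMap.comp_apply, LinearMap.neg_apply,
      LinearMap.mulLeft_apply, map_neg, Derivation.coeFn_coe, Derivation.leibniz, smul_eq_mul,
      pderiv_X, Pi.single_apply, LinearMap.smul_apply, LinearMap.id_apply, Prod.mk.injEq]
    simp only [eq_comm (a := m), eq_comm (a := α)]
    split_ifs <;> simp
  rw [h1, lie_eq_comp]
  change LinearMap.rTensor _ _ ∘ₗ LinearMap.rTensor _ _
    - LinearMap.rTensor _ _ ∘ₗ LinearMap.rTensor _ _ = _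
  rw [← LinearMap.rTensor_comp, ← LinearMap.rTensor_comp, ← LinearMap.rTensor_sub, h2,
    LinearMap.rTensor_smul, LinearMap.rTensor_id, pderiv_X, Pi.single_apply]
  have h3 : (if β = α then 1 else 0 : MvPolynomial (Pair n) ℂ) = C (if β = α then 1 else 0) := by
    split_ifs <;> simp
  rw [h3, modes_C]
  have h4 : s + m = 0 ↔ -s = m := by
    rw [neg_eq_iff_add_eq_zero]
  simp only [h4]
  by_cases h5 : β = α <;> by_cases h6 : -s = m <;> simp [h5, h6]

theorem aFields_comm (α β : Pair n) (m k : Idx N) :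
    aFields S α m ∘ₗ aFields S β k = aFields S β k ∘ₗ aFields S α m := by
  change LinearMap.rTensor _ _ ∘ₗ LinearMap.rTensor _ _ = LinearMap.rTensor _ _ ∘ₗ LinearMap.rTensor _ _
  rw [← LinearMap.rTensor_comp, ← LinearMap.rTensor_comp, mulX_of_pair, mulX_of_pair]
  congr 1
  refine LinearMap.ext fun f => ?_
  simp [mul_left_comm]

end FockFields

/-! ### The Heisenberg fields on ℂ[y] -/

section Heisenberg

variable {n N : ℕ} {S : SignDecomposition N}

/-- If m and -m were both negative, so would be their sum 0. This replaces negativity by positivity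
of -m, the form in which θ appears. -/
theorem SignDecomposition.trichotomy (S : SignDecomposition N) (m : Idx N) :
    m = 0 ∨ m ∈ S.pos ∨ -m ∈ S.pos := by
  have h : ∀ m, m ∈ S.neg ∨ m = 0 ∨ m ∈ S.pos := by
    intro m
    have := Set.mem_univ m
    rw [← S.union_eq] at this
    rcases this with (h | h) | h
    · exact Or.inl h
    · exact Or.inr (Or.inl h)
    · exact Or.inr (Or.inr h)
  rcases h m with h1 | h1 | h1
  · rcases h (-m) with h2 | h2 | h2
    · have := S.add_mem_neg h1 h2
      rw [add_neg_cancel] at this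
      exact absurd this S.zero_notMem_neg
    · exact Or.inl (neg_eq_zero.1 h2)
    · exact Or.inr (Or.inr h2)
  · exact Or.inl h1
  · exact Or.inr (Or.inl h1)

theorem SignDecomposition.neg_notMem_pos (S : SignDecomposition N) {m : Idx N} (h : m ∈ S.pos) :
    -m ∉ S.pos := by
  intro h2
  have := S.add_mem_pos h h2
  rw [add_neg_cancel] at this
  exact S.zero_notMem_pos this

theorem theta_of_mem {m : Idx N} (h : m ∈ S.pos) : theta S m = 1 := by
  simp [theta, h]

theorem theta_of_notMem {m : Idx N} (h : m ∉ S.pos) : theta S m = 0 := by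
  simp [theta, h]

/-- `∑_p m_p κ_{-m+s,p}`. -/
def kappaCoeff (κ : Idx N → Fin (N + 1) → ℂ) (m s : Idx N) : ℂ := ∑ p, (m p : ℂ) * κ (-m + s) p

/-- Summation with scalar weights commutes with multiplication, so the Leibniz rule passes from each
∂/∂y_i(s) to the infinite sum. -/
theorem lsum_smul_mul (c : Idx N → ℂ) (p : CY n S) (w : Idx N →₀ CY n S) :
    Finsupp.lsum ℂ (fun s => c s • (LinearMap.id : Module.End ℂ (CY n S))) (p • w)
      = p * Finsupp.lsum ℂ (fun s => c s • (LinearMap.id : Module.End ℂ (CY n S))) w := by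
  induction w using Finsupp.induction_linear with
  | zero => simp
  | add a b ha hb => rw [smul_add, map_add, map_add, ha, hb, mul_add]
  | single s x =>
    rw [Finsupp.smul_single, Finsupp.lsum_single, Finsupp.lsum_single]
    simp

theorem derivY_X (i : ℕ) (s : Idx N) (v : YVar n S) :
    derivY S i s (X v) = if v.1 = (i, s) then 1 else 0 := by
  classical
  by_cases h : (1 ≤ i ∧ i ≤ n) ∧ s ∈ S.pos
  · rw [derivY, dif_pos h]
    simp only [Derivation.coeFn_coe, pderiv_X, Pi.single_apply]
    simp only [Subtype.ext_iff]
  · rw [derivY, dif_neg h, if_neg]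
    · rfl
    · intro hv
      exact h (by have := v.2; rwa [hv] at this)

theorem derivY_mul (i : ℕ) (s : Idx N) (p q : CY n S) :
    derivY S i s (p * q) = p * derivY S i s q + q * derivY S i s p := by
  classical
  by_cases h : (1 ≤ i ∧ i ≤ n) ∧ s ∈ S.pos
  · rw [derivY, dif_pos h]
    simp
  · rw [derivY, dif_neg h]
    simp

/-- The operator `kappaDerivY` as a derivation. -/
theorem kappaDerivY_eq (κ : Idx N → Fin (N + 1) → ℂ) (i : ℕ) (m : Idx N) :
    kappaDerivY (n := n) S κ i m = (mkDerivation ℂ fun v : YVar n S =>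
      (C (if v.1.1 = i then kappaCoeff κ m v.1.2 else 0) : CY n S)).toLinearMap := by
  have hleib : ∀ p q, kappaDerivY (n := n) S κ i m (p * q)
      = p • kappaDerivY S κ i m q + q • kappaDerivY S κ i m p := by
    intro p q
    simp only [kappaDerivY, SummableFamily.sumComp, LinearMap.comp_apply, smul_eq_mul]
    rw [← lsum_smul_mul, ← lsum_smul_mul, ← map_add]
    congr 1
    ext s : 1
    exact derivY_mul i s p q
  have : Derivation.mk' (kappaDerivY (n := n) S κ i m) hleib = mkDerivation ℂ fun v : YVar n S =>
      (C (if v.1.1 = i then kappaCoeff κ m v.1.2 else 0) : CY n S) := by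
    refine derivation_ext fun v => ?_
    rw [mkDerivation_X]
    change kappaDerivY S κ i m (X v) = _
    have hf : SummableFamily.ofFinite (derivY S i) (derivY_finite S i) (X v)
        = Finsupp.single v.1.2 (if v.1.1 = i then (1 : CY n S) else 0) := by
      ext s : 1
      refine (derivY_X i s v).trans ?_
      classical
      rw [Finsupp.single_apply]
      by_cases h1 : v.1.1 = i <;> by_cases h2 : v.1.2 = s <;> simp [h1, h2, Prod.ext_iff]
    rw [kappaDerivY, SummableFamily.sumComp, LinearMap.comp_apply, hf, Finsupp.lsum_single]
    by_cases h1 : v.1.1 = i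
    · simp [h1, kappaCoeff, smul_eq_C_mul]
    · simp [h1]
  rw [← this]
  rfl

/-- The coefficients of the derivation part of `Φ(b_i(m))`. -/
def heisCoeff (S : SignDecomposition N) (κ : Idx N → Fin (N + 1) → ℂ) (i : ℕ) (m : Idx N) (j : ℕ)
    (s : Idx N) : ℂ :=
  (theta S (-m) * ((if j = i - 1 then 1 else 0) - (if j = i then 1 else 0))
    + theta S m * ((if j = i - 1 then 1 else 0) - 2 * (if j = i then 1 else 0)
      + (if j = i + 1 then 1 else 0))) * kappaCoeff κ m s

/-- The multiplication part of `Φ(b_i(m))`. -/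
def heisMul (n : ℕ) (S : SignDecomposition N) (i : ℕ) (m : Idx N) : CY n S :=
  theta S (-m) • mulY S i (-m) 1

/-- The operator is a constant-coefficient derivation plus a multiplication plus a scalar, so a
commutator of two of them is a scalar read off from derivations applied to single variables. -/
theorem heis_eq (κ : Idx N → Fin (N + 1) → ℂ) (lam : ℕ → ℂ) (i : ℕ) (m : Idx N) :
    heis (n := n) S κ lam i m = (mkDerivation ℂ fun v : YVar n S =>
        (C (heisCoeff S κ i m v.1.1 v.1.2) : CY n S)).toLinearMap
      + LinearMap.mulLeft ℂ (heisMul n S i m) - (if m = 0 then lam i else 0) • LinearMap.id := by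
  have h1 : theta S (-m) • mulY (n := n) S i (-m) = LinearMap.mulLeft ℂ (heisMul n S i m) := by
    classical
    rw [heisMul, mulY]
    split_ifs
    · refine LinearMap.ext fun f => ?_
      simp
    · refine LinearMap.ext fun f => ?_
      simp
  rw [heis, h1]
  congr 2
  simp only [kappaDerivY_eq]
  have key : ∀ D : Derivation ℂ (CY n S) (CY n S), (D = mkDerivation ℂ fun v : YVar n S =>
        (C (heisCoeff S κ i m v.1.1 v.1.2) : CY n S)) → D.toLinearMap
      = (mkDerivation ℂ fun v : YVar n S =>
        (C (heisCoeff S κ i m v.1.1 v.1.2) : CY n S)).toLinearMap := fun D h => by rw [h]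
  refine key (theta S (-m) • (mkDerivation ℂ _ - mkDerivation ℂ _)
    + theta S m • (mkDerivation ℂ _ - (2 : ℂ) • mkDerivation ℂ _ + mkDerivation ℂ _)) ?_
  refine derivation_ext fun v => ?_
  simp only [Derivation.add_apply, Derivation.smul_apply, Derivation.sub_apply, mkDerivation_X,
    smul_eq_C_mul, ← C_mul, ← C_sub, ← C_add]
  congr 1
  rw [heisCoeff]
  split_ifs <;> ring

/-- Entries of the Cartan matrix of type `A`. -/
def cartanA (i j : ℕ) : ℂ := if i = j then 2 else if i + 1 = j ∨ j + 1 = i then -1 else 0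

theorem mkDerivation_C_heisMul (κ : Idx N → Fin (N + 1) → ℂ) (i j : ℕ) (hj : 1 ≤ j ∧ j ≤ n)
    (m k : Idx N) :
    (mkDerivation ℂ fun v : YVar n S => (C (heisCoeff S κ i m v.1.1 v.1.2) : CY n S))
      (heisMul n S j k) = C (theta S (-k) * heisCoeff S κ i m j (-k)) := by
  classical
  rw [heisMul, Derivation.map_smul]
  by_cases h : -k ∈ S.pos
  · rw [mulY, dif_pos ⟨hj, h⟩, LinearMap.mulLeft_apply, mul_one, mkDerivation_X, smul_eq_C_mul,
      ← C_mul]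
  · rw [theta_of_notMem h]
    simp

/-- For opposite signs only the operator of positive degree differentiates the variable of the
other, and it carries the full Cartan row. For two negative degrees each contributes one
off-diagonal and half of the diagonal entry. For two positive degrees both sides vanish by the
second hypothesis on κ. -/
theorem heis_lie {κ : Idx N → Fin (N + 1) → ℂ} (lam : ℕ → ℂ)
    (eqn1 : ∀ m : Idx N, ∑ p, (m p : ℂ) * κ m p = 0)
    (eqn2 : ∀ m k : Idx N, m ∈ S.pos → k ∈ S.pos → ∑ p, (m p : ℂ) * κ (-m - k) p = 0)
    {i j : ℕ} (hi : 1 ≤ i ∧ i ≤ n) (hj : 1 ≤ j ∧ j ≤ n) (m k : Idx N) :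
    heis (n := n) S κ lam i m ∘ₗ heis (n := n) S κ lam j k
        - heis (n := n) S κ lam j k ∘ₗ heis (n := n) S κ lam i m
      = (-cartanA i j * ∑ p, (m p : ℂ) * κ (-(m + k)) p) • LinearMap.id := by
  have h1 : heis (n := n) S κ lam i m ∘ₗ heis (n := n) S κ lam j k
        - heis (n := n) S κ lam j k ∘ₗ heis (n := n) S κ lam i m
      = (theta S (-k) * heisCoeff S κ i m j (-k) - theta S (-m) * heisCoeff S κ j k i (-m)) •
        LinearMap.id := by
    rw [heis_eq, heis_eq]
    refine LinearMap.ext fun f => ?_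
    have hc := derivation_commute_of_X
      (D := mkDerivation ℂ fun v : YVar n S => (C (heisCoeff S κ i m v.1.1 v.1.2) : CY n S))
      (D' := mkDerivation ℂ fun v : YVar n S => (C (heisCoeff S κ j k v.1.1 v.1.2) : CY n S))
      (fun v => by simp [mkDerivation_X]) f
    have e1 := mkDerivation_C_heisMul (S := S) κ i j hj m k
    have e2 := mkDerivation_C_heisMul (S := S) κ j i hi k m
    simp only [LinearMap.sub_apply, LinearMap.add_apply, LinearMap.comp_apply,
      Derivation.coeFn_coe, LinearMap.mulLeft_apply, LinearMap.smul_apply, LinearMap.id_apply,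
      map_add, map_sub, derivation_C, Derivation.leibniz, e1, e2, hc, smul_eq_C_mul, smul_eq_mul]
    ring
  rw [h1]
  congr 1
  have hM1 : kappaCoeff κ m (-k) = ∑ p, (m p : ℂ) * κ (-(m + k)) p := by
    rw [kappaCoeff, neg_add]
  -- Contracting κ_{-(m+k)} with m + k gives zero, so contraction with k is minus contraction with
  -- m.
  have hM2 : kappaCoeff κ k (-m) = -∑ p, (m p : ℂ) * κ (-(m + k)) p := by
    have := eqn1 (-(m + k))
    simp only [Pi.neg_apply, Pi.add_apply, Int.cast_neg, Int.cast_add, neg_mul, add_mul,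
      Finset.sum_neg_distrib, Finset.sum_add_distrib] at this
    rw [kappaCoeff, ← neg_add, add_comm k m]
    linear_combination -this
  -- Truncated subtraction is harmless because i, j ≥ 1; the boundary index 0 carries no variable.
  have hi1 : (j = i - 1) ↔ j + 1 = i := by omega
  have hj1 : (i = j - 1) ↔ i + 1 = j := by omega
  rw [heisCoeff, heisCoeff, hM1, hM2, cartanA]
  simp only [hi1, hj1, eq_comm (a := j) (b := i), eq_comm (a := j) (b := i + 1),
    eq_comm (a := i) (b := j + 1)]
  have hM0 : m = 0 ∨ k = 0 ∨ (m ∈ S.pos ∧ k ∈ S.pos) →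
      ∑ p, (m p : ℂ) * κ (-(m + k)) p = 0 := by
    rintro (h | h | ⟨h, h'⟩)
    · simp [h]
    · have := eqn1 (-m)
      simp only [Pi.neg_apply, Int.cast_neg, neg_mul, Finset.sum_neg_distrib, neg_eq_zero] at this
      rw [h, add_zero, this]
    · rw [neg_add']
      exact eqn2 m k h h'
  rcases S.trichotomy m with hm | hm | hm
  · rw [hM0 (Or.inl hm)]; ring
  · rcases S.trichotomy k with hk | hk | hk
    · rw [hM0 (Or.inr (Or.inl hk))]; ring
    · rw [hM0 (Or.inr (Or.inr ⟨hm, hk⟩))]; ring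
    · have hk' := S.neg_notMem_pos hk
      rw [neg_neg] at hk'
      rw [theta_of_mem hm, theta_of_mem hk, theta_of_notMem hk',
        theta_of_notMem (S.neg_notMem_pos hm)]
      split_ifs <;> first | omega | ring
  · have hm' := S.neg_notMem_pos hm
    rw [neg_neg] at hm'
    rcases S.trichotomy k with hk | hk | hk
    · rw [hM0 (Or.inr (Or.inl hk))]; ring
    · rw [theta_of_mem hm, theta_of_mem hk, theta_of_notMem hm',
        theta_of_notMem (S.neg_notMem_pos hk)]
      split_ifs <;> first | omega | ring
    · have hk' := S.neg_notMem_pos hk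
      rw [neg_neg] at hk'
      rw [theta_of_mem hm, theta_of_mem hk, theta_of_notMem hm', theta_of_notMem hk']
      split_ifs <;> first | omega | ring

end Heisenberg

/-! ### Partial sums of Heisenberg fields -/

section FreeFieldsFock

variable {n N : ℕ} {S : SignDecomposition N}

/-- Row and column indices `1, …, n + 1`. -/
abbrev Pos (n : ℕ) : Type := Finset.Icc 1 (n + 1)

/-- The fields `Ψ_b = ∑_{r ≥ b} Φ(b_r)`. -/
def psiField (n : ℕ) {N : ℕ} (S : SignDecomposition N) (κ : Idx N → Fin (N + 1) → ℂ) (lam : ℕ → ℂ)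
    (b : Pos n) : OpSeries N (Fock n S) :=
  ∑ r ∈ Finset.Icc (b : ℕ) n, PhiF n S κ lam r

theorem psiField_apply (κ : Idx N → Fin (N + 1) → ℂ) (lam : ℕ → ℂ) (b : Pos n) (m : Idx N) :
    psiField n S κ lam b m
      = LinearMap.lTensor (CX n N) (∑ r ∈ Finset.Icc (b : ℕ) n, heis (n := n) S κ lam r m) := by
  rw [psiField, Finset.sum_apply]
  refine Eq.trans (Finset.sum_congr rfl fun r hr => ?_)
    (map_sum (LinearMap.lTensorHom (R := ℂ) (CX n N)) _ _).symm
  have h1 : r ≠ 0 := by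
    have := (Finset.mem_Icc.1 b.2).1
    have := (Finset.mem_Icc.1 hr).1
    omega
  rw [PhiF, heisAll, if_neg h1]
  rfl

/-- Gram matrix of the fields `Ψ_b`. -/
def gram (n : ℕ) (b c : Pos n) : ℂ :=
  (if b = c then 1 else 0) + (1 - if (b : ℕ) = n + 1 then 1 else 0)
    + -(if (c : ℕ) = n + 1 then 1 else 0)

theorem sum_Icc_telescope (F : ℕ → ℂ) {c n : ℕ} (h : c ≤ n + 1) :
    ∑ s ∈ Finset.Icc c n, (F s - F (s + 1)) = F c - F (n + 1) := by
  have := Finset.sum_Ico_sub F h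
  rw [← neg_inj, ← Finset.sum_neg_distrib, neg_sub, ← this]
  refine Finset.sum_congr (by ext; simp) fun s _ => by ring

/-- The Cartan matrix is a mixed second difference of the Kronecker delta G. Telescoping in both
variables leaves the four corner terms at b, c and n + 1. -/
theorem sum_cartanA (b c : Pos n) :
    ∑ r ∈ Finset.Icc (b : ℕ) n, ∑ s ∈ Finset.Icc (c : ℕ) n, cartanA r s = gram n b c := by
  have hb := Finset.mem_Icc.1 b.2
  have hc := Finset.mem_Icc.1 c.2
  let G : ℕ → ℕ → ℂ := fun r s => if r = s then 1 else 0
  have h1 : ∀ r s, cartanA r s = (G r s - G (r + 1) s) - (G r (s + 1) - G (r + 1) (s + 1)) := by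
    intro r s
    simp only [cartanA, G]
    split_ifs <;> first | omega | norm_num
  have h2 : ∀ r, ∑ s ∈ Finset.Icc (c : ℕ) n, cartanA r s
      = (G r c - G r (n + 1)) - (G (r + 1) c - G (r + 1) (n + 1)) := by
    intro r
    simp only [h1]
    rw [sum_Icc_telescope (fun s => G r s - G (r + 1) s) hc.2]
    ring
  simp only [h2]
  rw [sum_Icc_telescope (fun r => G r c - G r (n + 1)) hb.2]
  simp only [G, gram, Subtype.ext_iff, eq_comm (a := n + 1) (b := (c : ℕ))]
  split_ifs <;> norm_num at *

theorem freeFields_fock {κ : Idx N → Fin (N + 1) → ℂ} (lam : ℕ → ℂ)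
    (eqn1 : ∀ m : Idx N, ∑ p, (m p : ℂ) * κ m p = 0)
    (eqn2 : ∀ m k : Idx N, m ∈ S.pos → k ∈ S.pos → ∑ p, (m p : ℂ) * κ (-m - k) p = 0) :
    FreeFields κ (Pos n) (aFields S) (psiField n S κ lam) (gram n) where
  kappa := eqn1
  implements_a := implements_aFields S
  a_a α β m k := lie_eq_zero_of_comp_eq (aFields_comm S α β m k)
  a_psi α b m k := by
    refine lie_eq_zero_of_comp_eq ?_
    rw [psiField_apply]
    exact (LinearMap.rTensor_comp_lTensor _ _ _).trans
      (LinearMap.lTensor_comp_rTensor _ _ _).symm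
  implements_psi b m := by
    refine implements_of_X fun β s => ?_
    rw [Derivation.coe_zero, Pi.zero_apply, modes_zero, Pi.zero_apply]
    have h1 : modes (V := Fock n S) (X β : MvPolynomial (Pair n) ℂ) s
        = LinearMap.rTensor (CY n S) (derivX n β.1.1 β.1.2 (-s)) := by
      refine LinearMap.ext fun v => ?_
      rw [modes_X]
      rfl
    refine lie_eq_zero_of_comp_eq ?_
    rw [psiField_apply, h1]
    exact (LinearMap.lTensor_comp_rTensor _ _ _).trans
      (LinearMap.rTensor_comp_lTensor _ _ _).symm
  psi_psi b c m k := by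
    rw [lie_eq_comp, psiField_apply, psiField_apply, kappaDot_apply, ← sum_cartanA]
    have hh : (∑ r ∈ Finset.Icc (b : ℕ) n, heis (n := n) S κ lam r m)
          ∘ₗ (∑ r ∈ Finset.Icc (c : ℕ) n, heis (n := n) S κ lam r k)
        - (∑ r ∈ Finset.Icc (c : ℕ) n, heis (n := n) S κ lam r k)
          ∘ₗ (∑ r ∈ Finset.Icc (b : ℕ) n, heis (n := n) S κ lam r m)
        = (-(∑ r ∈ Finset.Icc (b : ℕ) n, ∑ s ∈ Finset.Icc (c : ℕ) n, cartanA r s)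
          * ∑ p, (m p : ℂ) * κ (-(m + k)) p) • LinearMap.id := by
      have hb := (Finset.mem_Icc.1 b.2).1
      have hc := (Finset.mem_Icc.1 c.2).1
      change (∑ r ∈ Finset.Icc (b : ℕ) n, heis (n := n) S κ lam r m)
          * (∑ r ∈ Finset.Icc (c : ℕ) n, heis (n := n) S κ lam r k)
        - (∑ r ∈ Finset.Icc (c : ℕ) n, heis (n := n) S κ lam r k)
          * (∑ r ∈ Finset.Icc (b : ℕ) n, heis (n := n) S κ lam r m) = _
      rw [Finset.sum_mul_sum, Finset.sum_mul_sum, Finset.sum_comm (s := Finset.Icc (c : ℕ) n),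
        ← Finset.sum_sub_distrib, ← Finset.sum_neg_distrib, Finset.sum_mul, Finset.sum_smul]
      refine Finset.sum_congr rfl fun r hr => ?_
      rw [← Finset.sum_sub_distrib, ← Finset.sum_neg_distrib, Finset.sum_mul, Finset.sum_smul]
      refine Finset.sum_congr rfl fun s hs => ?_
      rw [Finset.mem_Icc] at hr hs
      exact heis_lie lam eqn1 eqn2 ⟨by omega, hr.2⟩ ⟨by omega, hs.2⟩ m k
    have e1 := LinearMap.lTensor_sub (M := CX n N)
      ((∑ r ∈ Finset.Icc (b : ℕ) n, heis (n := n) S κ lam r m)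
          ∘ₗ (∑ r ∈ Finset.Icc (c : ℕ) n, heis (n := n) S κ lam r k))
      ((∑ r ∈ Finset.Icc (c : ℕ) n, heis (n := n) S κ lam r k)
          ∘ₗ (∑ r ∈ Finset.Icc (b : ℕ) n, heis (n := n) S κ lam r m))
    rw [hh, LinearMap.lTensor_comp, LinearMap.lTensor_comp, LinearMap.lTensor_smul,
      LinearMap.lTensor_id] at e1
    rw [smul_smul]
    exact e1.symm

end FreeFieldsFock

/-! ### The generic unitriangular matrix and its inverse -/

section Cell

variable {n : ℕ}

instance : Fintype (Pair n) :=
  Fintype.subtype ((Finset.Icc 1 (n + 1) ×ˢ Finset.Icc 1 (n + 1)).filter fun p => p.1 < p.2) (by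
    rintro ⟨i, j⟩
    simp only [Finset.mem_filter, Finset.mem_product, Finset.mem_Icc]
    omega)

theorem sum_pair {O : Type*} [AddCommMonoid O] (F : ℕ → ℕ → O) :
    ∑ α : Pair n, F α.1.1 α.1.2
      = ∑ i ∈ Finset.Icc 1 (n + 1), ∑ j ∈ Finset.Icc (i + 1) (n + 1), F i j := by
  rw [Finset.sum_sigma']
  refine Finset.sum_bij (fun α _ => ⟨α.1.1, α.1.2⟩) ?_ ?_ ?_ ?_
  · intro α _
    have := α.2
    simp only [Finset.mem_sigma, Finset.mem_Icc]
    omega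
  · rintro ⟨⟨i, j⟩, hα⟩ _ ⟨⟨i', j'⟩, hβ⟩ _ h
    simpa using h
  · rintro ⟨i, j⟩ h
    simp only [Finset.mem_sigma, Finset.mem_Icc] at h
    exact ⟨⟨(i, j), by omega⟩, Finset.mem_univ _, rfl⟩
  · intros
    rfl

/-- The variable attached to `a^*_{ij}` (`0` unless `0 < i < j ≤ n + 1`). -/
def uVar (n i j : ℕ) : MvPolynomial (Pair n) ℂ :=
  if h : 0 < i ∧ i < j ∧ j ≤ n + 1 then X ⟨(i, j), h⟩ else 0

theorem uVar_of_le {i j : ℕ} (h : j ≤ i) : uVar n i j = 0 := by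
  rw [uVar, dif_neg]
  omega

theorem uVar_pair (α : Pair n) : uVar n α.1.1 α.1.2 = X α := by
  rw [uVar, dif_pos α.2]

/-- The entries of `1 - u`. -/
def uEnt (n i j : ℕ) : MvPolynomial (Pair n) ℂ := (if i = j then 1 else 0) - uVar n i j

theorem uEnt_self (i : ℕ) : uEnt n i i = 1 := by
  rw [uEnt, if_pos rfl, uVar_of_le le_rfl, sub_zero]

theorem uEnt_of_lt {i j : ℕ} (h : i < j) : uEnt n i j = -uVar n i j := by
  rw [uEnt, if_neg h.ne, zero_sub]

theorem uEnt_of_gt {i j : ℕ} (h : j < i) : uEnt n i j = 0 := by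
  rw [uEnt, if_neg h.ne', uVar_of_le h.le, sub_zero]

/-- The generic upper unitriangular matrix. -/
def uMat (n : ℕ) : Matrix (Pos n) (Pos n) (MvPolynomial (Pair n) ℂ) :=
  Matrix.of fun i j => uEnt n i j

theorem uMat_apply (i j : Pos n) : uMat n i j = uEnt n i j := rfl

theorem det_uMat (n : ℕ) : (uMat n).det = 1 := by
  rw [Matrix.det_of_isUpperTriangular]
  · simp [uMat_apply, uEnt_self]
  · intro i j h
    exact uEnt_of_gt h

theorem uMat_mul_inv (n : ℕ) : uMat n * (uMat n)⁻¹ = 1 :=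
  Matrix.mul_nonsing_inv _ (by rw [det_uMat]; exact isUnit_one)

theorem inv_mul_uMat (n : ℕ) : (uMat n)⁻¹ * uMat n = 1 :=
  Matrix.nonsing_inv_mul _ (by rw [det_uMat]; exact isUnit_one)

/-- The row index of a pair. -/
def pairRow (α : Pair n) : Pos n := ⟨α.1.1, by have := α.2; simp only [Finset.mem_Icc]; omega⟩

/-- The column index of a pair. -/
def pairCol (α : Pair n) : Pos n := ⟨α.1.2, by have := α.2; simp only [Finset.mem_Icc]; omega⟩

/-- The infinitesimal action of a matrix on the big cell. -/
def cellAction (n : ℕ) (M : Matrix (Pos n) (Pos n) ℂ) :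
    Derivation ℂ (MvPolynomial (Pair n) ℂ) (MvPolynomial (Pair n) ℂ) :=
  mkDerivation ℂ fun α =>
    -(upper (uMat n * constMat (MvPolynomial (Pair n) ℂ) M * (uMat n)⁻¹) * uMat n) (pairRow α) (pairCol α)

/-- The big cell of upper unitriangular matrices. -/
def cell (n : ℕ) : BigCell (Pos n) (Pair n) where
  U := uMat n
  V := (uMat n)⁻¹
  U_mul_V := uMat_mul_inv n
  V_mul_U := inv_mul_uMat n
  row := pairRow
  col := pairCol
  X_eq α := by
    rw [uMat_apply, uEnt_of_lt (show (pairRow α : ℕ) < pairCol α from α.2.2.1), neg_neg]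
    exact (uVar_pair α).symm
  P := cellAction n
  map_P M := by
    ext1 i j
    rw [Matrix.map_apply, uMat_apply]
    have h0 : j ≤ i → (upper (uMat n * constMat (MvPolynomial (Pair n) ℂ) M * (uMat n)⁻¹) * uMat n) i j = 0 := by
      intro h
      rw [Matrix.mul_apply]
      refine Finset.sum_eq_zero fun s _ => ?_
      rw [upper_apply]
      split_ifs with hs
      · rw [uMat_apply, uEnt_of_gt (lt_of_le_of_lt (show (j : ℕ) ≤ i from h) hs), mul_zero]
      · rw [zero_mul]
    rcases lt_trichotomy i j with h | h | h
    · have hi := Finset.mem_Icc.1 i.2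
      have hj := Finset.mem_Icc.1 j.2
      have hij : (i : ℕ) < j := h
      rw [uEnt_of_lt hij, uVar, dif_pos ⟨by omega, hij, hj.2⟩, map_neg, cellAction, mkDerivation_X,
        neg_neg]
      rfl
    · subst h
      rw [h0 le_rfl, uEnt_self, Derivation.map_one_eq_zero]
    · rw [h0 h.le, uEnt_of_gt h, map_zero]

/-- The entries of the inverse of the generic unitriangular matrix, indexed by naturals. -/
def vEnt (n i j : ℕ) : MvPolynomial (Pair n) ℂ :=
  if h : i ∈ Finset.Icc 1 (n + 1) ∧ j ∈ Finset.Icc 1 (n + 1) then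
    (uMat n)⁻¹ ⟨i, h.1⟩ ⟨j, h.2⟩ else 0

theorem inv_uMat_apply (i j : Pos n) : (uMat n)⁻¹ i j = vEnt n i j := by
  rw [vEnt, dif_pos ⟨i.2, j.2⟩]

theorem sum_vEnt_mul_uEnt {i j : ℕ} (hi : i ∈ Finset.Icc 1 (n + 1)) (hj : j ∈ Finset.Icc 1 (n + 1)) :
    ∑ s ∈ Finset.Icc 1 (n + 1), vEnt n i s * uEnt n s j = if i = j then 1 else 0 := by
  have h := congrFun (congrFun (inv_mul_uMat n) ⟨i, hi⟩) ⟨j, hj⟩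
  rw [Matrix.mul_apply, Matrix.one_apply] at h
  simp only [inv_uMat_apply, uMat_apply, Subtype.mk.injEq] at h
  rw [← h, Finset.sum_coe_sort (Finset.Icc 1 (n + 1)) (fun s => vEnt n i s * uEnt n s j)]

/-- This is V = 1 + V u, from V(1 - u) = 1. As u is strictly upper, it determines the entries of a
row from left to right. -/
theorem vEnt_rec {i j : ℕ} (hi : i ∈ Finset.Icc 1 (n + 1)) (hj : j ∈ Finset.Icc 1 (n + 1)) :
    vEnt n i j = (if i = j then 1 else 0) + ∑ s ∈ Finset.Icc 1 (j - 1), vEnt n i s * uVar n s j := by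
  have h := sum_vEnt_mul_uEnt hi hj
  simp only [uEnt, mul_sub, Finset.sum_sub_distrib, mul_ite, mul_one, mul_zero,
    Finset.sum_ite_eq', hj, if_true] at h
  have h2 : ∑ s ∈ Finset.Icc 1 (j - 1), vEnt n i s * uVar n s j
      = ∑ s ∈ Finset.Icc 1 (n + 1), vEnt n i s * uVar n s j := by
    rw [Finset.mem_Icc] at hj
    refine Finset.sum_subset (fun s hs => ?_) fun s hs hs' => ?_
    · rw [Finset.mem_Icc] at *; omega
    · rw [Finset.mem_Icc] at *
      rw [uVar_of_le (by omega), mul_zero]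
  rw [h2, ← h]
  ring

theorem vEnt_of_gt {i j : ℕ} (h : j < i) : vEnt n i j = 0 := by
  induction j using Nat.strong_induction_on with
  | _ j ih =>
    by_cases hij : i ∈ Finset.Icc 1 (n + 1) ∧ j ∈ Finset.Icc 1 (n + 1)
    · rw [vEnt_rec hij.1 hij.2, if_neg h.ne', zero_add]
      refine Finset.sum_eq_zero fun s hs => ?_
      rw [Finset.mem_Icc] at hs
      rw [ih s (by omega) (by omega), zero_mul]
    · rw [vEnt, dif_neg hij]

theorem vEnt_self {i : ℕ} (hi : i ∈ Finset.Icc 1 (n + 1)) : vEnt n i i = 1 := by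
  rw [vEnt_rec hi hi, if_pos rfl, add_eq_left]
  refine Finset.sum_eq_zero fun s hs => ?_
  rw [Finset.mem_Icc] at hs
  rw [vEnt_of_gt (by omega), zero_mul]

theorem vEnt_succ {i : ℕ} (hi : 1 ≤ i ∧ i ≤ n) : vEnt n i (i + 1) = uVar n i (i + 1) := by
  rw [vEnt_rec (by rw [Finset.mem_Icc]; omega) (by rw [Finset.mem_Icc]; omega), if_neg (by omega),
    zero_add, Nat.add_sub_cancel, Finset.sum_eq_single i]
  · rw [vEnt_self (by rw [Finset.mem_Icc]; omega), one_mul]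
  · intro s hs hsi
    rw [Finset.mem_Icc] at hs
    rw [vEnt_of_gt (by omega), zero_mul]
  · intro h
    rw [Finset.mem_Icc] at h
    omega

theorem conj_single (p q i j : Pos n) (c : ℂ) :
    (cell n).conj (Matrix.single p q c) i j = C c * (uEnt n i p * vEnt n q j) := by
  rw [BigCell.conj]
  change (uMat n * constMat (MvPolynomial (Pair n) ℂ) (Matrix.single p q c) * (uMat n)⁻¹) i j = _
  rw [Matrix.mul_assoc, Matrix.mul_apply, Finset.sum_eq_single p]
  · rw [Matrix.mul_apply, Finset.sum_eq_single q]
    · simp only [uMat_apply, inv_uMat_apply, Matrix.map_apply, Matrix.single_apply_same,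
        algebraMap_eq]
      ring
    · intro s _ hs
      simp [hs.symm]
    · simp
  · intro s _ hs
    rw [Matrix.mul_apply, Finset.sum_eq_zero, mul_zero]
    intro t _
    simp [hs.symm]
  · simp

/-- Taking the strictly upper part keeps the intermediate indices s > i. The sum over all s is
(U⁻¹U)_{qj}, so the complement s ≤ i can be subtracted; it is the shorter sum in the cases that
occur. -/
theorem upper_conj_single_mul (p q : Pos n) (c : ℂ) (i j : Pos n) :
    (upper ((cell n).conj (Matrix.single p q c)) * uMat n) i j
      = C c * (uEnt n i p * ((if (q : ℕ) = j then 1 else 0)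
        - ∑ s ∈ Finset.Icc 1 (i : ℕ), vEnt n q s * uEnt n s j)) := by
  have hi := Finset.mem_Icc.1 i.2
  rw [← sum_vEnt_mul_uEnt q.2 j.2, Matrix.mul_apply]
  have h1 : ∀ s : Pos n, upper ((cell n).conj (Matrix.single p q c)) i s * uMat n s j
      = C c * (uEnt n i p * (if (i : ℕ) < s then vEnt n q s * uEnt n s j else 0)) := by
    intro s
    rw [upper_apply, conj_single, uMat_apply]
    by_cases h : (i : ℕ) < s
    · rw [if_pos (show i < s from h), if_pos h]; ring
    · rw [if_neg (show ¬ i < s from h), if_neg h]; ring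
  simp only [h1]
  rw [← Finset.mul_sum, ← Finset.mul_sum, Finset.sum_coe_sort (Finset.Icc 1 (n + 1))
    (fun s => if (i : ℕ) < s then vEnt n q s * uEnt n s j else 0), ← Finset.sum_filter,
    ← Finset.sum_filter_add_sum_filter_not (Finset.Icc 1 (n + 1)) (fun s => (i : ℕ) < s)
      (fun s => vEnt n q s * uEnt n s j)]
  have h2 : (Finset.Icc 1 (n + 1)).filter (fun s => ¬ (i : ℕ) < s) = Finset.Icc 1 (i : ℕ) := by
    ext s
    simp only [Finset.mem_filter, Finset.mem_Icc]
    omega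
  rw [h2, add_sub_cancel_right]

end Cell

/-! ### Currents of matrix units -/

section MatrixUnits

variable {n N : ℕ} {W : Type*} [AddCommGroup W] [Module ℂ W] [CommutingFields (Pair n) N W]
  {κ : Idx N → Fin (N + 1) → ℂ} {B : Pos n → Pos n → ℂ} {A : ℕ → ℕ → OpSeries N W}
  {Φ : ℕ → OpSeries N W} {u : ℕ → ℕ → SummableFamily (Idx N) W}
  (h : FreeFields κ (Pos n) (fun α : Pair n => A α.1.1 α.1.2)
    (fun b : Pos n => ∑ r ∈ Finset.Icc (b : ℕ) n, Φ r) B)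

theorem uVar_smul
    (hu : ∀ α : Pair n, CommutingFields.field α = u α.1.1 α.1.2)
    (hu0 : ∀ i j, ¬ (0 < i ∧ i < j ∧ j ≤ n + 1) → u i j = 0)
    (i j : ℕ) (F : OpSeries N W) : uVar n i j • F = F.mul (u i j) := by
  by_cases hij : 0 < i ∧ i < j ∧ j ≤ n + 1
  · rw [uVar, dif_pos hij, X_smul, hu]
  · rw [uVar, dif_neg hij, zero_smul, hu0 i j hij]
    funext m
    simp [OpSeries.mul, SummableFamily.sumComp]

theorem kappaDerivation_uVar
    (hu : ∀ α : Pair n, CommutingFields.field α = u α.1.1 α.1.2)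
    (hu0 : ∀ i j, ¬ (0 < i ∧ i < j ∧ j ≤ n + 1) → u i j = 0)
    (i j : ℕ) :
    kappaDerivation κ h.kappa (uVar n i j) = kappaD κ (u i j) := by
  by_cases hij : 0 < i ∧ i < j ∧ j ≤ n + 1
  · rw [uVar, dif_pos hij, kappaDerivation_X, hu]
  · rw [uVar, dif_neg hij, map_zero, hu0 i j hij]
    funext m
    simp [kappaD, OpSeries.mul, SummableFamily.sumComp, SummableFamily.euler]

theorem matrixCurrent_cell (M : Matrix (Pos n) (Pos n) ℂ) :
    h.matrixCurrent (cell n) M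
      = -∑ α, (upper ((cell n).conj M) * uMat n) (pairRow α) (pairCol α) • A α.1.1 α.1.2
        - ∑ i, (cell n).conj M i i • ∑ r ∈ Finset.Icc (i : ℕ) n, Φ r
        - traceD (kappaDerivation κ h.kappa) (constMat _ M * (uMat n)⁻¹) (uMat n) := by
  rw [h.matrixCurrent_eq]
  congr 2
  rw [← Finset.sum_neg_distrib]
  refine Finset.sum_congr rfl fun α _ => ?_
  rw [← neg_smul]
  congr 1
  exact mkDerivation_X _ _ _

theorem matrixCurrent_sub (M M' : Matrix (Pos n) (Pos n) ℂ) :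
    h.matrixCurrent (cell n) (M - M')
      = h.matrixCurrent (cell n) M - h.matrixCurrent (cell n) M' := by
  have h1 : (cell n).conj (M - M') = (cell n).conj M - (cell n).conj M' := by
    rw [BigCell.conj, constMat_sub, mul_sub, sub_mul]
    rfl
  simp only [matrixCurrent_cell, h1, map_sub, sub_mul, constMat_sub, traceD_sub_left,
    Matrix.sub_apply, sub_smul, Finset.sum_sub_distrib]
  abel

/-- Summation by parts back from the Ψ_b to the Φ(b_r). -/
theorem sum_smul_psiField (d : ℕ → MvPolynomial (Pair n) ℂ) :
    ∑ i : Pos n, d i • ∑ r ∈ Finset.Icc (i : ℕ) n, Φ r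
      = ∑ r ∈ Finset.Icc 1 n, (∑ b ∈ Finset.Icc 1 r, d b) • Φ r := by
  simp only [Finset.smul_sum, Finset.sum_smul]
  rw [Finset.sum_coe_sort (Finset.Icc 1 (n + 1))
    (fun i => ∑ r ∈ Finset.Icc i n, d i • Φ r)]
  refine Finset.sum_comm' fun x y => ?_
  simp only [Finset.mem_Icc]
  omega

/-- The current of a matrix unit. -/
theorem matrixCurrent_single
    (hu : ∀ α : Pair n, CommutingFields.field α = u α.1.1 α.1.2)
    (hu0 : ∀ i j, ¬ (0 < i ∧ i < j ∧ j ≤ n + 1) → u i j = 0)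
    (p q : Pos n) (c : ℂ) :
    h.matrixCurrent (cell n) (Matrix.single p q c)
      = -(c • ∑ i ∈ Finset.Icc 1 (n + 1), ∑ j ∈ Finset.Icc (i + 1) (n + 1),
          (uEnt n i p * ((if (q : ℕ) = j then 1 else 0)
            - ∑ s ∈ Finset.Icc 1 i, vEnt n q s * uEnt n s j)) • A i j)
        - c • ∑ r ∈ Finset.Icc 1 n, (∑ b ∈ Finset.Icc 1 r, uEnt n b p * vEnt n q b) •
            Φ r
        + c • ∑ b ∈ Finset.Icc 1 (n + 1), vEnt n q b • kappaD κ (u b p) := by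
  have hc : ∀ (f : MvPolynomial (Pair n) ℂ) (F : OpSeries N W),
      (C c * f) • F = c • (f • F) := by
    intro f F
    rw [← smul_eq_C_mul, smul_assoc]
  rw [matrixCurrent_cell]
  simp only [upper_conj_single_mul, conj_single, hc, ← Finset.smul_sum]
  have e1 := sum_pair (n := n) (fun i j => (uEnt n i p * ((if (q : ℕ) = j then 1 else 0)
            - ∑ s ∈ Finset.Icc 1 i, vEnt n q s * uEnt n s j)) • A i j)
  have e2 := sum_smul_psiField (Φ := Φ) (fun b => uEnt n b p * vEnt n q b)
  have e3 : traceD (kappaDerivation κ h.kappa) (constMat _ (Matrix.single p q c) * (uMat n)⁻¹)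
      (uMat n) = -(c • ∑ b ∈ Finset.Icc 1 (n + 1), vEnt n q b • kappaD κ (u b p)) := by
    have hD : ∀ b : ℕ, kappaDerivation κ h.kappa (uEnt n b p) = -kappaD κ (u b p) := by
      intro b
      rw [uEnt, map_sub, kappaDerivation_uVar h hu hu0]
      split_ifs
      · rw [Derivation.map_one_eq_zero, zero_sub]
      · rw [map_zero, zero_sub]
    have hM : ∀ i j : Pos n, (constMat (MvPolynomial (Pair n) ℂ) (Matrix.single p q c)
        * (uMat n)⁻¹) i j = if i = p then C c * vEnt n q j else 0 := by
      intro i j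
      rw [Matrix.mul_apply, Finset.sum_eq_single q]
      · rw [inv_uMat_apply]
        by_cases hi : i = p
        · subst hi; simp [algebraMap_eq]
        · rw [if_neg hi]
          simp [Ne.symm hi]
      · intro s _ hs
        simp [hs.symm]
      · simp
    rw [traceD, Finset.sum_eq_single p]
    · simp only [hM, if_true, uMat_apply, hD, hc, smul_neg, Finset.sum_neg_distrib,
        ← Finset.smul_sum]
      rw [Finset.sum_coe_sort (Finset.Icc 1 (n + 1))
        (fun b => vEnt n q b • kappaD κ (u b p))]
    · intro i _ hi
      simp [hi]
    · simp
  rw [e3, ← e1, ← e2]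
  rw [sub_neg_eq_add]
  rfl

end MatrixUnits

/-! ### Upper, diagonal and subdiagonal matrix units -/

section Matching

variable {n N : ℕ} {W : Type*} [AddCommGroup W] [Module ℂ W] [CommutingFields (Pair n) N W]
  {κ : Idx N → Fin (N + 1) → ℂ} {B : Pos n → Pos n → ℂ} {A : ℕ → ℕ → OpSeries N W}
  {Φ : ℕ → OpSeries N W} {u : ℕ → ℕ → SummableFamily (Idx N) W}
  (h : FreeFields κ (Pos n) (fun α : Pair n => A α.1.1 α.1.2)
    (fun b : Pos n => ∑ r ∈ Finset.Icc (b : ℕ) n, Φ r) B)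

theorem OpSeries.mul_mul {V : Type*} [AddCommGroup V] [Module ℂ V] (F : OpSeries N V)
    (f g : SummableFamily (Idx N) V) : F.mul (f.mul g) = (F.mul f).mul g :=
  OpSeries.total_injective (by
    rw [total_mul, total_mul, total_mul, SummableFamily.extend_mul]
    rfl)

theorem kappaD_zero {V : Type*} [AddCommGroup V] [Module ℂ V] :
    kappaD κ (0 : SummableFamily (Idx N) V) = 0 := by
  funext m
  simp [kappaD, OpSeries.mul, SummableFamily.sumComp, SummableFamily.euler]

theorem sum_Icc_eq_add {O : Type*} [AddCommMonoid O] {a b : ℕ} (hab : a ≤ b) (f : ℕ → O) :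
    ∑ i ∈ Finset.Icc a b, f i = f a + ∑ i ∈ Finset.Icc (a + 1) b, f i := by
  rw [← Finset.add_sum_Ioc_eq_sum_Icc hab]
  congr 1
  exact Finset.sum_congr (by ext; rw [Finset.mem_Ioc, Finset.mem_Icc]; omega) fun _ _ => rfl

theorem sum_vEnt_eq_zero {q i : ℕ} (hi : i < q) (f : ℕ → MvPolynomial (Pair n) ℂ) :
    ∑ s ∈ Finset.Icc 1 i, vEnt n q s * f s = 0 := by
  refine Finset.sum_eq_zero fun s hs => ?_
  rw [Finset.mem_Icc] at hs
  rw [vEnt_of_gt (by omega), zero_mul]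

theorem sum_Icc_vEnt_self {q : ℕ} (hq : q ∈ Finset.Icc 1 (n + 1))
    (f : ℕ → MvPolynomial (Pair n) ℂ) :
    ∑ s ∈ Finset.Icc 1 q, vEnt n q s * f s = f q := by
  have h1 := Finset.mem_Icc.1 hq
  obtain ⟨p, rfl⟩ : ∃ p, q = p + 1 := ⟨q - 1, by omega⟩
  rw [Finset.sum_Icc_succ_top (by omega), sum_vEnt_eq_zero (by omega), zero_add, vEnt_self hq,
    one_mul]

/-- For p < q, the factor u_{ip} forces i ≤ p < q, where row q of U⁻¹ has no entries. Only a linear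
expression in the a_{iq} survives. -/
theorem matrixCurrent_single_of_lt
    (hu : ∀ α : Pair n, CommutingFields.field α = u α.1.1 α.1.2)
    (hu0 : ∀ i j, ¬ (0 < i ∧ i < j ∧ j ≤ n + 1) → u i j = 0)
    (p q : Pos n) (hpq : (p : ℕ) < q) (c : ℂ) :
    h.matrixCurrent (cell n) (Matrix.single p q c)
      = -(c • ∑ i ∈ Finset.Icc 1 (p : ℕ), uEnt n i p • A i q) := by
  have hp := Finset.mem_Icc.1 p.2
  have hq := Finset.mem_Icc.1 q.2
  rw [matrixCurrent_single h hu hu0]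
  have e1 : ∑ i ∈ Finset.Icc 1 (n + 1), ∑ j ∈ Finset.Icc (i + 1) (n + 1),
          (uEnt n i p * ((if (q : ℕ) = j then 1 else 0)
            - ∑ s ∈ Finset.Icc 1 i, vEnt n q s * uEnt n s j)) • A i j
      = ∑ i ∈ Finset.Icc 1 (p : ℕ), uEnt n i p • A i q := by
    symm
    rw [Finset.sum_subset (Finset.Icc_subset_Icc_right hp.2)]
    · refine Finset.sum_congr rfl fun i hi => ?_
      rw [Finset.mem_Icc] at hi
      by_cases hip : i ≤ p
      · rw [Finset.sum_eq_single (q : ℕ)]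
        · rw [sum_vEnt_eq_zero (by omega), if_pos rfl, sub_zero, mul_one]
        · intro j _ hj
          rw [sum_vEnt_eq_zero (by omega), if_neg hj.symm, sub_zero, mul_zero, zero_smul]
        · intro hq'
          rw [Finset.mem_Icc] at hq'
          omega
      · rw [uEnt_of_gt (by omega), zero_smul]
        simp
    · intro i hi hi'
      rw [Finset.mem_Icc] at hi hi'
      rw [uEnt_of_gt (by omega), zero_smul]
  have e2 : ∑ r ∈ Finset.Icc 1 n, (∑ b ∈ Finset.Icc 1 r, uEnt n b p * vEnt n q b) • Φ r = 0 := by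
    refine Finset.sum_eq_zero fun r _ => ?_
    rw [Finset.sum_eq_zero, zero_smul]
    intro b _
    rcases le_or_gt b p with hb | hb
    · rw [vEnt_of_gt (by omega), mul_zero]
    · rw [uEnt_of_gt hb, zero_mul]
  have e3 : ∑ b ∈ Finset.Icc 1 (n + 1), vEnt n q b • kappaD κ (u b p) = 0 := by
    refine Finset.sum_eq_zero fun b _ => ?_
    rcases le_or_gt b p with hb | hb
    · rw [vEnt_of_gt (by omega), zero_smul]
    · rw [hu0 b p (by omega), kappaD_zero, smul_zero]
  rw [e1, e2, e3, smul_zero, sub_zero, add_zero]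

theorem matrixCurrent_single_self
    (hu : ∀ α : Pair n, CommutingFields.field α = u α.1.1 α.1.2)
    (hu0 : ∀ i j, ¬ (0 < i ∧ i < j ∧ j ≤ n + 1) → u i j = 0)
    (p : Pos n) :
    h.matrixCurrent (cell n) (Matrix.single p p 1)
      = ∑ i ∈ Finset.Icc 1 ((p : ℕ) - 1), (A i p).mul (u i p)
        - ∑ j ∈ Finset.Icc ((p : ℕ) + 1) (n + 1), (A p j).mul (u p j)
        - ∑ r ∈ Finset.Icc (p : ℕ) n, Φ r := by
  have hp := Finset.mem_Icc.1 p.2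
  rw [matrixCurrent_single h hu hu0]
  simp only [one_smul]
  have e1 : ∑ i ∈ Finset.Icc 1 (n + 1), ∑ j ∈ Finset.Icc (i + 1) (n + 1),
          (uEnt n i p * ((if (p : ℕ) = j then 1 else 0)
            - ∑ s ∈ Finset.Icc 1 i, vEnt n p s * uEnt n s j)) • A i j
      = -∑ i ∈ Finset.Icc 1 ((p : ℕ) - 1), (A i p).mul (u i p)
        + ∑ j ∈ Finset.Icc ((p : ℕ) + 1) (n + 1), (A p j).mul (u p j) := by
    rw [← Finset.sum_subset (Finset.Icc_subset_Icc_right hp.2)]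
    · obtain ⟨p', hp'⟩ : ∃ p', (p : ℕ) = p' + 1 := ⟨(p : ℕ) - 1, by omega⟩
      rw [hp', Finset.sum_Icc_succ_top (by omega), Nat.add_sub_cancel, ← Finset.sum_neg_distrib]
      congr 1
      · refine Finset.sum_congr rfl fun i hi => ?_
        rw [Finset.mem_Icc] at hi
        rw [Finset.sum_eq_single (p' + 1)]
        · rw [sum_vEnt_eq_zero (by omega), if_pos rfl, sub_zero, mul_one, uEnt_of_lt (by omega),
            neg_smul, uVar_smul hu hu0]
        · intro j _ hj
          rw [sum_vEnt_eq_zero (by omega), if_neg hj.symm, sub_zero, mul_zero, zero_smul]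
        · intro hq'
          rw [Finset.mem_Icc] at hq'
          omega
      · refine Finset.sum_congr rfl fun j hj => ?_
        rw [Finset.mem_Icc] at hj
        rw [sum_Icc_vEnt_self (by rw [Finset.mem_Icc]; omega), uEnt_self, one_mul,
          if_neg (by omega), zero_sub, uEnt_of_lt (by omega), neg_neg, uVar_smul hu hu0]
    · intro i hi hi'
      rw [Finset.mem_Icc] at hi hi'
      refine Finset.sum_eq_zero fun j _ => ?_
      rw [uEnt_of_gt (by omega), zero_mul, zero_smul]
  have e2 : ∑ r ∈ Finset.Icc 1 n, (∑ b ∈ Finset.Icc 1 r, uEnt n b p * vEnt n p b) • Φ r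
      = ∑ r ∈ Finset.Icc (p : ℕ) n, Φ r := by
    simp only [mul_comm (uEnt n _ p)]
    rw [← Finset.sum_subset (Finset.Icc_subset_Icc_left hp.1)]
    · refine Finset.sum_congr rfl fun r hr => ?_
      rw [Finset.mem_Icc] at hr
      rw [← Finset.sum_subset (Finset.Icc_subset_Icc_right hr.1), sum_Icc_vEnt_self p.2, uEnt_self,
        one_smul]
      intro b hb hb'
      rw [Finset.mem_Icc] at hb hb'
      rw [uEnt_of_gt (by omega), mul_zero]
    · intro r hr hr'
      rw [Finset.mem_Icc] at hr hr'
      rw [sum_vEnt_eq_zero (by omega), zero_smul]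
  have e3 : ∑ b ∈ Finset.Icc 1 (n + 1), vEnt n p b • kappaD κ (u b p) = 0 := by
    refine Finset.sum_eq_zero fun b _ => ?_
    rcases lt_or_ge b (p : ℕ) with hb | hb
    · rw [vEnt_of_gt (by omega), zero_smul]
    · rw [hu0 b p (by omega), kappaD_zero, smul_zero]
  rw [e1, e2, e3]
  abel

theorem matrixCurrent_single_succ
    (hu : ∀ α : Pair n, CommutingFields.field α = u α.1.1 α.1.2)
    (hu0 : ∀ i j, ¬ (0 < i ∧ i < j ∧ j ≤ n + 1) → u i j = 0)
    {r : ℕ} (hr : 1 ≤ r ∧ r ≤ n) (p q : Pos n) (hp : (p : ℕ) = r + 1)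
    (hq : (q : ℕ) = r) :
    h.matrixCurrent (cell n) (Matrix.single p q 1)
      = (A r (r + 1)).mul ((u r (r + 1)).mul (u r (r + 1)))
  - ∑ j ∈ Finset.Icc (r + 2) (n + 1), (A (r + 1) j).mul (u r j)
  + ∑ j ∈ Finset.Icc 1 (r - 1), (A j r).mul (u j (r + 1))
  + ∑ j ∈ Finset.Icc (r + 2) (n + 1),
      ((A r j).mul (u r j) - (A (r + 1) j).mul (u (r + 1) j)).mul (u r (r + 1))
  + (Φ r).mul (u r (r + 1))
  + kappaD κ (u r (r + 1)) := by
  rw [matrixCurrent_single h hu hu0]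
  simp only [one_smul, hp, hq]
  have hr1 : r ∈ Finset.Icc 1 (n + 1) := by rw [Finset.mem_Icc]; omega
  have e1 : ∑ i ∈ Finset.Icc 1 (n + 1), ∑ j ∈ Finset.Icc (i + 1) (n + 1),
          (uEnt n i (r + 1) * ((if r = j then 1 else 0)
            - ∑ s ∈ Finset.Icc 1 i, vEnt n r s * uEnt n s j)) • A i j
      = -∑ j ∈ Finset.Icc 1 (r - 1), uVar n j (r + 1) • A j r
        - ∑ j ∈ Finset.Icc (r + 1) (n + 1), uVar n r (r + 1) • uVar n r j • A r j
        + ∑ j ∈ Finset.Icc (r + 2) (n + 1), (uVar n r j • A (r + 1) j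
          + uVar n r (r + 1) • uVar n (r + 1) j • A (r + 1) j) := by
    rw [← Finset.sum_subset (Finset.Icc_subset_Icc_right (show r + 1 ≤ n + 1 by omega))]
    · obtain ⟨p', hp'⟩ : ∃ p', r = p' + 1 := ⟨r - 1, by omega⟩
      rw [Finset.sum_Icc_succ_top (by omega)]
      congr 1
      · rw [show Finset.Icc 1 r = Finset.Icc 1 (p' + 1) by rw [hp'],
          Finset.sum_Icc_succ_top (by omega), sub_eq_add_neg, ← Finset.sum_neg_distrib,
          ← Finset.sum_neg_distrib, show r - 1 = p' by omega, ← hp']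
        congr 1
        · refine Finset.sum_congr rfl fun i hi => ?_
          rw [Finset.mem_Icc] at hi
          rw [Finset.sum_eq_single r]
          · rw [sum_vEnt_eq_zero (by omega), if_pos rfl, sub_zero, mul_one,
              uEnt_of_lt (by omega), neg_smul]
          · intro j _ hj
            rw [sum_vEnt_eq_zero (by omega), if_neg hj.symm, sub_zero, mul_zero, zero_smul]
          · intro hq'
            rw [Finset.mem_Icc] at hq'
            omega
        · refine Finset.sum_congr rfl fun j hj => ?_
          rw [Finset.mem_Icc] at hj
          rw [sum_Icc_vEnt_self hr1, if_neg (by omega), zero_sub, uEnt_of_lt (by omega),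
            uEnt_of_lt (by omega), neg_neg, smul_smul, neg_mul, neg_smul]
      · refine Finset.sum_congr rfl fun j hj => ?_
        rw [Finset.mem_Icc] at hj
        rw [Finset.sum_Icc_succ_top (by omega), sum_Icc_vEnt_self hr1, uEnt_self, one_mul,
          if_neg (by omega), zero_sub, uEnt_of_lt (by omega), uEnt_of_lt (by omega), vEnt_succ hr,
          smul_smul, ← add_smul]
        congr 1
        ring
    · intro i hi hi'
      rw [Finset.mem_Icc] at hi hi'
      refine Finset.sum_eq_zero fun j _ => ?_
      rw [uEnt_of_gt (by omega), zero_mul, zero_smul]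
  have e2 : ∑ t ∈ Finset.Icc 1 n, (∑ b ∈ Finset.Icc 1 t, uEnt n b (r + 1) * vEnt n r b) • Φ t
      = -(uVar n r (r + 1) • Φ r) := by
    rw [Finset.sum_eq_single r]
    · simp only [mul_comm (uEnt n _ (r + 1))]
      rw [sum_Icc_vEnt_self hr1, uEnt_of_lt (by omega), neg_smul]
    · intro t ht htr
      rw [Finset.mem_Icc] at ht
      simp only [mul_comm (uEnt n _ (r + 1))]
      rcases lt_or_gt_of_ne htr with htr | htr
      · rw [sum_vEnt_eq_zero htr, zero_smul]
      -- For t > r the terms b = r and b = r + 1 contribute -u_{r,r+1} and +u_{r,r+1} and cancel, so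
      -- only Φ_r remains.
      · rw [← Finset.sum_subset (Finset.Icc_subset_Icc_right (show r + 1 ≤ t by omega)),
          Finset.sum_Icc_succ_top (by omega), sum_Icc_vEnt_self hr1, vEnt_succ hr, uEnt_self,
          uEnt_of_lt (by omega), mul_one, neg_add_cancel, zero_smul]
        intro i hi hi'
        rw [Finset.mem_Icc] at hi hi'
        rw [uEnt_of_gt (by omega), mul_zero]
    · intro h'
      rw [Finset.mem_Icc] at h'
      omega
  have e3 : ∑ b ∈ Finset.Icc 1 (n + 1), vEnt n r b • kappaD κ (u b (r + 1))
      = kappaD κ (u r (r + 1)) := by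
    rw [Finset.sum_eq_single r]
    · rw [vEnt_self hr1, one_smul]
    · intro b _ hb
      rcases lt_or_gt_of_ne hb with hb | hb
      · rw [vEnt_of_gt hb, zero_smul]
      · rw [hu0 b _ (by omega), kappaD_zero, smul_zero]
    · intro h'
      exact absurd hr1 h'
  rw [e1, e2, e3, sum_Icc_eq_add (show r + 1 ≤ n + 1 by omega), OpSeries.mul_mul]
  simp only [← uVar_smul hu hu0, smul_sub, Finset.sum_add_distrib, Finset.sum_sub_distrib]
  abel

end Matching

/-! ### Path expansion of the first row of U⁻¹ -/

section Chains

theorem mem_chains {j : ℕ} {q : Finset ℕ} :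
    q ∈ chains j ↔ (∀ k ∈ q, 1 ≤ k ∧ k ≤ j) ∧ 1 ∈ q ∧ j ∈ q := by
  simp only [chains, Finset.mem_filter, Finset.mem_powerset, Finset.subset_iff, Finset.mem_Icc]

theorem sort_insert_of_forall_lt {q : Finset ℕ} {j : ℕ} (h : ∀ k ∈ q, k < j) :
    (insert j q).sort (· ≤ ·) = q.sort (· ≤ ·) ++ [j] := by
  have hj : j ∉ q := fun hj => lt_irrefl _ (h j hj)
  refine List.Perm.eq_of_pairwise' (r := (· ≤ ·)) (Finset.pairwise_sort _ _) ?_ ?_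
  · rw [List.pairwise_append]
    refine ⟨Finset.pairwise_sort _ _, List.pairwise_singleton _ _, fun a ha b hb => ?_⟩
    rw [List.mem_singleton.1 hb]
    exact (h a ((Finset.mem_sort _).1 ha)).le
  · refine (Finset.sort_perm_toList _ _).trans ((Finset.toList_insert hj).trans ?_)
    exact ((Finset.sort_perm_toList q _).symm.cons j).trans
      (List.perm_append_singleton j _).symm

/-- Chains ending at `j` whose other entries are at most `r` arise from chains ending at some
`t ≤ r` by appending `j`. -/
theorem sum_chains_filter {O : Type*} [AddCommMonoid O] {r j : ℕ} (hr : 1 ≤ r) (hj : r < j)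
    (f : Finset ℕ → O) :
    ∑ q ∈ (chains j).filter (fun q => ∀ k ∈ q, k ≠ j → k ≤ r), f q
      = ∑ t ∈ Finset.Icc 1 r, ∑ q ∈ chains t, f (insert j q) := by
  rw [Finset.sum_sigma']
  symm
  refine Finset.sum_bij (fun x _ => insert j x.2) ?_ ?_ ?_ ?_
  · rintro ⟨t, q⟩ h
    simp only [Finset.mem_sigma, Finset.mem_Icc, mem_chains] at h
    simp only [Finset.mem_filter, mem_chains, Finset.mem_insert]
    obtain ⟨h1, h2, h3, -⟩ := h
    refine ⟨⟨?_, Or.inr h3, Or.inl trivial⟩, ?_⟩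
    · rintro k (rfl | hk)
      · omega
      · have := h2 k hk
        omega
    · rintro k (rfl | hk) hkj
      · exact absurd rfl hkj
      · have := h2 k hk
        omega
  · rintro ⟨t, q⟩ h ⟨t', q'⟩ h' he
    simp only [Finset.mem_sigma, Finset.mem_Icc, mem_chains] at h h'
    have h1 : j ∉ q := fun hq => by have := h.2.1 j hq; omega
    have h1' : j ∉ q' := fun hq => by have := h'.2.1 j hq; omega
    have hq : q = q' := by
      rw [← Finset.erase_insert h1, ← Finset.erase_insert h1']
      exact congrArg (fun s => s.erase j) he
    subst hq
    have := h.2.1 t' h'.2.2.2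
    have := h'.2.1 t h.2.2.2
    obtain rfl : t = t' := by omega
    rfl
  · intro q hq
    simp only [Finset.mem_filter, mem_chains] at hq
    obtain ⟨⟨h1, h2, h3⟩, h4⟩ := hq
    have hne : 1 ∈ q.erase j := Finset.mem_erase.2 ⟨by omega, h2⟩
    -- The penultimate entry t is recovered as the largest element other than j; it exists since 1 <
    -- j.
    have hm := Finset.max'_mem (q.erase j) ⟨1, hne⟩
    have hm' := Finset.mem_erase.1 hm
    refine ⟨⟨(q.erase j).max' ⟨1, hne⟩, q.erase j⟩, ?_, Finset.insert_erase h3⟩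
    simp only [Finset.mem_sigma, Finset.mem_Icc, mem_chains]
    exact ⟨⟨(h1 _ hm'.2).1, h4 _ hm'.2 hm'.1⟩, fun k hk =>
      ⟨(h1 k (Finset.mem_of_mem_erase hk)).1, Finset.le_max' _ _ hk⟩, hne, hm⟩
  · intros
    rfl

/-- `∏_l u_{q_l q_{l+1}}` over consecutive entries of a list. -/
def chainPoly (n : ℕ) : List ℕ → MvPolynomial (Pair n) ℂ
  | a :: b :: l => uVar n a b * chainPoly n (b :: l)
  | _ => 1

variable {n : ℕ}

theorem chainPoly_append (l : List ℕ) (t j : ℕ) :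
    chainPoly n (l ++ [t, j]) = chainPoly n (l ++ [t]) * uVar n t j := by
  induction l with
  | nil => simp [chainPoly]
  | cons a l ih =>
    cases l with
    | nil => simp [chainPoly]
    | cons b l =>
      simp only [List.cons_append, chainPoly] at ih ⊢
      rw [ih, mul_assoc]

theorem chainPoly_sort_append {t : ℕ} {q : Finset ℕ} (hq : q ∈ chains t) (j : ℕ) :
    chainPoly n (q.sort (· ≤ ·) ++ [j]) = chainPoly n (q.sort (· ≤ ·)) * uVar n t j := by
  rw [mem_chains] at hq
  have hs : q.sort (· ≤ ·) = (q.erase t).sort (· ≤ ·) ++ [t] := by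
    conv_lhs => rw [← Finset.insert_erase hq.2.2]
    refine sort_insert_of_forall_lt fun k hk => ?_
    rw [Finset.mem_erase] at hk
    exact lt_of_le_of_ne (hq.1 k hk.2).2 hk.1
  rw [hs, List.append_assoc]
  exact chainPoly_append _ t j

theorem sort_insert_of_mem_chains {t j : ℕ} (htj : t < j) {q : Finset ℕ} (hq : q ∈ chains t) :
    (insert j q).sort (· ≤ ·) = q.sort (· ≤ ·) ++ [j] :=
  sort_insert_of_forall_lt fun k hk => ((mem_chains.1 hq).1 k hk).2.trans_lt htj

/-- Splitting a chain at its last step t → j gives the same recursion as V = 1 + V u. -/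
theorem sum_chains_chainPoly {j : ℕ} (hj : j ∈ Finset.Icc 1 (n + 1)) :
    ∑ q ∈ chains j, chainPoly n (q.sort (· ≤ ·)) = vEnt n 1 j := by
  induction j using Nat.strong_induction_on with
  | _ j ih =>
    have hj' := Finset.mem_Icc.1 hj
    rcases hj'.1.eq_or_lt with rfl | h1
    · rw [vEnt_self hj]
      have hc : chains 1 = {{1}} := by
        ext q
        rw [mem_chains, Finset.mem_singleton]
        refine ⟨fun h => ?_, ?_⟩
        · ext k
          rw [Finset.mem_singleton]
          exact ⟨fun hk => by have := h.1 k hk; omega, fun hk => hk ▸ h.2.1⟩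
        · rintro rfl
          simp
      rw [hc, Finset.sum_singleton, Finset.sort_singleton, chainPoly]
      simp
    · rw [vEnt_rec (by rw [Finset.mem_Icc]; omega) hj, if_neg h1.ne, zero_add]
      have hf : (chains j).filter (fun q => ∀ k ∈ q, k ≠ j → k ≤ j - 1) = chains j := by
        refine Finset.filter_true_of_mem fun q hq k hk hkj => ?_
        have := (mem_chains.1 hq).1 k hk
        omega
      rw [← hf, sum_chains_filter (by omega) (by omega)]
      refine Finset.sum_congr rfl fun t ht => ?_
      rw [Finset.mem_Icc] at ht
      rw [← ih t (by omega) (by rw [Finset.mem_Icc]; omega), Finset.sum_mul]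
      refine Finset.sum_congr rfl fun q hq => ?_
      rw [sort_insert_of_mem_chains (by omega) hq, chainPoly_sort_append hq]

theorem sum_chains_filter_chainPoly {r j : ℕ} (hr : 1 ≤ r) (hj : r < j) (hrn : r ≤ n) :
    ∑ q ∈ (chains j).filter (fun q => ∀ k ∈ q, k ≠ j → k ≤ r), chainPoly n (q.sort (· ≤ ·))
      = ∑ t ∈ Finset.Icc 1 r, vEnt n 1 t * uVar n t j := by
  rw [sum_chains_filter hr hj]
  refine Finset.sum_congr rfl fun t ht => ?_
  rw [Finset.mem_Icc] at ht
  rw [← sum_chains_chainPoly (by rw [Finset.mem_Icc]; omega), Finset.sum_mul]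
  refine Finset.sum_congr rfl fun q hq => ?_
  rw [sort_insert_of_mem_chains (by omega) hq, chainPoly_sort_append hq]

/-- `∏_l u_{q_l q_{l+1}}(z)` over consecutive entries of a list, for fields `u`. -/
def chainProdOf {N : ℕ} {W : Type*} [AddCommGroup W] [Module ℂ W]
    (u : ℕ → ℕ → SummableFamily (Idx N) W) : List ℕ → SummableFamily (Idx N) W
  | a :: b :: l => (u a b).mul (chainProdOf u (b :: l))
  | _ => SummableFamily.one

theorem OpSeries.mul_one {N : ℕ} {V : Type*} [AddCommGroup V] [Module ℂ V] (F : OpSeries N V) :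
    F.mul SummableFamily.one = F := by
  funext m
  ext v
  simp [OpSeries.mul, SummableFamily.sumComp, SummableFamily.one]

end Chains

/-! ### The corner matrix unit and F_0 -/

section Corner

variable {n N : ℕ} {W : Type*} [AddCommGroup W] [Module ℂ W] [CommutingFields (Pair n) N W]
  {κ : Idx N → Fin (N + 1) → ℂ} {B : Pos n → Pos n → ℂ} {A : ℕ → ℕ → OpSeries N W}
  {Φ : ℕ → OpSeries N W} {u : ℕ → ℕ → SummableFamily (Idx N) W}
  (h : FreeFields κ (Pos n) (fun α : Pair n => A α.1.1 α.1.2)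
    (fun b : Pos n => ∑ r ∈ Finset.Icc (b : ℕ) n, Φ r) B)

theorem mul_chainProdOf
    (hu : ∀ α : Pair n, CommutingFields.field α = u α.1.1 α.1.2)
    (hu0 : ∀ i j, ¬ (0 < i ∧ i < j ∧ j ≤ n + 1) → u i j = 0)
    (l : List ℕ) (F : OpSeries N W) :
    F.mul (chainProdOf u l) = chainPoly n l • F := by
  induction l generalizing F with
  | nil => rw [chainProdOf, chainPoly, one_smul, OpSeries.mul_one] <;> simp
  | cons a l ih =>
    cases l with
    | nil => rw [chainProdOf, chainPoly, one_smul, OpSeries.mul_one] <;> simp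
    | cons b l =>
      rw [chainProdOf, chainPoly, OpSeries.mul_mul, ih, ← uVar_smul hu hu0, smul_smul, mul_comm]

/-- For p = n + 1 and q = 1 no simplification by triangularity occurs, and row 1 of U⁻¹ enters in
full. A restriction q_{i-1} ≤ r produces the truncated sum over s ≤ r in the a-part, and q_i ≤ r the
partial sums multiplying Φ(b_r). -/
theorem matrixCurrent_single_corner
    (hu : ∀ α : Pair n, CommutingFields.field α = u α.1.1 α.1.2)
    (hu0 : ∀ i j, ¬ (0 < i ∧ i < j ∧ j ≤ n + 1) → u i j = 0)
    (p q : Pos n) (hp : (p : ℕ) = n + 1) (hq : (q : ℕ) = 1) :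
    h.matrixCurrent (cell n) (Matrix.single p q (-1))
      = ∑ r ∈ Finset.Icc 1 n, ∑ j ∈ Finset.Icc (r + 1) (n + 1),
          ∑ q ∈ (chains j).filter (fun q => ∀ k ∈ q, k ≠ j → k ≤ r),
            (-A r j).mul ((chainProdOf u (q.sort (· ≤ ·))).mul (u r (n + 1)))
        - ∑ r ∈ Finset.Icc 1 n, ∑ t ∈ Finset.Icc 1 r, ∑ q ∈ chains t,
            (Φ r).mul (chainProdOf u (q.sort (· ≤ ·) ++ [n + 1]))
        - ∑ r ∈ Finset.Icc 1 n, ∑ q ∈ chains r,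
            (kappaD κ (u r (n + 1))).mul (chainProdOf u (q.sort (· ≤ ·))) := by
  have e1 : ∑ r ∈ Finset.Icc 1 n, ∑ j ∈ Finset.Icc (r + 1) (n + 1),
          ∑ q ∈ (chains j).filter (fun q => ∀ k ∈ q, k ≠ j → k ≤ r),
            (-A r j).mul ((chainProdOf u (q.sort (· ≤ ·))).mul (u r (n + 1)))
      = ∑ i ∈ Finset.Icc 1 (n + 1), ∑ j ∈ Finset.Icc (i + 1) (n + 1),
          (uEnt n i (n + 1) * ((if 1 = j then 1 else 0)
            - ∑ s ∈ Finset.Icc 1 i, vEnt n 1 s * uEnt n s j)) • A i j := by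
    -- The row i = n + 1 has no entries to its right and contributes nothing.
    rw [Finset.sum_Icc_succ_top (by omega), Finset.Icc_eq_empty (by omega : ¬ n + 1 + 1 ≤ n + 1),
      Finset.sum_empty, add_zero]
    refine Finset.sum_congr rfl fun r hr => Finset.sum_congr rfl fun j hj => ?_
    rw [Finset.mem_Icc] at hr hj
    simp only [OpSeries.mul_mul, mul_chainProdOf hu hu0, ← uVar_smul hu hu0, smul_smul, smul_neg]
    rw [Finset.sum_neg_distrib, ← Finset.sum_smul, ← Finset.mul_sum,
      sum_chains_filter_chainPoly hr.1 (by omega) hr.2, uEnt_of_lt (by omega), if_neg (by omega),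
      zero_sub, ← neg_smul, neg_mul_neg, ← mul_neg, ← Finset.sum_neg_distrib]
    congr 2
    refine Finset.sum_congr rfl fun s hs => ?_
    rw [Finset.mem_Icc] at hs
    rw [uEnt_of_lt (by omega), mul_neg]
  have e2 : ∑ r ∈ Finset.Icc 1 n, ∑ t ∈ Finset.Icc 1 r, ∑ q ∈ chains t,
            (Φ r).mul (chainProdOf u (q.sort (· ≤ ·) ++ [n + 1]))
      = -∑ r ∈ Finset.Icc 1 n, (∑ b ∈ Finset.Icc 1 r, uEnt n b (n + 1) * vEnt n 1 b) • Φ r := by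
    rw [← Finset.sum_neg_distrib]
    refine Finset.sum_congr rfl fun r hr => ?_
    rw [Finset.mem_Icc] at hr
    rw [← neg_smul, ← Finset.sum_neg_distrib, Finset.sum_smul]
    refine Finset.sum_congr rfl fun t ht => ?_
    rw [Finset.mem_Icc] at ht
    simp only [mul_chainProdOf hu hu0]
    rw [← Finset.sum_smul, uEnt_of_lt (by omega), neg_mul, neg_neg, mul_comm,
      ← sum_chains_chainPoly (by rw [Finset.mem_Icc]; omega), Finset.sum_mul]
    congr 1
    exact Finset.sum_congr rfl fun q hq => chainPoly_sort_append hq _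
  have e3 : ∑ r ∈ Finset.Icc 1 n, ∑ q ∈ chains r,
            (kappaD κ (u r (n + 1))).mul (chainProdOf u (q.sort (· ≤ ·)))
      = ∑ b ∈ Finset.Icc 1 (n + 1), vEnt n 1 b • kappaD κ (u b (n + 1)) := by
    rw [Finset.sum_Icc_succ_top (by omega), hu0 (n + 1) (n + 1) (by omega), kappaD_zero,
      smul_zero, add_zero]
    refine Finset.sum_congr rfl fun r hr => ?_
    rw [Finset.mem_Icc] at hr
    simp only [mul_chainProdOf hu hu0]
    rw [← Finset.sum_smul, sum_chains_chainPoly (by rw [Finset.mem_Icc]; omega)]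
  rw [matrixCurrent_single h hu hu0, e1, e2, e3, hp, hq]
  simp only [neg_smul, one_smul]
  abel

end Corner

/-! ### Universal property of the presentation -/

section Presentation

variable {n N : ℕ} {L : Type*} [LieRing L] [LieAlgebra ℂ L]

/-- The universal property of the toroidal Lie algebra. -/
theorem existsUnique_hom (g : Gen n N → L)
    (hg : ∀ x, Relator n N x → FreeLieAlgebra.lift ℂ g x = 0) :
    ∃! ρ : ToroidalLieAlgebra n N →ₗ⁅ℂ⁆ L, ∀ x, ρ (ToroidalLieAlgebra.of x) = g x := by
  have hle : relatorIdeal n N ≤ (FreeLieAlgebra.lift ℂ g).ker :=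
    LieSubmodule.lieSpan_le.2 fun x hx => LieHom.mem_ker.2 (hg x hx)
  let ρ : ToroidalLieAlgebra n N →ₗ⁅ℂ⁆ L :=
    { (relatorIdeal n N).toSubmodule.liftQ
        ((FreeLieAlgebra.lift ℂ g : FreeLieAlgebra ℂ (Gen n N) →ₗ⁅ℂ⁆ L) :
          FreeLieAlgebra ℂ (Gen n N) →ₗ[ℂ] L)
        (fun x hx => LinearMap.mem_ker.2 (LieHom.mem_ker.1 (hle hx))) with
      map_lie' := by
        intro x y
        obtain ⟨x, rfl⟩ := LieSubmodule.Quotient.surjective_mk' (relatorIdeal n N) x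
        obtain ⟨y, rfl⟩ := LieSubmodule.Quotient.surjective_mk' (relatorIdeal n N) y
        exact (FreeLieAlgebra.lift ℂ g).map_lie x y }
  refine ⟨ρ, fun x => FreeLieAlgebra.lift_of_apply g x, fun ρ' hρ' => ?_⟩
  let π : FreeLieAlgebra ℂ (Gen n N) →ₗ⁅ℂ⁆ ToroidalLieAlgebra n N :=
    { (relatorIdeal n N).toSubmodule.mkQ with
      map_lie' := fun {x y} => LieSubmodule.Quotient.mk_bracket _ x y }
  have h1 : ρ'.comp π = FreeLieAlgebra.lift ℂ g :=
    FreeLieAlgebra.hom_ext fun x => (hρ' x).trans (FreeLieAlgebra.lift_of_apply g x).symm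
  refine LieHom.ext fun x => ?_
  obtain ⟨x, rfl⟩ := LieSubmodule.Quotient.surjective_mk' (relatorIdeal n N) x
  exact congrArg (fun f : FreeLieAlgebra ℂ (Gen n N) →ₗ⁅ℂ⁆ L => f x) h1

end Presentation

/-! ### Matrix units on the affine cycle -/

section ChevalleyGenerators

variable {n : ℕ}

/-- The nodes of the affine diagram as matrix indices; node `0` becomes `n + 1`. -/
def nodePos (r : Fin (n + 1)) : Pos n :=
  ⟨if r = 0 then n + 1 else r, by
    rw [Finset.mem_Icc]
    split_ifs with h
    · omega
    · have := Fin.pos_iff_ne_zero.2 h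
      have : 0 < (r : ℕ) := this
      omega⟩

theorem nodePos_zero : (nodePos (0 : Fin (n + 1)) : ℕ) = n + 1 := by
  simp [nodePos]

theorem nodePos_of_ne {r : Fin (n + 1)} (h : r ≠ 0) : (nodePos r : ℕ) = r := by
  rw [nodePos]
  exact if_neg h

theorem nodePos_succ (r : Fin (n + 1)) : (nodePos (r + 1) : ℕ) = r + 1 := by
  rcases eq_or_ne r (Fin.last n) with rfl | hr
  · rw [Fin.last_add_one, nodePos_zero, Fin.val_last]
  · have h1 : ((r + 1 : Fin (n + 1)) : ℕ) = r + 1 :=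
      Fin.val_add_one_of_lt (lt_of_le_of_ne (Fin.le_last r) hr)
    rw [nodePos_of_ne, h1]
    intro h0
    rw [h0] at h1
    simp at h1

theorem nodePos_injective : Function.Injective (nodePos (n := n)) := by
  intro r s h
  have h1 : (nodePos r : ℕ) = nodePos s := congrArg _ h
  have := r.2
  have := s.2
  by_cases hr : r = 0 <;> by_cases hs : s = 0
  · rw [hr, hs]
  · rw [hr, nodePos_zero, nodePos_of_ne hs] at h1
    omega
  · rw [hs, nodePos_zero, nodePos_of_ne hr] at h1
    omega
  · rw [nodePos_of_ne hr, nodePos_of_ne hs] at h1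
    exact Fin.ext h1

/-- Matrix units at the nodes of the affine diagram. -/
def nodeUnit (r s : Fin (n + 1)) : Matrix (Pos n) (Pos n) ℂ :=
  Matrix.single (nodePos r) (nodePos s) 1

theorem nodeUnit_mul (r s r' s' : Fin (n + 1)) :
    nodeUnit r s * nodeUnit r' s' = if s = r' then nodeUnit r s' else 0 := by
  split_ifs with h
  · subst h
    rw [nodeUnit, nodeUnit, Matrix.single_mul_single_same, one_mul]
    rfl
  · exact Matrix.single_mul_single_of_ne _ _ _ _ (fun h' => h (nodePos_injective h')) _

theorem trace_nodeUnit (r s : Fin (n + 1)) :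
    (nodeUnit r s).trace = if r = s then 1 else 0 := by
  split_ifs with h
  · subst h
    exact Matrix.trace_single_eq_same _ _
  · exact Matrix.trace_single_eq_of_ne _ _ _ (fun h' => h (nodePos_injective h'))

/-- The matrix of `E_r`. -/
def eMat (r : Fin (n + 1)) : Matrix (Pos n) (Pos n) ℂ := nodeUnit (r + 1) r

/-- The matrix of `F_r`. -/
def fMat (r : Fin (n + 1)) : Matrix (Pos n) (Pos n) ℂ := -nodeUnit r (r + 1)

/-- The matrix of `H_r`. -/
def hMat (r : Fin (n + 1)) : Matrix (Pos n) (Pos n) ℂ := nodeUnit (r + 1) (r + 1) - nodeUnit r r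

theorem add_one_ne_self (hn : 2 ≤ n) (r : Fin (n + 1)) : r + 1 ≠ r := by
  intro h
  rw [add_eq_left] at h
  have h1 := congrArg Fin.val h
  rw [Fin.val_one', Nat.mod_eq_of_lt (by omega : 1 < n + 1), Fin.val_zero] at h1
  omega

theorem add_one_add_one_ne_self (hn : 2 ≤ n) (r : Fin (n + 1)) : r + 1 + 1 ≠ r := by
  intro h
  rw [add_assoc, add_eq_left] at h
  have h1 := congrArg Fin.val h
  rw [Fin.val_add, Fin.val_one', Nat.mod_eq_of_lt (by omega : 1 < n + 1), Fin.val_zero,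
    Nat.mod_eq_of_lt (by omega)] at h1
  omega

/-- Since the cycle has at least three nodes, equality and the two directed adjacencies are mutually
exclusive, so the case distinction becomes a sum of deltas. These are the deltas that arise from
multiplying matrix units. -/
theorem affineCartan_eq (hn : 2 ≤ n) (i j : Fin (n + 1)) :
    (affineCartan n i j : ℂ) = (if i = j then 1 else 0) + (if i = j then 1 else 0)
      - (if i + 1 = j then 1 else 0) - (if i = j + 1 then 1 else 0) := by
  have h1 := add_one_ne_self hn
  have h2 := add_one_add_one_ne_self hn
  rw [affineCartan]
  rcases eq_or_ne i j with rfl | hij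
  · rw [if_pos rfl, if_pos rfl, if_neg (h1 i), if_neg (h1 i).symm]
    norm_num
  · rw [if_neg hij, if_neg hij]
    by_cases h3 : i + 1 = j
    · subst h3
      rw [if_pos (Or.inl rfl), if_pos rfl, if_neg (h2 i).symm]
      norm_num
    · by_cases h4 : i = j + 1
      · subst h4
        rw [if_pos (Or.inr rfl), if_pos rfl, if_neg h3]
        norm_num
      · rw [if_neg (by rintro (h | h); exacts [h3 h, h4 h.symm]), if_neg h3, if_neg h4]
        norm_num

theorem trace_hMat (i : Fin (n + 1)) : (hMat i).trace = 0 := by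
  rw [hMat, Matrix.trace_sub, trace_nodeUnit, trace_nodeUnit, if_pos rfl, if_pos rfl, sub_self]

theorem trace_eMat (hn : 2 ≤ n) (i : Fin (n + 1)) : (eMat i).trace = 0 := by
  rw [eMat, trace_nodeUnit, if_neg (add_one_ne_self hn i)]

theorem trace_fMat (hn : 2 ≤ n) (i : Fin (n + 1)) : (fMat i).trace = 0 := by
  rw [fMat, Matrix.trace_neg, trace_nodeUnit, if_neg (add_one_ne_self hn i).symm, neg_zero]

theorem hMat_commutator_hMat (i j : Fin (n + 1)) : hMat i * hMat j - hMat j * hMat i = 0 := by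
  simp only [hMat, sub_mul, mul_sub, nodeUnit_mul]
  have h : ∀ a b : Fin (n + 1), (if a = b then nodeUnit a b else 0)
      = if b = a then nodeUnit b a else 0 := by
    intro a b
    by_cases h : a = b
    · subst h; rfl
    · rw [if_neg h, if_neg (Ne.symm h)]
  rw [h (j + 1) (i + 1), h (j + 1) i, h j (i + 1), h j i]
  abel

theorem trace_hMat_mul_hMat (hn : 2 ≤ n) (i j : Fin (n + 1)) :
    (hMat i * hMat j).trace = affineCartan n i j := by
  have h : ∀ a b : Fin (n + 1), (if a = b then nodeUnit a b else 0).trace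
      = if a = b then (1 : ℂ) else 0 := by
    intro a b
    by_cases h : a = b
    · rw [if_pos h, if_pos h, trace_nodeUnit, if_pos h]
    · rw [if_neg h, if_neg h, Matrix.trace_zero]
  simp only [hMat, sub_mul, mul_sub, nodeUnit_mul, Matrix.trace_sub, h]
  simp only [add_left_inj]
  rw [affineCartan_eq hn]
  ring

theorem hMat_commutator_nodeUnit (i r s : Fin (n + 1)) :
    hMat i * nodeUnit r s - nodeUnit r s * hMat i
      = (((if i + 1 = r then 1 else 0) - (if i = r then 1 else 0)
        - (if i + 1 = s then 1 else 0) + (if i = s then 1 else 0) : ℂ)) • nodeUnit r s := by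
  have h1 : ∀ a : Fin (n + 1), nodeUnit a a * nodeUnit r s
      = (if a = r then (1 : ℂ) else 0) • nodeUnit r s := by
    intro a
    rw [nodeUnit_mul]
    split_ifs with h
    · rw [h, one_smul]
    · rw [zero_smul]
  have h2 : ∀ a : Fin (n + 1), nodeUnit r s * nodeUnit a a
      = (if a = s then (1 : ℂ) else 0) • nodeUnit r s := by
    intro a
    rw [nodeUnit_mul]
    by_cases h : a = s
    · rw [if_pos h.symm, if_pos h, h, one_smul]
    · rw [if_neg (Ne.symm h), if_neg h, zero_smul]
  rw [hMat, sub_mul, mul_sub, h1, h1, h2, h2]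
  module

theorem hMat_commutator_eMat (hn : 2 ≤ n) (i j : Fin (n + 1)) :
    hMat i * eMat j - eMat j * hMat i = (affineCartan n i j : ℂ) • eMat j := by
  rw [eMat, hMat_commutator_nodeUnit, affineCartan_eq hn]
  simp only [add_left_inj]
  congr 1
  ring

theorem hMat_commutator_fMat (hn : 2 ≤ n) (i j : Fin (n + 1)) :
    hMat i * fMat j - fMat j * hMat i = -((affineCartan n i j : ℂ) • fMat j) := by
  rw [fMat, mul_neg, neg_mul, ← neg_sub', hMat_commutator_nodeUnit, affineCartan_eq hn, smul_neg]
  simp only [add_left_inj]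
  rw [← neg_smul, ← neg_smul, ← neg_smul]
  congr 1
  ring

theorem trace_hMat_mul_nodeUnit (i : Fin (n + 1)) {r s : Fin (n + 1)} (h : r ≠ s) :
    (hMat i * nodeUnit r s).trace = 0 := by
  have h1 : ∀ a : Fin (n + 1), (nodeUnit a a * nodeUnit r s).trace = 0 := by
    intro a
    rw [nodeUnit_mul]
    split_ifs with h'
    · rw [h', trace_nodeUnit, if_neg h]
    · exact Matrix.trace_zero _ _
  rw [hMat, sub_mul, Matrix.trace_sub, h1, h1, sub_zero]

theorem eMat_mul_fMat (i j : Fin (n + 1)) :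
    eMat i * fMat j = if i = j then -nodeUnit (i + 1) (i + 1) else 0 := by
  rw [eMat, fMat, mul_neg, nodeUnit_mul]
  split_ifs with h
  · rw [h]
  · exact neg_zero

theorem fMat_mul_eMat (i j : Fin (n + 1)) :
    fMat i * eMat j = if i = j then -nodeUnit i i else 0 := by
  rw [eMat, fMat, neg_mul, nodeUnit_mul]
  simp only [add_left_inj]
  split_ifs with h
  · rw [h]
  · exact neg_zero

theorem nodeUnit_mul_mul_self {r s r' s' : Fin (n + 1)} (h : s ≠ r' ∨ s' ≠ r) :
    nodeUnit r s * nodeUnit r' s' * nodeUnit r s = 0 := by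
  rw [nodeUnit_mul]
  split_ifs with h1
  · rw [nodeUnit_mul, if_neg (h.resolve_left (not_not.2 h1))]
  · exact zero_mul _

theorem trace_nodeUnit_mul {r s r' s' : Fin (n + 1)} (h : s ≠ r' ∨ s' ≠ r) :
    (nodeUnit r s * nodeUnit r' s').trace = 0 := by
  rw [nodeUnit_mul]
  split_ifs with h1
  · rw [trace_nodeUnit, if_neg (h.resolve_left (not_not.2 h1)).symm]
  · exact Matrix.trace_zero _ _

end ChevalleyGenerators

/-! ### Toroidal relations in an affinization -/

section Relations

open LieAlgebra

variable {n N : ℕ} {L : Type*} [LieRing L] [LieAlgebra ℂ L]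

/-- `C` is an affinization of the traceless matrices, with cocycle `κ` and central element `z`. -/
structure IsAffinization (κ : Idx N → Fin (N + 1) → ℂ)
    (C : Matrix (Pos n) (Pos n) ℂ →+ (Idx N → L)) (z : L) : Prop where
  kappa : ∀ m : Idx N, ∑ p, (m p : ℂ) * κ m p = 0
  central : ∀ x : L, ⁅z, x⁆ = 0
  lie : ∀ X Y : Matrix (Pos n) (Pos n) ℂ, X.trace = 0 → Y.trace = 0 → ∀ m k : Idx N,
    ⁅C X m, C Y k⁆ = C (X * Y - Y * X) (m + k)
      - ((X * Y).trace * ∑ p, (m p : ℂ) * κ (-(m + k)) p) • z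

/-- The images of the generators of the toroidal Lie algebra. -/
def genImage (κ : Idx N → Fin (N + 1) → ℂ) (C : Matrix (Pos n) (Pos n) ℂ →+ (Idx N → L)) (z : L) :
    Gen n N → L
  | .K m l => (-κ (-m) l) • z
  | .H i m => C (hMat i) m
  | .E i m => C (eMat i) m
  | .F i m => C (fMat i) m

variable {κ : Idx N → Fin (N + 1) → ℂ} {C : Matrix (Pos n) (Pos n) ℂ →+ (Idx N → L)} {z : L}

theorem map_intCast_smul (c : ℤ) (X : Matrix (Pos n) (Pos n) ℂ) (m : Idx N) :
    C ((c : ℂ) • X) m = (c : ℂ) • C X m := by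
  rw [Int.cast_smul_eq_zsmul, Int.cast_smul_eq_zsmul, map_zsmul]
  rfl

theorem lift_sumK (m k : Idx N) :
    FreeLieAlgebra.lift ℂ (genImage κ C z) (sumK m k) = -((∑ p, (m p : ℂ) * κ (-k) p) • z) := by
  rw [sumK, map_sum, Finset.sum_smul, ← Finset.sum_neg_distrib]
  refine Finset.sum_congr rfl fun l _ => ?_
  rw [map_smul, FreeLieAlgebra.lift_of_apply, genImage, smul_smul, ← neg_smul, mul_neg]

theorem IsAffinization.lie_of_eq_zero (h : IsAffinization κ C z)
    {X Y : Matrix (Pos n) (Pos n) ℂ} (hX : X.trace = 0) (hY : Y.trace = 0)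
    (hXY : X * Y - Y * X = 0) (ht : (X * Y).trace = 0) (m k : Idx N) : ⁅C X m, C Y k⁆ = 0 := by
  rw [h.lie X Y hX hY, hXY, ht, map_zero, zero_mul, zero_smul, sub_zero]
  rfl

theorem IsAffinization.lie_of_trace_eq_zero (h : IsAffinization κ C z)
    {X Y : Matrix (Pos n) (Pos n) ℂ} (hX : X.trace = 0) (hY : Y.trace = 0)
    (ht : (X * Y).trace = 0) (m k : Idx N) : ⁅C X m, C Y k⁆ = C (X * Y - Y * X) (m + k) := by
  rw [h.lie X Y hX hY, ht, zero_mul, zero_smul, sub_zero]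

/-- Serre relations for two matrix units in general position. -/
theorem IsAffinization.lie_lie_eq_zero (h : IsAffinization κ C z)
    {X Y : Matrix (Pos n) (Pos n) ℂ} (hX : X.trace = 0) (hY : Y.trace = 0)
    (hXX : X * X = 0) (hXYX : X * Y * X = 0) (ht : (X * Y).trace = 0) (m k : Idx N) :
    ⁅C X m, ⁅C X m, C Y k⁆⁆ = 0 := by
  have h1 : X * (X * Y - Y * X) = 0 := by
    rw [mul_sub, ← mul_assoc, ← mul_assoc, hXX, hXYX, zero_mul, sub_zero]
  have h2 : (X * Y - Y * X) * X = 0 := by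
    rw [sub_mul, hXYX, mul_assoc, hXX, mul_zero, sub_zero]
  rw [h.lie_of_trace_eq_zero hX hY ht]
  refine h.lie_of_eq_zero hX ?_ ?_ ?_ _ _
  · rw [Matrix.trace_sub, Matrix.trace_mul_comm X Y, sub_self]
  · rw [h1, h2, sub_zero]
  · rw [h1, Matrix.trace_zero]

theorem lift_ad_pow (g : Gen n N → L) (x y : FreeLieAlgebra ℂ (Gen n N)) (d : ℕ) :
    FreeLieAlgebra.lift ℂ g ((ad ℂ (FreeLieAlgebra ℂ (Gen n N)) x ^ d) y)
      = (ad ℂ L (FreeLieAlgebra.lift ℂ g x) ^ d) (FreeLieAlgebra.lift ℂ g y) := by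
  induction d with
  | zero => rfl
  | succ d ih =>
    rw [pow_succ', pow_succ', Module.End.mul_apply, Module.End.mul_apply, ad_apply, ad_apply,
      LieHom.map_lie, ih]

/-- The Serre relations, for matrices behaving like the `E_i` or the `F_i`. -/
theorem IsAffinization.serre (h : IsAffinization κ C z) {i j : Fin (n + 1)} (hij : i ≠ j)
    {X Y : Matrix (Pos n) (Pos n) ℂ} (hX : X.trace = 0) (hY : Y.trace = 0)
    (hXX : X * X = 0) (hXYX : X * Y * X = 0) (ht : (X * Y).trace = 0)
    (hXY : affineCartan n i j = 0 → X * Y - Y * X = 0) (m k : Idx N) :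
    (ad ℂ L (C X m) ^ (-affineCartan n i j + 1).toNat) (C Y k) = 0 := by
  -- Off the diagonal only these values occur, so the Serre exponent is 1 or 2.
  have hA : affineCartan n i j = 0 ∨ affineCartan n i j = -1 := by
    rw [affineCartan, if_neg hij]
    split_ifs
    · exact Or.inr rfl
    · exact Or.inl rfl
  rcases hA with hA | hA
  · have h1 : (-affineCartan n i j + 1).toNat = 1 := by rw [hA]; rfl
    rw [h1, pow_one, ad_apply]
    exact h.lie_of_eq_zero hX hY (hXY hA) ht m k
  · have h1 : (-affineCartan n i j + 1).toNat = 2 := by rw [hA]; rfl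
    rw [h1, pow_two, Module.End.mul_apply, ad_apply, ad_apply]
    exact h.lie_lie_eq_zero hX hY hXX hXYX ht m k

/-- Each relation becomes a commutator and a trace of products of matrix units. The sign in K_{m,l}
↦ -κ_{-m,l} matches the sign of the cocycle. -/
theorem IsAffinization.lift_relator (hn : 2 ≤ n) (h : IsAffinization κ C z)
    (x : FreeLieAlgebra ℂ (Gen n N)) (hx : Relator n N x) :
    FreeLieAlgebra.lift ℂ (genImage κ C z) x = 0 := by
  have hne1 := add_one_ne_self hn
  have hne2 := add_one_add_one_ne_self hn
  -- Two nodes cannot succeed each other in both directions on a cycle of length at least 3. This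
  -- excludes the nonzero products and traces that would occur for two nodes.
  have hne : ∀ {i j : Fin (n + 1)}, i ≠ j + 1 ∨ j ≠ i + 1 := by
    intro i j
    by_cases hi : i = j + 1
    · exact Or.inr fun hj => hne2 i (by rw [← hj, ← hi])
    · exact Or.inl hi
  have hA : ∀ {i j : Fin (n + 1)}, i ≠ j → affineCartan n i j = 0 → i + 1 ≠ j ∧ j + 1 ≠ i := by
    intro i j hij h0
    rw [affineCartan, if_neg hij] at h0
    by_contra h1
    rw [if_pos (by tauto)] at h0
    exact absurd h0 (by norm_num)
  cases hx with
  | central m l g =>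
    rw [LieHom.map_lie, FreeLieAlgebra.lift_of_apply, genImage, smul_lie, h.central, smul_zero]
  | sumK m =>
    have h1 := h.kappa (-m)
    simp only [Pi.neg_apply, Int.cast_neg, neg_mul, Finset.sum_neg_distrib, neg_eq_zero] at h1
    rw [lift_sumK, h1, zero_smul, neg_zero]
  | HH i j m k =>
    rw [map_sub, LieHom.map_lie, map_smul, lift_sumK, FreeLieAlgebra.lift_of_apply,
      FreeLieAlgebra.lift_of_apply]
    change ⁅C (hMat i) m, C (hMat j) k⁆ - _ = 0
    rw [h.lie _ _ (trace_hMat i) (trace_hMat j), hMat_commutator_hMat, trace_hMat_mul_hMat hn,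
      map_zero, Pi.zero_apply, mul_smul, zero_sub, smul_neg, sub_self]
  | HE i j m k =>
    rw [map_sub, LieHom.map_lie, map_smul, FreeLieAlgebra.lift_of_apply,
      FreeLieAlgebra.lift_of_apply, FreeLieAlgebra.lift_of_apply]
    change ⁅C (hMat i) m, C (eMat j) k⁆ - (affineCartan n i j : ℂ) • C (eMat j) (m + k) = 0
    rw [h.lie_of_trace_eq_zero (trace_hMat i) (trace_eMat hn j)
      (trace_hMat_mul_nodeUnit i (hne1 j)), hMat_commutator_eMat hn, map_intCast_smul, sub_self]
  | HF i j m k =>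
    rw [map_add, LieHom.map_lie, map_smul, FreeLieAlgebra.lift_of_apply,
      FreeLieAlgebra.lift_of_apply, FreeLieAlgebra.lift_of_apply]
    change ⁅C (hMat i) m, C (fMat j) k⁆ + (affineCartan n i j : ℂ) • C (fMat j) (m + k) = 0
    have ht : (hMat i * fMat j).trace = 0 := by
      rw [fMat, mul_neg, Matrix.trace_neg, trace_hMat_mul_nodeUnit i (hne1 j).symm, neg_zero]
    rw [h.lie_of_trace_eq_zero (trace_hMat i) (trace_fMat hn j) ht, hMat_commutator_fMat hn,
      map_neg, Pi.neg_apply, map_intCast_smul, neg_add_cancel]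
  | EF_same i m k =>
    rw [map_add, LieHom.map_lie, map_add, map_smul, lift_sumK,
      FreeLieAlgebra.lift_of_apply, FreeLieAlgebra.lift_of_apply, FreeLieAlgebra.lift_of_apply]
    change ⁅C (eMat i) m, C (fMat i) k⁆ + (C (hMat i) (m + k) + _) = 0
    have hc : eMat i * fMat i - fMat i * eMat i = -hMat i := by
      rw [eMat_mul_fMat, fMat_mul_eMat, if_pos rfl, if_pos rfl, hMat]
      abel
    have ht : (eMat i * fMat i).trace = -1 := by
      rw [eMat_mul_fMat, if_pos rfl, Matrix.trace_neg, trace_nodeUnit, if_pos rfl]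
    have h2 : (2 / (affineCartan n i i : ℂ)) = 1 := by
      rw [affineCartan, if_pos rfl]
      norm_num
    rw [h.lie _ _ (trace_eMat hn i) (trace_fMat hn i), hc, ht, h2, map_neg, Pi.neg_apply, one_smul,
      neg_one_mul, neg_smul]
    abel
  | EF_ne i j hij m k =>
    rw [LieHom.map_lie, FreeLieAlgebra.lift_of_apply, FreeLieAlgebra.lift_of_apply]
    refine h.lie_of_eq_zero (trace_eMat hn i) (trace_fMat hn j) ?_ ?_ m k
    · rw [eMat_mul_fMat, fMat_mul_eMat, if_neg hij, if_neg hij.symm, sub_zero]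
    · rw [eMat_mul_fMat, if_neg hij, Matrix.trace_zero]
  | EE i m k =>
    rw [LieHom.map_lie, FreeLieAlgebra.lift_of_apply, FreeLieAlgebra.lift_of_apply]
    exact h.lie_of_eq_zero (trace_eMat hn i) (trace_eMat hn i) (sub_self _)
      (trace_nodeUnit_mul hne) m k
  | FF i m k =>
    rw [LieHom.map_lie, FreeLieAlgebra.lift_of_apply, FreeLieAlgebra.lift_of_apply]
    refine h.lie_of_eq_zero (trace_fMat hn i) (trace_fMat hn i) (sub_self _) ?_ m k
    rw [fMat, neg_mul_neg]
    exact trace_nodeUnit_mul (Or.inl (hne1 i))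
  | serreE i j hij m k =>
    rw [lift_ad_pow, FreeLieAlgebra.lift_of_apply, FreeLieAlgebra.lift_of_apply]
    refine h.serre hij (trace_eMat hn i) (trace_eMat hn j) ?_ (nodeUnit_mul_mul_self hne)
      (trace_nodeUnit_mul hne) (fun h0 => ?_) m k
    · rw [eMat, nodeUnit_mul, if_neg (hne1 i).symm]
    · obtain ⟨h1, h2⟩ := hA hij h0
      rw [eMat, eMat, nodeUnit_mul, nodeUnit_mul, if_neg h2.symm, if_neg h1.symm, sub_zero]
  | serreF i j hij m k =>
    rw [lift_ad_pow, FreeLieAlgebra.lift_of_apply, FreeLieAlgebra.lift_of_apply]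
    refine h.serre hij (trace_fMat hn i) (trace_fMat hn j) ?_ ?_ ?_ (fun h0 => ?_) m k
    · rw [fMat, neg_mul_neg, nodeUnit_mul, if_neg (hne1 i)]
    · rw [fMat, fMat, neg_mul_neg, mul_neg, nodeUnit_mul_mul_self (hne.imp Ne.symm Ne.symm).symm,
        neg_zero]
    · rw [fMat, fMat, neg_mul_neg]
      exact trace_nodeUnit_mul (hne.imp Ne.symm Ne.symm).symm
    · obtain ⟨h1, h2⟩ := hA hij h0
      rw [fMat, fMat, neg_mul_neg, neg_mul_neg, nodeUnit_mul, nodeUnit_mul, if_neg h1, if_neg h2,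
        sub_zero]

end Relations

/-! ### Cartan currents as differences of diagonal currents -/

section Diagonal

/-- The diagonal current at `p`, for the quadratic fields `Q i j` and the fields `Φ r`. -/
def diagonalCurrent {O : Type*} [AddCommGroup O] (n : ℕ) (Q : ℕ → ℕ → O) (Φ : ℕ → O) (p : ℕ) : O :=
  ∑ i ∈ Finset.Icc 1 (p - 1), Q i p - ∑ j ∈ Finset.Icc (p + 1) (n + 1), Q p j
    - ∑ r ∈ Finset.Icc p n, Φ r

variable {O : Type*} [AddCommGroup O] {n : ℕ} (Q : ℕ → ℕ → O) (Φ : ℕ → O)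

theorem diagonalCurrent_succ_sub {r : ℕ} (hr : 1 ≤ r ∧ r ≤ n) :
    diagonalCurrent n Q Φ (r + 1) - diagonalCurrent n Q Φ r
      = Q r (r + 1) + Q r (r + 1) + ∑ i ∈ Finset.Icc 1 (r - 1), (Q i (r + 1) - Q i r)
        + ∑ j ∈ Finset.Icc (r + 2) (n + 1), (Q r j - Q (r + 1) j) + Φ r := by
  obtain ⟨p, rfl⟩ : ∃ p, r = p + 1 := ⟨r - 1, by omega⟩
  rw [diagonalCurrent, diagonalCurrent, Nat.add_sub_cancel, Nat.add_sub_cancel,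
    Finset.sum_Icc_succ_top (by omega), sum_Icc_eq_add (show p + 1 + 1 ≤ n + 1 by omega),
    sum_Icc_eq_add (show p + 1 ≤ n by omega), Finset.sum_sub_distrib, Finset.sum_sub_distrib]
  abel

theorem diagonalCurrent_one_sub_last :
    diagonalCurrent n Q Φ 1 - diagonalCurrent n Q Φ (n + 1)
      = -∑ r ∈ Finset.Icc 1 n, Q r (n + 1) - ∑ r ∈ Finset.Icc 2 (n + 1), Q 1 r
        + -∑ r ∈ Finset.Icc 1 n, Φ r := by
  rw [diagonalCurrent, diagonalCurrent, Nat.add_sub_cancel, Nat.sub_self,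
    Finset.Icc_eq_empty (by omega : ¬ 1 ≤ 0), Finset.Icc_eq_empty (by omega : ¬ n + 1 + 1 ≤ n + 1),
    Finset.Icc_eq_empty (by omega : ¬ n + 1 ≤ n)]
  simp only [Finset.sum_empty]
  abel

/-- The telescoping sum behind ρ(H_0) = -∑ ρ(H_r). -/
theorem neg_sum_diagonalCurrent_sub (n : ℕ) :
    -∑ r ∈ Finset.Icc 1 n, (diagonalCurrent n Q Φ (r + 1) - diagonalCurrent n Q Φ r)
      = diagonalCurrent n Q Φ 1 - diagonalCurrent n Q Φ (n + 1) := by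
  rw [← neg_sub (diagonalCurrent n Q Φ (n + 1)),
    ← Finset.sum_Ico_sub (diagonalCurrent n Q Φ) (show 1 ≤ n + 1 by omega)]
  congr 1

theorem OpSeries.two_smul {N : ℕ} {W : Type*} [AddCommGroup W] [Module ℂ W] (F : OpSeries N W) :
    (2 : ℂ) • F = F + F :=
  _root_.two_smul ℂ F

end Diagonal

/-! ### Currents of the Chevalley matrices -/

section Generators

variable {n N : ℕ} {W : Type*} [AddCommGroup W] [Module ℂ W] [CommutingFields (Pair n) N W]
  {κ : Idx N → Fin (N + 1) → ℂ} {B : Pos n → Pos n → ℂ} {A : ℕ → ℕ → OpSeries N W}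
  {Φ : ℕ → OpSeries N W} {u : ℕ → ℕ → SummableFamily (Idx N) W}
  (h : FreeFields κ (Pos n) (fun α : Pair n => A α.1.1 α.1.2)
    (fun b : Pos n => ∑ r ∈ Finset.Icc (b : ℕ) n, Φ r) B)

/-- `M ↦ C_M` as an additive map. -/
def currentHom : Matrix (Pos n) (Pos n) ℂ →+ (Idx N → Module.End ℂ W) :=
  AddMonoidHom.ofMapSub (h.matrixCurrent (cell n)) (matrixCurrent_sub h)

theorem currentHom_apply (M : Matrix (Pos n) (Pos n) ℂ) :
    currentHom h M = h.matrixCurrent (cell n) M := rfl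

theorem isAffinization_currentHom {β γ : Pos n → ℂ}
    (hB : ∀ i j, B i j = (if i = j then 1 else 0) + β i + γ j) :
    IsAffinization κ (currentHom h) (LinearMap.id : Module.End ℂ W) where
  kappa := h.kappa
  central x := lie_eq_zero_of_comp_eq (by rw [LinearMap.id_comp, LinearMap.comp_id])
  lie X Y hX hY m k := by
    have h1 := congrFun (h.adShift_matrixCurrent (cell n) hB X Y hX hY m) (m + k)
    rw [adShift_apply, add_sub_cancel_left, Pi.sub_apply, Pi.smul_apply, kappaDot_apply,
      smul_smul] at h1
    exact h1

theorem currentHom_eMat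
    (hu : ∀ α : Pair n, CommutingFields.field α = u α.1.1 α.1.2)
    (hu0 : ∀ i j, ¬ (0 < i ∧ i < j ∧ j ≤ n + 1) → u i j = 0)
    {r : Fin (n + 1)} (hr : r ≠ 0) :
    currentHom h (eMat r)
      = (A r (r + 1)).mul ((u r (r + 1)).mul (u r (r + 1)))
        - ∑ j ∈ Finset.Icc ((r : ℕ) + 2) (n + 1), (A (r + 1) j).mul (u r j)
        + ∑ j ∈ Finset.Icc 1 ((r : ℕ) - 1), (A j r).mul (u j (r + 1))
        + ∑ j ∈ Finset.Icc ((r : ℕ) + 2) (n + 1),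
            ((A r j).mul (u r j) - (A (r + 1) j).mul (u (r + 1) j)).mul (u r (r + 1))
        + (Φ r).mul (u r (r + 1))
        + kappaD κ (u r (r + 1)) := by
  have hr0 : 0 < (r : ℕ) := Fin.pos_iff_ne_zero.2 hr
  exact matrixCurrent_single_succ h hu hu0 ⟨hr0, by omega⟩ _ _ (nodePos_succ r) (nodePos_of_ne hr)

theorem currentHom_eMat_zero
    (hu : ∀ α : Pair n, CommutingFields.field α = u α.1.1 α.1.2)
    (hu0 : ∀ i j, ¬ (0 < i ∧ i < j ∧ j ≤ n + 1) → u i j = 0)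
    (hn : 1 ≤ n) : currentHom h (eMat 0) = -A 1 (n + 1) := by
  have h1 : (nodePos (0 + 1 : Fin (n + 1)) : ℕ) = 1 := nodePos_succ 0
  rw [currentHom_apply, eMat, nodeUnit, matrixCurrent_single_of_lt h hu hu0 _ _
    (by rw [h1, nodePos_zero]; omega), h1, nodePos_zero, Finset.Icc_self, Finset.sum_singleton,
    uEnt_self, one_smul, one_smul]

theorem currentHom_fMat
    (hu : ∀ α : Pair n, CommutingFields.field α = u α.1.1 α.1.2)
    (hu0 : ∀ i j, ¬ (0 < i ∧ i < j ∧ j ≤ n + 1) → u i j = 0)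
    {r : Fin (n + 1)} (hr : r ≠ 0) :
    currentHom h (fMat r)
      = A r (r + 1) - ∑ j ∈ Finset.Icc 1 ((r : ℕ) - 1), (A j (r + 1)).mul (u j r) := by
  have hr0 : 0 < (r : ℕ) := Fin.pos_iff_ne_zero.2 hr
  rw [fMat, map_neg, currentHom_apply, nodeUnit, matrixCurrent_single_of_lt h hu hu0 _ _
    (by rw [nodePos_succ, nodePos_of_ne hr]; omega), nodePos_succ, nodePos_of_ne hr, neg_neg,
    one_smul]
  obtain ⟨p, hp⟩ : ∃ p, (r : ℕ) = p + 1 := ⟨(r : ℕ) - 1, by omega⟩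
  rw [hp, Finset.sum_Icc_succ_top (by omega), uEnt_self, one_smul, Nat.add_sub_cancel, add_comm,
    sub_eq_add_neg, ← Finset.sum_neg_distrib]
  congr 1
  refine Finset.sum_congr rfl fun j hj => ?_
  rw [Finset.mem_Icc] at hj
  rw [uEnt_of_lt (by omega), neg_smul, uVar_smul hu hu0]

theorem currentHom_fMat_zero
    (hu : ∀ α : Pair n, CommutingFields.field α = u α.1.1 α.1.2)
    (hu0 : ∀ i j, ¬ (0 < i ∧ i < j ∧ j ≤ n + 1) → u i j = 0)
    :
    currentHom h (fMat 0)
      = ∑ r ∈ Finset.Icc 1 n, ∑ j ∈ Finset.Icc (r + 1) (n + 1),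
          ∑ q ∈ (chains j).filter (fun q => ∀ k ∈ q, k ≠ j → k ≤ r),
            (-A r j).mul ((chainProdOf u (q.sort (· ≤ ·))).mul (u r (n + 1)))
        - ∑ r ∈ Finset.Icc 1 n, ∑ t ∈ Finset.Icc 1 r, ∑ q ∈ chains t,
            (Φ r).mul (chainProdOf u (q.sort (· ≤ ·) ++ [n + 1]))
        - ∑ r ∈ Finset.Icc 1 n, ∑ q ∈ chains r,
            (kappaD κ (u r (n + 1))).mul (chainProdOf u (q.sort (· ≤ ·))) := by
  have h1 : fMat (0 : Fin (n + 1)) = Matrix.single (nodePos 0) (nodePos (0 + 1)) (-1) := by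
    rw [fMat, nodeUnit, ← Matrix.single_neg]
  rw [h1]
  exact matrixCurrent_single_corner h hu hu0 _ _ nodePos_zero (nodePos_succ 0)

theorem currentHom_nodeUnit_self
    (hu : ∀ α : Pair n, CommutingFields.field α = u α.1.1 α.1.2)
    (hu0 : ∀ i j, ¬ (0 < i ∧ i < j ∧ j ≤ n + 1) → u i j = 0)
    (r : Fin (n + 1)) :
    currentHom h (nodeUnit r r)
      = diagonalCurrent n (fun i j => (A i j).mul (u i j)) Φ (nodePos r) :=
  matrixCurrent_single_self h hu hu0 _

theorem currentHom_hMat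
    (hu : ∀ α : Pair n, CommutingFields.field α = u α.1.1 α.1.2)
    (hu0 : ∀ i j, ¬ (0 < i ∧ i < j ∧ j ≤ n + 1) → u i j = 0)
    {r : Fin (n + 1)} (hr : r ≠ 0) :
    currentHom h (hMat r) = diagonalCurrent n (fun i j => (A i j).mul (u i j)) Φ (r + 1)
      - diagonalCurrent n (fun i j => (A i j).mul (u i j)) Φ r := by
  rw [hMat, map_sub, currentHom_nodeUnit_self h hu hu0, currentHom_nodeUnit_self h hu hu0,
    nodePos_succ, nodePos_of_ne hr]

theorem currentHom_hMat_zero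
    (hu : ∀ α : Pair n, CommutingFields.field α = u α.1.1 α.1.2)
    (hu0 : ∀ i j, ¬ (0 < i ∧ i < j ∧ j ≤ n + 1) → u i j = 0)
    :
    currentHom h (hMat 0) = diagonalCurrent n (fun i j => (A i j).mul (u i j)) Φ 1
      - diagonalCurrent n (fun i j => (A i j).mul (u i j)) Φ (n + 1) := by
  rw [hMat, map_sub, currentHom_nodeUnit_self h hu hu0, currentHom_nodeUnit_self h hu hu0,
    nodePos_succ, nodePos_zero]
  rfl

end Generators

/-! ### Identification with the given fields -/

section FockRealization

variable {n N : ℕ} {S : SignDecomposition N} {κ : Idx N → Fin (N + 1) → ℂ} {lam : ℕ → ℂ}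

theorem PhiF_zero (n : ℕ) (S : SignDecomposition N) (κ : Idx N → Fin (N + 1) → ℂ) (lam : ℕ → ℂ) :
    PhiF n S κ lam 0 = -∑ r ∈ Finset.Icc 1 n, PhiF n S κ lam r := by
  funext m
  rw [Pi.neg_apply, Finset.sum_apply]
  change LinearMap.lTensorHom (R := ℂ) (CX n N) _ = _
  rw [heisAll, if_pos rfl, map_neg, map_sum]
  congr 1
  refine Finset.sum_congr rfl fun r hr => ?_
  rw [Finset.mem_Icc] at hr
  rw [PhiF, heisAll, if_neg (by omega)]
  rfl

theorem aS_eq_zero (i j : ℕ) (hij : ¬ (0 < i ∧ i < j ∧ j ≤ n + 1)) : aS n S i j = 0 := by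
  refine LinearMap.ext fun v => Finsupp.ext fun k => ?_
  rw [aS_apply, aStarMode, derivX, dif_neg hij, LinearMap.rTensor_zero]
  rfl

theorem chainProd_eq (l : List ℕ) : chainProd n S l = chainProdOf (aS n S) l := by
  induction l with
  | nil => rw [chainProd, chainProdOf] <;> simp
  | cons a l ih =>
    cases l with
    | nil => rw [chainProd, chainProdOf] <;> simp
    | cons b l => rw [chainProd, chainProdOf, ih]

theorem rhoHpos_eq {r : ℕ} (hr : 1 ≤ r ∧ r ≤ n) :
    rhoHpos n S κ lam r
      = diagonalCurrent n (fun i j => (aF n S i j).mul (aS n S i j)) (PhiF n S κ lam) (r + 1)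
        - diagonalCurrent n (fun i j => (aF n S i j).mul (aS n S i j)) (PhiF n S κ lam) r := by
  rw [diagonalCurrent_succ_sub _ _ hr, rhoHpos, OpSeries.two_smul]

theorem rhoH0_eq :
    rhoH0 n S κ lam
      = diagonalCurrent n (fun i j => (aF n S i j).mul (aS n S i j)) (PhiF n S κ lam) 1
        - diagonalCurrent n (fun i j => (aF n S i j).mul (aS n S i j)) (PhiF n S κ lam) (n + 1) := by
  rw [diagonalCurrent_one_sub_last, rhoH0, PhiF_zero]

theorem rhoH0_eq_neg_sum :
    rhoH0 n S κ lam = -∑ r ∈ Finset.Icc 1 n, rhoHpos n S κ lam r := by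
  rw [Finset.sum_congr rfl fun r hr => rhoHpos_eq (Finset.mem_Icc.1 hr),
    neg_sum_diagonalCurrent_sub, rhoH0_eq]

variable (h : FreeFields κ (Pos n) (fun α : Pair n => aF n S α.1.1 α.1.2)
    (fun b : Pos n => ∑ r ∈ Finset.Icc (b : ℕ) n, PhiF n S κ lam r) (gram n))

theorem currentHom_eMat_fock (hn : 1 ≤ n) (r : Fin (n + 1)) :
    currentHom h (eMat r) = rhoE n S κ lam r := by
  by_cases hr : r = 0
  · subst hr
    rw [rhoE, if_pos rfl]
    exact currentHom_eMat_zero h (u := aS n S) (fun _ => rfl) aS_eq_zero hn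
  · rw [rhoE, if_neg hr]
    exact currentHom_eMat h (fun _ => rfl) aS_eq_zero hr

theorem currentHom_fMat_fock (r : Fin (n + 1)) :
    currentHom h (fMat r) = rhoF n S κ lam r := by
  by_cases hr : r = 0
  · subst hr
    rw [rhoF, if_pos rfl, currentHom_fMat_zero h (u := aS n S) (fun _ => rfl) aS_eq_zero, rhoF0]
    simp only [chainProd_eq]
  · rw [rhoF, if_neg hr]
    exact currentHom_fMat h (fun _ => rfl) aS_eq_zero hr

theorem currentHom_hMat_fock (r : Fin (n + 1)) :
    currentHom h (hMat r) = rhoH n S κ lam r := by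
  by_cases hr : r = 0
  · subst hr
    rw [rhoH, if_pos rfl, rhoH0_eq]
    exact currentHom_hMat_zero h (u := aS n S) (fun _ => rfl) aS_eq_zero
  · have hr0 : 0 < (r : ℕ) := Fin.pos_iff_ne_zero.2 hr
    rw [rhoH, if_neg hr, rhoHpos_eq ⟨hr0, by omega⟩]
    exact currentHom_hMat h (u := aS n S) (fun _ => rfl) aS_eq_zero hr

end FockRealization

end

end Toroidal

/-! ### The realization theorem -/

theorem mainTheorem1 (n N : ℕ) (hn : 2 ≤ n) (hN : 1 ≤ N)
    (S : Toroidal.SignDecomposition N)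
    (κ : (Fin (N + 1) → ℤ) → Fin (N + 1) → ℂ) (lam : ℕ → ℂ)
    (eqn1 : ∀ m : Fin (N + 1) → ℤ, ∑ p, (m p : ℂ) * κ m p = 0)
    (eqn2 : ∀ m k : Fin (N + 1) → ℤ, m ∈ S.pos → k ∈ S.pos →
      ∑ p, (m p : ℂ) * κ (-m - k) p = 0) :
    (∃! ρ : Toroidal.ToroidalLieAlgebra n N →ₗ⁅ℂ⁆ Module.End ℂ (Toroidal.Fock n S),
      (∀ (r : Fin (n + 1)) (m : Fin (N + 1) → ℤ),
        ρ (Toroidal.ToroidalLieAlgebra.of (.E r m)) = Toroidal.rhoE n S κ lam r m ∧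
        ρ (Toroidal.ToroidalLieAlgebra.of (.F r m)) = Toroidal.rhoF n S κ lam r m ∧
        ρ (Toroidal.ToroidalLieAlgebra.of (.H r m)) = Toroidal.rhoH n S κ lam r m) ∧
      (∀ (m : Fin (N + 1) → ℤ) (l : Fin (N + 1)),
        ρ (Toroidal.ToroidalLieAlgebra.of (.K m l)) = (-κ (-m) l) • LinearMap.id)) ∧
    Toroidal.rhoH0 n S κ lam = -∑ r ∈ Finset.Icc 1 n, Toroidal.rhoHpos n S κ lam r := by
  refine ⟨?_, Toroidal.rhoH0_eq_neg_sum⟩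
  have h := Toroidal.freeFields_fock (n := n) (S := S) lam eqn1 eqn2
  have hE := Toroidal.currentHom_eMat_fock h (by omega)
  have hF := Toroidal.currentHom_fMat_fock h
  have hH := Toroidal.currentHom_hMat_fock h
  -- By its definition `gram` has the form identity plus row function plus column function, which is
  -- why `rfl` suffices here.
  obtain ⟨ρ, hρ, huniq⟩ := Toroidal.existsUnique_hom _
    ((Toroidal.isAffinization_currentHom h fun _ _ => rfl).lift_relator hn)
  refine ⟨ρ, ⟨fun r m => ⟨?_, ?_, ?_⟩, fun m l => hρ _⟩, fun ρ' hρ' => huniq ρ' ?_⟩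
  · exact (hρ _).trans (congrFun (hE r) m)
  · exact (hρ _).trans (congrFun (hF r) m)
  · exact (hρ _).trans (congrFun (hH r) m)
  · rintro (⟨m, l⟩ | ⟨i, m⟩ | ⟨i, m⟩ | ⟨i, m⟩)
    · exact hρ'.2 m l
    · exact (hρ'.1 i m).2.2.trans (congrFun (hH i) m).symm
    · exact (hρ'.1 i m).1.trans (congrFun (hE i) m).symm
    · exact (hρ'.1 i m).2.1.trans (congrFun (hF i) m).symm
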